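/- Let $d\ge 1$ and consider the spin chain with sites $\mathbb Z$ and one-site space $\mathbb C^d$. Let $\mathcal B$ be the set of linear operators on $\mathbb C^d$ and $\mathcal B_0\subset\mathcal B$ the traceless ones. A (formal) operator is a family $\Phi=\sum_A\Phi(A)$ with $\Phi(A)\in\mathcal B_0^{\otimes A}$, where $A$ ranges over the finite subsets of $\mathbb Z$ (and $\mathcal B_0^{\otimes\emptyset}=\mathbb C$). It is Hermitian if every $\Phi(A)$ is, and at most $n$-local if $\Phi(A)=0$ unless $A$ is contained in $n$ contiguous sites. Put $\Phi|_\Lambda=\sum_{A\subset\Lambda}\Phi(A)\otimes I_{\Lambda\setminus A}\in\mathcal B^{\otimes\Lambda}$ for finite $\Lambda$. For operators of finite range, the commutator is defined by $[\Phi,\Psi](A)=\big[\Phi|_\Lambda,\Psi|_\Lambda\big]_A$ for any sufficiently large finite $\Lambda\supset A$, where $Y_A$ denotes the component of $Y$ in the decomposition $\mathcal B^{\otimes\Lambda}=\bigoplus_{A\subset\Lambda}\mathcal B_0^{\otimes A}$. The translation $\mathcal T$ moves $\Phi(A+1)$ to the sites $A$, and $\Phi$ is translation-invariant if $\mathcal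 T(\Phi)=\Phi$. $\Psi$ is a conserved quantity of $H$ if $[H,\Psi]=0$. Let $H$ be a Hermitian, translation-invariant, at most two-local operator, and write $h^{(2)}_j=H(\{j,j+1\})$ and $h^{(1)}_j=H(\{j\})$. Assume: (1) for $a\in\mathcal B_0$, each of $[I\otimes a,h^{(2)}_1]=0$ and $[a\otimes I,h^{(2)}_1]=0$ implies $a=0$; (2) for every family $a_i\in\mathcal B_0\otimes\mathcal B_0$ of operators on the sites $\{i,i+1\}$ ($i\in\mathbb Z$), if $[h^{(2)}_i,a_{i+1}]=[a_i,h^{(2)}_{i+1}]$ for all $i$, then there is a constant $\alpha\in\mathbb C$ with $a_i=\alpha h^{(2)}_i$ for all $i$. Let $B$ be a Hermitian, at most two-local operator (not necessarily translation-invariant), and set $Q^{(2)}=H$ and $Q^{(n+1)}=[B,Q^{(n)}]$ for $n\ge 2$. Suppose that $Q^{(3)}=[B,H]$ is nonzero and is a conserved quantity of $H$. Then: (i) for every $n\ge 2$, $Q^{(n)}$ is an at most $n$-local, translation-invariant conserved quantity of $H$; (ii) $[Q^{(m)},Q^{(n)}]=0$ for all $m,n\ge 2$; (iii) there are real numbers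 $c\neq 0$ and $a$ and an at most one-local operator $R$ with $[H,\mathcal T(R)-R]=0$ such that $$B=c\Big(\sum_{j\in\mathbb Z}j\big(h^{(2)}_j+h^{(1)}_j\big)+R+aH\Big).$$ -/

import Mathlib

noncomputable section

namespace SpinChain

open Filter

/-- `𝓑^{⊗A}`: the linear operators on `(ℂ^d)^{⊗A}` for a finite set of sites `A ⊂ ℤ`, as matrices in
the product basis, which is indexed by the configurations `A → Fin d`. -/
abbrev Op (d : ℕ) (A : Finset ℤ) : Type := Matrix (A → Fin d) (A → Fin d) ℂ

/-- `𝓑₀^{⊗A}`: the span of the products of traceless one-site operators, that is, the operators on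
the sites `A` whose partial trace over each single site of `A` vanishes (`ℂ` for `A = ∅`). -/
def Op₀ (d : ℕ) (A : Finset ℤ) : Submodule ℂ (Op d A) where
  carrier := {X | ∀ (i : A) (s t : A → Fin d),
    ∑ k : Fin d, X (Function.update s i k) (Function.update t i k) = 0}
  zero_mem' := by intro i s t; simp
  add_mem' := by
    intro X Y hX hY i s t
    simp only [Matrix.add_apply, Finset.sum_add_distrib, hX i s t, hY i s t, add_zero]
  smul_mem' := by
    intro c X hX i s t
    simp only [Matrix.smul_apply, ← Finset.smul_sum, hX i s t, smul_zero]

/-- Formal operators `Φ = ∑_A Φ(A)` on the infinite chain: families `Φ(A) ∈ 𝓑₀^{⊗A}` indexed by the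
finite sets of sites. -/
abbrev FormalOp (d : ℕ) : Type := ∀ A : Finset ℤ, Op₀ d A

variable {d : ℕ}

/-- The restriction of a configuration on `B` to a subset `A`. -/
def restrictConfig {A B : Finset ℤ} (h : A ⊆ B) (s : B → Fin d) : A → Fin d :=
  fun i => s ⟨i, h i.2⟩

/-- The natural embedding `𝓑^{⊗A} → 𝓑^{⊗B}`, `X ↦ X ⊗ I_{B \ A}`. -/
def embed {A B : Finset ℤ} (h : A ⊆ B) (X : Op d A) : Op d B :=
  fun s t => if ∀ i : B, (i : ℤ) ∉ A → s i = t i then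
    X (restrictConfig h s) (restrictConfig h t) else 0

/-- The restriction `Φ|_B = ∑_{A ⊆ B} Φ(A) ∈ 𝓑^{⊗B}`. -/
def restrict (Φ : FormalOp d) (B : Finset ℤ) : Op d B :=
  ∑ A ∈ B.powerset.attach, embed (Finset.mem_powerset.1 A.2) (Φ A.1 : Op d A.1)

/-- The kernel of the map `X ↦ X - (tr X / d) I` on one-site operators:
its value at `X` has the entries `∑ a' b', tracelessKernel a b a' b' * X a' b'`. -/
def tracelessKernel (a b a' b' : Fin d) : ℂ :=
  (if a = a' ∧ b = b' then 1 else 0) - (d : ℂ)⁻¹ * (if a = b ∧ a' = b' then 1 else 0)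

/-- The projection `Y ↦ Y_A` of `𝓑^{⊗B} = ⨁_{A ⊆ B} 𝓑₀^{⊗A}` onto the component `A`, as an operator
on the sites `A`: the tensor product over the sites of `B` of the map `X ↦ X - (tr X / d) I` at the
sites of `A` and of the normalized trace `X ↦ tr X / d` at the other sites. -/
def componentOp {A B : Finset ℤ} (h : A ⊆ B) (Y : Op d B) : Op d A :=
  fun s t => ∑ s' : B → Fin d, ∑ t' : B → Fin d,
    (∏ i : A, tracelessKernel (s i) (t i) (s' ⟨i, h i.2⟩) (t' ⟨i, h i.2⟩)) *
    (∏ i : B, if (i : ℤ) ∈ A then 1 else (d : ℂ)⁻¹ * (if s' i = t' i then 1 else 0)) * Y s' t'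

theorem sum_tracelessKernel (a' b' : Fin d) : ∑ k : Fin d, tracelessKernel k k a' b' = 0 := by
  have hd : (d : ℂ) ≠ 0 := by
    have := a'.pos
    exact_mod_cast this.ne'
  simp only [tracelessKernel, true_and, Finset.sum_sub_distrib, Finset.sum_const,
    Finset.card_univ, Fintype.card_fin, nsmul_eq_mul]
  by_cases hab : a' = b'
  · subst hab
    simp [hd]
  · have : ∀ k : Fin d, ¬ (k = a' ∧ k = b') := fun k hk => hab (hk.1.symm.trans hk.2)
    simp [this, hab]

theorem componentOp_mem {A B : Finset ℤ} (h : A ⊆ B) (Y : Op d B) : componentOp h Y ∈ Op₀ d A := by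
  intro i s t
  simp only [componentOp]
  rw [Finset.sum_comm]
  refine Finset.sum_eq_zero fun s' _ => ?_
  rw [Finset.sum_comm]
  refine Finset.sum_eq_zero fun t' _ => ?_
  rw [← Finset.sum_mul, ← Finset.sum_mul]
  have key : ∑ k : Fin d, ∏ j : A, tracelessKernel (Function.update s i k j)
      (Function.update t i k j) (s' ⟨j, h j.2⟩) (t' ⟨j, h j.2⟩) = 0 := by
    have hk : ∀ k : Fin d, ∏ j : A, tracelessKernel (Function.update s i k j)
        (Function.update t i k j) (s' ⟨j, h j.2⟩) (t' ⟨j, h j.2⟩) =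
        tracelessKernel k k (s' ⟨i, h i.2⟩) (t' ⟨i, h i.2⟩) *
        ∏ j ∈ Finset.univ.erase i, tracelessKernel (s j) (t j) (s' ⟨j, h j.2⟩) (t' ⟨j, h j.2⟩) := by
      intro k
      rw [← Finset.mul_prod_erase _ _ (Finset.mem_univ i)]
      congr 1
      · simp
      · refine Finset.prod_congr rfl fun j hj => ?_
        rw [Function.update_of_ne (Finset.ne_of_mem_erase hj),
          Function.update_of_ne (Finset.ne_of_mem_erase hj)]
    simp only [hk]
    rw [← Finset.sum_mul, sum_tracelessKernel, zero_mul]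
  rw [key, zero_mul, zero_mul]

/-- The component `Y_A ∈ 𝓑₀^{⊗A}` of `Y ∈ 𝓑^{⊗B}`. -/
def component {A B : Finset ℤ} (h : A ⊆ B) (Y : Op d B) : Op₀ d A :=
  ⟨componentOp h Y, componentOp_mem h Y⟩

open Classical in
/-- The commutator `[Φ, Ψ]`: its component at `A` is the value of `[Φ|_B, Ψ|_B]_A` for all
sufficiently large finite `B ⊇ A`. This value exists when `Φ` or `Ψ` has finite range; the default
`0` is never used then. -/
def opComm (Φ Ψ : FormalOp d) : FormalOp d := fun A =>
  if h : ∃ X : Op₀ d A, ∀ᶠ B : Finset ℤ in atTop, ∀ hAB : A ⊆ B,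
    component hAB (restrict Φ B * restrict Ψ B - restrict Ψ B * restrict Φ B) = X
  then h.choose else 0

/-- `Ψ` is a conserved quantity of `Φ`. -/
def IsConserved (Φ Ψ : FormalOp d) : Prop := opComm Φ Ψ = 0

/-- `Φ† = Φ`. -/
def IsSelfAdj (Φ : FormalOp d) : Prop := ∀ A, (Φ A : Op d A).IsHermitian

/-- `Φ` is at most `n`-local: each of its terms acts on at most `n` contiguous sites
`i, i + 1, …, i + n - 1`. -/
def AtMostLocal (n : ℕ) (Φ : FormalOp d) : Prop :=
  ∀ A, Φ A ≠ 0 → ∃ i : ℤ, A ⊆ Finset.Ico i (i + n)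

/-- `A + 1`. -/
def shift (A : Finset ℤ) : Finset ℤ := A.map (addRightEmbedding 1)

/-- The configuration on `A + 1` which has at `i + 1` the value of `s` at `i`. -/
def shiftConfig {A : Finset ℤ} (s : A → Fin d) : shift A → Fin d :=
  fun j => s ⟨j - 1, by
    obtain ⟨i, hi, hij⟩ := Finset.mem_map.1 j.2
    simpa [← hij] using hi⟩

theorem shiftConfig_update {A : Finset ℤ} (s : A → Fin d) (i : A) (k : Fin d) :
    shiftConfig (Function.update s i k) =
      Function.update (shiftConfig s)
        ⟨(i : ℤ) + 1, Finset.mem_map.2 ⟨i, i.2, rfl⟩⟩ k := by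
  funext j
  by_cases hj : (j : ℤ) = i + 1
  · have h1 : j = ⟨(i : ℤ) + 1, Finset.mem_map.2 ⟨i, i.2, rfl⟩⟩ := Subtype.ext hj
    subst h1
    have h2 : (⟨(i : ℤ) + 1 - 1, by simp⟩ : A) = i := Subtype.ext (by simp)
    simp only [shiftConfig, Function.update_self]
    rw [h2, Function.update_self]
  · rw [Function.update_of_ne (fun h => hj (congrArg Subtype.val h))]
    simp only [shiftConfig]
    rw [Function.update_of_ne]
    intro h
    have := congrArg Subtype.val h
    simp only at this
    omega

/-- The translation `𝓣(Φ)(A) = τ† Φ(A + 1) τ`, where `τ` is the unitary shift of the sites `A` to the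
sites `A + 1`. -/
def translateOp (Φ : FormalOp d) : FormalOp d := fun A =>
  ⟨fun s t => (Φ (shift A) : Op d (shift A)) (shiftConfig s) (shiftConfig t), by
    intro i s t
    simp only [shiftConfig_update]
    exact (Φ (shift A)).2 _ _ _⟩

/-- The standard boost `∑_j j (h_j^{(2)} + h_j^{(1)})`, where `h_j^{(2)} = H({j, j + 1})` and
`h_j^{(1)} = H({j})`: each term of `H` is multiplied by its leftmost site. -/
def standardBoost (H : FormalOp d) : FormalOp d := fun A =>
  if h : A.Nonempty then ((A.min' h : ℤ) : ℂ) • H A else 0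

/-- The operators `Q^{(2)} = H`, `Q^{(n+1)} = [B, Q^{(n)}]` (used for `n ≥ 2` only). -/
def charge (H B : FormalOp d) (n : ℕ) : FormalOp d := (opComm B)^[n - 2] H

/-- The injectivity assumption on `h_1^{(2)} = H({1, 2})`: a traceless one-site operator `a` with
`[I ⊗ a, h_1^{(2)}] = 0` or with `[a ⊗ I, h_1^{(2)}] = 0` is zero. -/
def InjectiveInteraction (H : FormalOp d) : Prop :=
  (∀ a : Op₀ d {2}, Commute (embed (B := {1, 2}) (by simp) (a : Op d {2})) (H {1, 2} : Op d {1, 2}) →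
    a = 0) ∧
  (∀ a : Op₀ d {1}, Commute (embed (B := {1, 2}) (by simp) (a : Op d {1})) (H {1, 2} : Op d {1, 2}) →
    a = 0)

/-- The commutator in `𝓑^{⊗{i, i+1, i+2}}` of an operator on `{i, i+1}` with one on `{i+1, i+2}`. -/
def adjacentComm (i : ℤ) (x : Op₀ d {i, i + 1}) (y : Op₀ d {i + 1, i + 1 + 1}) :
    Op d {i, i + 1, i + 1 + 1} :=
  let X : Op d {i, i + 1, i + 1 + 1} :=
    embed (A := {i, i + 1})
      (by intro j; simp only [Finset.mem_insert, Finset.mem_singleton]; tauto) x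
  let Y : Op d {i, i + 1, i + 1 + 1} :=
    embed (A := {i + 1, i + 1 + 1})
      (by intro j; simp only [Finset.mem_insert, Finset.mem_singleton]; tauto) y
  X * Y - Y * X

/-- The assumption that, for every family `a_i ∈ 𝓑₀ ⊗ 𝓑₀` on `{i, i+1}`, the relations
`[h_i^{(2)}, a_{i+1}] = [a_i, h_{i+1}^{(2)}]` for all `i` imply `a_i = α h_i^{(2)}` for all `i`, with a
constant `α ∈ ℂ` independent of `i`. -/
def OneDimTwoLocal (H : FormalOp d) : Prop :=
  ∀ a : ∀ i : ℤ, Op₀ d {i, i + 1},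
    (∀ i : ℤ, adjacentComm i (H {i, i + 1}) (a (i + 1)) =
      adjacentComm i (a i) (H {i + 1, i + 1 + 1})) →
    ∃ α : ℂ, ∀ i : ℤ, a i = α • H {i, i + 1}

end SpinChain

end

open SpinChain

noncomputable section

namespace SpinChain

open Filter

variable {d : ℕ}

/-! ### Operators on the infinite chain -/

/-! Write h_i for the interaction on {i, i+1}, b_i for the corresponding term of B, and ad_H for the
commutator with H. The argument rests on two facts of the form "ad_H² = 0 implies ad_H = 0".

For translation-invariant operators this is `opComm_eq_zero_of_opComm_opComm`. Since H is Hermitian,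
ad_H is symmetric for the Hilbert-Schmidt product per site, so with K = [H, Ψ] one gets ⟨K, K⟩ = ⟨Ψ,
[H, K]⟩ = 0. The rearrangement of the infinite sums behind this is a mass-transport identity. For
one-local operators without any invariance it is `opComm_eq_zero_of_one_local`. The three-site terms
of [H, [H, S]] = 0 force the two-site terms of [H, S] to be γ h_i. These are orthogonal to h_i
because tr(h[h, S]) = 0, and what remains is a one-site trace identity.

The shape of B comes from the longest terms. The four-site part of [H, [B, H]] = 0 relates
neighboring three-site terms c_i of [B, H]. Injectivity of the interaction then gives c_i = [h_i,
a_{i+1}] = [a_i, h_{i+1}] (`exists_factorization`), so a_i = γ h_i by the uniqueness assumption. A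
second use of that assumption, on b_i + γ i h_i, shows that b_i is an affine function of i times h_i
(`exists_linear_interaction`). If the slope were zero, B - βH would be one-local, and the second
fact would give [B, H] = 0.

Once B is known to be a boost, its translate differs from cH + B only by a constant and c(T(R) - R).
The latter is a one-local conserved quantity, and such quantities commute with every Q^(n)
(`one_local_opComm_iterate`). This yields the translation invariance of Q^(n+1) from the
conservation of Q^(n). By Jacobi, [H, Q^(n+1)] = -[Q^(3), Q^(n)], which commutes with H, so the
first fact gives conservation of Q^(n+1). Mutual commutativity is one more induction with Jacobi.

The infinite commutators are handled by realizing all local operators in one algebra `Chain d`,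
where a formal operator acts as a derivation. The derivation determines the operator up to its
constant term (`eq_of_eventually_lie`), which reduces the Jacobi identity to that of an associative
algebra. -/

/-- The linear operators on the functions of the configurations of the infinite chain. -/
abbrev Chain (d : ℕ) : Type := Module.End ℂ ((ℤ → Fin d) → ℂ)

instance : LieRing (Chain d) := LieRing.ofAssociativeRing

instance : LieAlgebra ℂ (Chain d) := LieAlgebra.ofAssociativeAlgebra

/-- The restriction of a configuration of the chain to the sites `A`. -/
def siteRestrict (A : Finset ℤ) (s : ℤ → Fin d) : A → Fin d := fun i => s i

/-- The configuration `s` of the chain with its values on `A` replaced by `t`. -/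
def glue {A : Finset ℤ} (s : ℤ → Fin d) (t : A → Fin d) : ℤ → Fin d :=
  fun i => if h : i ∈ A then t ⟨i, h⟩ else s i

theorem glue_of_notMem {A : Finset ℤ} (s : ℤ → Fin d) (t : A → Fin d) {i : ℤ} (h : i ∉ A) :
    glue s t i = s i := by simp [glue, h]

@[simp] theorem siteRestrict_glue {A : Finset ℤ} (s : ℤ → Fin d) (t : A → Fin d) :
    siteRestrict A (glue s t) = t := by
  funext i; simp [siteRestrict, glue]

@[simp] theorem glue_glue {A : Finset ℤ} (s : ℤ → Fin d) (t u : A → Fin d) :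
    glue (glue s t) u = glue s u := by
  funext i; by_cases h : i ∈ A <;> simp [glue, h]

@[simp] theorem glue_siteRestrict {A : Finset ℤ} (s : ℤ → Fin d) :
    glue s (siteRestrict A s) = s := by
  funext i; by_cases h : i ∈ A <;> simp [glue, h, siteRestrict]

theorem siteRestrict_glue_of_disjoint {A B : Finset ℤ} (h : Disjoint A B) (s : ℤ → Fin d)
    (t : A → Fin d) : siteRestrict B (glue s t) = siteRestrict B s := by
  funext i
  exact glue_of_notMem s t (Finset.disjoint_right.1 h i.2)

theorem glue_comm_of_disjoint {A B : Finset ℤ} (h : Disjoint A B) (s : ℤ → Fin d)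
    (t : A → Fin d) (u : B → Fin d) : glue (glue s t) u = glue (glue s u) t := by
  funext i
  by_cases hA : i ∈ A
  · have hB := Finset.disjoint_left.1 h hA
    simp [glue, hA, hB]
  · simp [glue, hA]

/-- The inclusion of the operators on the sites `A` into the operators on the chain. -/
def toChain (A : Finset ℤ) : Op d A →ₐ[ℂ] Chain d :=
  AlgHom.ofLinearMap
    { toFun := fun X =>
        { toFun := fun f s => ∑ t, X (siteRestrict A s) t * f (glue s t)
          map_add' := by
            intro f g; funext s; simp [mul_add, Finset.sum_add_distrib]
          map_smul' := by
            intro c f; funext s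
            simp only [Pi.smul_apply, smul_eq_mul, RingHom.id_apply, Finset.mul_sum]
            exact Finset.sum_congr rfl fun t _ => by ring }
      map_add' := by
        intro X Y; ext f s; simp [add_mul, Finset.sum_add_distrib]
      map_smul' := by
        intro c X
        refine LinearMap.ext fun f => funext fun s => ?_
        simp [Finset.mul_sum, mul_assoc] }
    (by
      refine LinearMap.ext fun f => funext fun s => ?_
      simp [Matrix.one_apply])
    (by
      intro X Y
      refine LinearMap.ext fun f => funext fun s => ?_
      simp only [LinearMap.coe_mk, AddHom.coe_mk, Matrix.mul_apply, Finset.sum_mul,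
        Module.End.mul_apply, siteRestrict_glue, glue_glue, Finset.mul_sum]
      rw [Finset.sum_comm]
      exact Finset.sum_congr rfl fun t _ => Finset.sum_congr rfl fun u _ => by ring)

theorem toChain_apply (A : Finset ℤ) (X : Op d A) (f : (ℤ → Fin d) → ℂ) (s : ℤ → Fin d) :
    toChain A X f s = ∑ t, X (siteRestrict A s) t * f (glue s t) := rfl

/-- Testing on the indicator of a configuration recovers a matrix entry. A background configuration
is needed outside A, which is where d ≥ 1 enters. -/
theorem toChain_injective [NeZero d] (A : Finset ℤ) :
    Function.Injective (toChain (d := d) A) := by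
  classical
  intro X Y h
  ext s t
  have h1 := congrFun (LinearMap.congr_fun h (Pi.single (glue (fun _ => 0) t) 1))
    (glue (fun _ => 0) s)
  simp only [toChain_apply, siteRestrict_glue, glue_glue] at h1
  have inj : ∀ u : A → Fin d, glue (fun _ => 0) u = glue (fun _ => (0 : Fin d)) t ↔ u = t := by
    intro u
    refine ⟨fun hu => ?_, fun hu => by rw [hu]⟩
    rw [← siteRestrict_glue (fun _ => (0 : Fin d)) u, hu, siteRestrict_glue]
  simpa [Pi.single_apply, inj] using h1

/-- This lets operators on different finite sets be added and multiplied in `Chain d` without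
carrying embeddings along. -/
theorem toChain_embed {A B : Finset ℤ} (h : A ⊆ B) (X : Op d A) :
    toChain B (embed h X) = toChain A X := by
  classical
  refine LinearMap.ext fun f => funext fun s => ?_
  simp only [toChain_apply, embed, ite_mul, zero_mul]
  rw [← Finset.sum_filter]
  refine Finset.sum_bij' (fun t _ => restrictConfig h t)
    (fun u _ => siteRestrict B (glue s u)) ?_ ?_ ?_ ?_ ?_
  · intro t _; exact Finset.mem_univ _
  · intro u _
    simp only [Finset.mem_filter, Finset.mem_univ, true_and]
    intro i hi
    simp [siteRestrict, glue, hi]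
  · intro t ht
    simp only [Finset.mem_filter, Finset.mem_univ, true_and] at ht
    funext i
    by_cases hi : (i : ℤ) ∈ A
    · simp [siteRestrict, glue, hi, restrictConfig]
    · simp only [siteRestrict, glue, hi, dif_neg, not_false_iff]
      exact ht i hi
  · intro u _
    funext i
    simp [siteRestrict, glue, restrictConfig]
  · intro t ht
    simp only [Finset.mem_filter, Finset.mem_univ, true_and] at ht
    congr 2
    funext i
    by_cases hA : i ∈ A
    · simp [glue, hA, h hA, restrictConfig]
    · by_cases hB : i ∈ B
      · simpa [glue, hA, hB, siteRestrict] using (ht ⟨i, hB⟩ hA).symm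
      · simp [glue, hA, hB]

/-- The operators on the chain which act on the sites `A`. -/
def localAlg (d : ℕ) (A : Finset ℤ) : Subalgebra ℂ (Chain d) := (toChain A).range

theorem toChain_mem (A : Finset ℤ) (X : Op d A) : toChain A X ∈ localAlg d A := ⟨X, rfl⟩

theorem localAlg_mono {A B : Finset ℤ} (h : A ⊆ B) : localAlg d A ≤ localAlg d B := by
  rintro _ ⟨X, rfl⟩
  exact ⟨embed h X, toChain_embed h X⟩

theorem commute_of_disjoint {A B : Finset ℤ} (h : Disjoint A B) {X Y : Chain d}
    (hX : X ∈ localAlg d A) (hY : Y ∈ localAlg d B) : Commute X Y := by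
  obtain ⟨X, rfl⟩ := hX
  obtain ⟨Y, rfl⟩ := hY
  refine LinearMap.ext fun f => funext fun s => ?_
  change toChain A X (toChain B Y f) s = toChain B Y (toChain A X f) s
  simp only [toChain_apply, siteRestrict_glue_of_disjoint h, siteRestrict_glue_of_disjoint h.symm,
    Finset.mul_sum]
  rw [Finset.sum_comm]
  refine Finset.sum_congr rfl fun t _ => Finset.sum_congr rfl fun u _ => ?_
  rw [glue_comm_of_disjoint h]; ring

theorem lie_mem_localAlg {A : Finset ℤ} {X Y : Chain d} (hX : X ∈ localAlg d A)
    (hY : Y ∈ localAlg d A) : ⁅X, Y⁆ ∈ localAlg d A := by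
  rw [Ring.lie_def]
  exact sub_mem (mul_mem hX hY) (mul_mem hY hX)

theorem lie_eq_zero_of_disjoint {A B : Finset ℤ} (h : Disjoint A B) {X Y : Chain d}
    (hX : X ∈ localAlg d A) (hY : Y ∈ localAlg d B) : ⁅X, Y⁆ = 0 := by
  rw [Ring.lie_def, (commute_of_disjoint h hX hY).eq, sub_self]

/-! ### Matrix units and slices -/

/-- The matrix units on the sites `A`. -/
def unit (A : Finset ℤ) (s t : A → Fin d) : Chain d := toChain A (Matrix.single s t 1)

theorem unit_mem (A : Finset ℤ) (s t : A → Fin d) : unit A s t ∈ localAlg d A := toChain_mem _ _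

theorem unit_mul_unit {A : Finset ℤ} (s t u v : A → Fin d) :
    unit A s t * unit A u v = if t = u then unit A s v else 0 := by
  rw [unit, unit, ← map_mul]
  split_ifs with h
  · rw [h, Matrix.single_mul_single_same, one_mul, unit]
  · rw [Matrix.single_mul_single_of_ne (h := h), map_zero]

theorem sum_unit (A : Finset ℤ) : ∑ s : A → Fin d, unit A s s = 1 := by
  simp only [unit]
  rw [← map_sum, ← map_one (toChain A)]
  congr 1
  ext s t
  simp [Matrix.sum_apply, Matrix.single_apply, Matrix.one_apply, ite_and]

theorem toChain_eq_sum_unit {A : Finset ℤ} (X : Op d A) :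
    toChain A X = ∑ s, ∑ t, X s t • unit A s t := by
  conv_lhs => rw [Matrix.matrix_eq_sum_single X]
  simp only [map_sum, unit, ← map_smul, Matrix.smul_single, smul_eq_mul, mul_one]

theorem unit_apply {A : Finset ℤ} (s t : A → Fin d) (f : (ℤ → Fin d) → ℂ) (r : ℤ → Fin d) :
    unit A s t f r = if siteRestrict A r = s then f (glue r t) else 0 := by
  rw [unit, toChain_apply]
  simp only [Matrix.single_apply]
  by_cases h : siteRestrict A r = s
  · simp [h]
  · simp [h, Ne.symm h]

theorem unit_union {A B : Finset ℤ} (h : Disjoint A B) (s t : (A ∪ B : Finset ℤ) → Fin d) :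
    unit (A ∪ B) s t =
      unit A (restrictConfig Finset.subset_union_left s)
        (restrictConfig Finset.subset_union_left t) *
      unit B (restrictConfig Finset.subset_union_right s)
        (restrictConfig Finset.subset_union_right t) := by
  refine LinearMap.ext fun f => funext fun r => ?_
  rw [Module.End.mul_apply, unit_apply, unit_apply, unit_apply,
    siteRestrict_glue_of_disjoint h, ← ite_and]
  have h1 : siteRestrict (A ∪ B) r = s ↔
      siteRestrict A r = restrictConfig Finset.subset_union_left s ∧
      siteRestrict B r = restrictConfig Finset.subset_union_right s := by
    constructor
    · rintro rfl; exact ⟨rfl, rfl⟩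
    · rintro ⟨h1, h2⟩
      funext ⟨i, hi⟩
      rcases Finset.mem_union.1 hi with hi | hi
      · exact congrFun h1 ⟨i, hi⟩
      · exact congrFun h2 ⟨i, hi⟩
  have h2 : glue (glue r (restrictConfig Finset.subset_union_left t))
      (restrictConfig Finset.subset_union_right t) = glue r t := by
    funext i
    by_cases hA : i ∈ A <;> by_cases hB : i ∈ B <;> simp [glue, hA, hB, restrictConfig]
  simp only [h1, h2]

/-- Linear maps on the local algebra of a disjoint union are determined by the products. -/
theorem localAlg_union_induction {A B : Finset ℤ} (h : Disjoint A B) (p : Submodule ℂ (Chain d))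
    (hp : ∀ X ∈ localAlg d A, ∀ Y ∈ localAlg d B, X * Y ∈ p) {X : Chain d}
    (hX : X ∈ localAlg d (A ∪ B)) : X ∈ p := by
  obtain ⟨X, rfl⟩ := hX
  change toChain (A ∪ B) X ∈ p
  rw [toChain_eq_sum_unit]
  refine Submodule.sum_mem _ fun s _ => Submodule.sum_mem _ fun t _ => p.smul_mem _ ?_
  rw [unit_union h]
  exact hp _ (unit_mem _ _ _) _ (unit_mem _ _ _)

/-- The coefficient of the matrix unit `unit A s t` in the expansion of an operator on the chain. -/
def slice (A : Finset ℤ) (s t : A → Fin d) : Chain d →ₗ[ℂ] Chain d :=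
  ∑ u, LinearMap.mulLeft ℂ (unit A u s) ∘ₗ LinearMap.mulRight ℂ (unit A t u)

theorem slice_apply (A : Finset ℤ) (s t : A → Fin d) (X : Chain d) :
    slice A s t X = ∑ u, unit A u s * (X * unit A t u) := by
  simp [slice]

/-- Valid for every X, local or not: summing u over e_us X e_tu isolates the part of X beyond the
matrix algebra on A, and the matrix units resolve the identity. -/
theorem eq_sum_slice_mul_unit (A : Finset ℤ) (X : Chain d) :
    X = ∑ s, ∑ t, slice A s t X * unit A s t := by
  simp only [slice_apply, Finset.sum_mul, mul_assoc, unit_mul_unit]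
  simp only [mul_ite, mul_zero, Finset.sum_ite_eq', Finset.mem_univ, if_true]
  simp only [← Finset.mul_sum, ← Finset.sum_mul, sum_unit, one_mul, mul_one]

theorem slice_mul_left {A : Finset ℤ} {X : Chain d} (hX : ∀ Y ∈ localAlg d A, Commute X Y)
    (s t : A → Fin d) (Y : Chain d) : slice A s t (X * Y) = X * slice A s t Y := by
  simp only [slice_apply, Finset.mul_sum]
  refine Finset.sum_congr rfl fun u _ => ?_
  rw [← mul_assoc, ← mul_assoc, ← (hX _ (unit_mem A u s)).eq]
  simp only [mul_assoc]

theorem slice_mul_right {A : Finset ℤ} {X : Chain d} (hX : ∀ Y ∈ localAlg d A, Commute X Y)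
    (s t : A → Fin d) (Y : Chain d) : slice A s t (Y * X) = slice A s t Y * X := by
  simp only [slice_apply, Finset.sum_mul, mul_assoc]
  refine Finset.sum_congr rfl fun u _ => ?_
  rw [(hX _ (unit_mem A t u)).eq]

theorem slice_toChain {A : Finset ℤ} (s t : A → Fin d) (X : Op d A) :
    slice A s t (toChain A X) = X s t • 1 := by
  rw [slice_apply, ← sum_unit A, Finset.smul_sum]
  refine Finset.sum_congr rfl fun u _ => ?_
  simp only [unit]
  rw [← map_mul, ← map_mul, ← map_smul, ← mul_assoc, Matrix.single_mul_mul_single]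
  simp [Matrix.smul_single]

/-- The partial evaluation of a functional of the operators on the sites `A`. -/
def slicing (A : Finset ℤ) (φ : Op d A →ₗ[ℂ] ℂ) : Chain d →ₗ[ℂ] Chain d :=
  ∑ s, ∑ t, φ (Matrix.single s t 1) • slice A s t

theorem slicing_apply (A : Finset ℤ) (φ : Op d A →ₗ[ℂ] ℂ) (X : Chain d) :
    slicing A φ X = ∑ s, ∑ t, φ (Matrix.single s t 1) • slice A s t X := by
  simp [slicing]

theorem slicing_mul_left {A : Finset ℤ} {X : Chain d} (hX : ∀ Y ∈ localAlg d A, Commute X Y)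
    (φ : Op d A →ₗ[ℂ] ℂ) (Y : Chain d) : slicing A φ (X * Y) = X * slicing A φ Y := by
  simp only [slicing_apply, slice_mul_left hX, Finset.mul_sum, mul_smul_comm]

theorem slicing_mul_right {A : Finset ℤ} {X : Chain d} (hX : ∀ Y ∈ localAlg d A, Commute X Y)
    (φ : Op d A →ₗ[ℂ] ℂ) (Y : Chain d) : slicing A φ (Y * X) = slicing A φ Y * X := by
  simp only [slicing_apply, slice_mul_right hX, Finset.sum_mul, smul_mul_assoc]

theorem slicing_lie {A : Finset ℤ} {X : Chain d} (hX : ∀ Y ∈ localAlg d A, Commute X Y)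
    (φ : Op d A →ₗ[ℂ] ℂ) (Y : Chain d) : slicing A φ ⁅X, Y⁆ = ⁅X, slicing A φ Y⁆ := by
  rw [Ring.lie_def, Ring.lie_def, map_sub, slicing_mul_left hX, slicing_mul_right hX]

theorem slicing_toChain {A : Finset ℤ} (φ : Op d A →ₗ[ℂ] ℂ) (X : Op d A) :
    slicing A φ (toChain A X) = φ X • 1 := by
  simp only [slicing_apply, slice_toChain, smul_smul]
  simp only [← Finset.sum_smul]
  congr 1
  conv_rhs => rw [Matrix.matrix_eq_sum_single X]
  simp only [map_sum]
  refine Finset.sum_congr rfl fun s _ => Finset.sum_congr rfl fun t _ => ?_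
  rw [← mul_one (X s t), ← smul_eq_mul (X s t) 1, ← Matrix.smul_single, map_smul]
  simp [mul_comm]

theorem slicing_mul_toChain {A : Finset ℤ} {X : Chain d} (hX : ∀ Y ∈ localAlg d A, Commute X Y)
    (φ : Op d A →ₗ[ℂ] ℂ) (Y : Op d A) : slicing A φ (X * toChain A Y) = φ Y • X := by
  rw [slicing_mul_left hX, slicing_toChain, mul_smul_comm, mul_one]

theorem slicing_mem {A B : Finset ℤ} (h : Disjoint A B) (φ : Op d B →ₗ[ℂ] ℂ) {X : Chain d}
    (hX : X ∈ localAlg d (A ∪ B)) : slicing B φ X ∈ localAlg d A := by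
  refine localAlg_union_induction h
    ((Subalgebra.toSubmodule (localAlg d A)).comap (slicing B φ)) ?_ hX
  rintro X hX _ ⟨Y, rfl⟩
  have := slicing_mul_toChain (fun Z hZ => commute_of_disjoint h hX hZ) φ Y
  change slicing B φ (X * toChain B Y) ∈ localAlg d A
  rw [this]
  exact Subalgebra.smul_mem _ hX _

/-! ### Partial traces and the decomposition into traceless components -/

/-- The normalized partial trace over the site `i`. -/
def siteTrace (d : ℕ) (i : ℤ) : Chain d →ₗ[ℂ] Chain d :=
  slicing {i} ((d : ℂ)⁻¹ • Matrix.traceLinearMap (({i} : Finset ℤ) → Fin d) ℂ ℂ)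

theorem siteTrace_apply (i : ℤ) (X : Chain d) :
    siteTrace d i X = (d : ℂ)⁻¹ • ∑ p, ∑ u, unit {i} u p * (X * unit {i} p u) := by
  classical
  rw [siteTrace, slicing_apply, Finset.smul_sum]
  refine Finset.sum_congr rfl fun p _ => ?_
  rw [Finset.sum_eq_single p]
  · simp [slice_apply]
  · intro q _ hq
    simp [Matrix.trace_single_eq_of_ne _ _ _ hq.symm]
  · simp

theorem siteTrace_of_notMem [NeZero d] {A : Finset ℤ} {i : ℤ} (hi : i ∉ A) {X : Chain d}
    (hX : X ∈ localAlg d A) : siteTrace d i X = X := by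
  have h : Disjoint A {i} := by simpa using hi
  have := slicing_mul_toChain (fun Z hZ => commute_of_disjoint h hX hZ)
    ((d : ℂ)⁻¹ • Matrix.traceLinearMap (({i} : Finset ℤ) → Fin d) ℂ ℂ) 1
  rw [map_one, mul_one] at this
  rw [siteTrace, this]
  have hd : (d : ℂ) ≠ 0 := by exact_mod_cast NeZero.ne d
  simp [hd]

theorem siteTrace_toChain_of_mem {A : Finset ℤ} {X : Op d A} (hX : X ∈ Op₀ d A) {i : ℤ}
    (hi : i ∈ A) : siteTrace d i (toChain A X) = 0 := by
  classical
  rw [siteTrace_apply]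
  refine smul_eq_zero_of_right _ ?_
  refine LinearMap.ext fun f => funext fun s => ?_
  simp only [LinearMap.sum_apply, Finset.sum_apply, Module.End.mul_apply, unit_apply,
    toChain_apply, Finset.sum_ite_eq, Finset.mem_univ, if_true, LinearMap.zero_apply, Pi.zero_apply,
    mul_ite, mul_zero]
  have e1 : ∀ p : ({i} : Finset ℤ) → Fin d, siteRestrict A (glue s p) =
      Function.update (siteRestrict A s) ⟨i, hi⟩ (p ⟨i, Finset.mem_singleton_self i⟩) := by
    intro p
    funext j
    by_cases hj : (j : ℤ) = i
    · have : j = ⟨i, hi⟩ := Subtype.ext hj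
      subst this
      simp [siteRestrict, glue]
    · rw [Function.update_of_ne (fun h => hj (congrArg Subtype.val h))]
      simp [siteRestrict, glue, hj]
  have e2 : ∀ (p : ({i} : Finset ℤ) → Fin d) (t : A → Fin d), glue (glue s p) t = glue s t := by
    intro p t
    funext j
    by_cases hj : j ∈ A
    · simp [glue, hj]
    · have : j ≠ i := fun h => hj (h ▸ hi)
      simp [glue, hj, this]
  have e3 : ∀ t : A → Fin d, glue (glue s t) (siteRestrict {i} s) =
      glue s (Function.update t ⟨i, hi⟩ (s i)) := by
    intro t
    funext j
    by_cases hj : j = i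
    · subst hj; simp [glue, hi, siteRestrict]
    · by_cases hjA : j ∈ A
      · simp [glue, hj, hjA]
      · simp [glue, hj, hjA]
  have e4 : ∀ (p : ({i} : Finset ℤ) → Fin d) (t : A → Fin d),
      siteRestrict {i} (glue s t) = p ↔ t ⟨i, hi⟩ = p ⟨i, Finset.mem_singleton_self i⟩ := by
    intro p t
    constructor
    · rintro rfl; simp [siteRestrict, glue, hi]
    · intro h
      funext ⟨j, hj⟩
      obtain rfl := Finset.mem_singleton.1 hj
      simpa [siteRestrict, glue, hi] using h
  simp only [e1, e2, e3, e4]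
  -- Changing the value of t at i from p to s i removes p from the argument of f. The sum over p
  -- then becomes exactly the one-site trace that vanishes for traceless operators.
  have e5 : ∀ p : ({i} : Finset ℤ) → Fin d, (∑ t : A → Fin d,
      if t ⟨i, hi⟩ = p ⟨i, Finset.mem_singleton_self i⟩ then
        X (Function.update (siteRestrict A s) ⟨i, hi⟩ (p ⟨i, Finset.mem_singleton_self i⟩)) t *
          f (glue s (Function.update t ⟨i, hi⟩ (s i))) else 0) =
      ∑ t : A → Fin d, if t ⟨i, hi⟩ = s i then
        X (Function.update (siteRestrict A s) ⟨i, hi⟩ (p ⟨i, Finset.mem_singleton_self i⟩))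
          (Function.update t ⟨i, hi⟩ (p ⟨i, Finset.mem_singleton_self i⟩)) * f (glue s t) else 0 := by
    intro p
    rw [← Finset.sum_filter, ← Finset.sum_filter]
    refine Finset.sum_bij' (fun t _ => Function.update t ⟨i, hi⟩ (s i))
      (fun t _ => Function.update t ⟨i, hi⟩ (p ⟨i, Finset.mem_singleton_self i⟩)) ?_ ?_ ?_ ?_ ?_
    · intro t _; simp
    · intro t _; simp
    · intro t ht
      simp only [Finset.mem_filter, Finset.mem_univ, true_and] at ht
      simp [← ht]
    · intro t ht
      simp only [Finset.mem_filter, Finset.mem_univ, true_and] at ht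
      simp [← ht]
    · intro t ht
      simp only [Finset.mem_filter, Finset.mem_univ, true_and] at ht
      simp [← ht]
  simp only [e5]
  rw [Finset.sum_comm]
  refine Finset.sum_eq_zero fun t _ => ?_
  split_ifs with ht
  · rw [← Finset.sum_mul]
    convert zero_mul _
    rw [← hX ⟨i, hi⟩ (siteRestrict A s) t]
    exact Fintype.sum_equiv (Equiv.funUnique ({i} : Finset ℤ) (Fin d)) _ _ fun p => rfl
  · simp

theorem siteTrace_mem {A : Finset ℤ} (i : ℤ) {X : Chain d} (hX : X ∈ localAlg d A) :
    siteTrace d i X ∈ localAlg d (A.erase i) := by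
  refine slicing_mem (by simp) _ (localAlg_mono ?_ hX)
  intro j hj
  by_cases h : j = i <;> simp [h, hj]

theorem siteTrace_mul_left {A : Finset ℤ} {i : ℤ} (hi : i ∉ A) {X : Chain d}
    (hX : X ∈ localAlg d A) (Y : Chain d) : siteTrace d i (X * Y) = X * siteTrace d i Y :=
  slicing_mul_left (fun _ hZ => commute_of_disjoint (by simpa using hi) hX hZ) _ _

theorem siteTrace_mul_right {A : Finset ℤ} {i : ℤ} (hi : i ∉ A) {X : Chain d}
    (hX : X ∈ localAlg d A) (Y : Chain d) : siteTrace d i (Y * X) = siteTrace d i Y * X :=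
  slicing_mul_right (fun _ hZ => commute_of_disjoint (by simpa using hi) hX hZ) _ _

theorem siteTrace_lie {A : Finset ℤ} {i : ℤ} (hi : i ∉ A) {X : Chain d}
    (hX : X ∈ localAlg d A) (Y : Chain d) : siteTrace d i ⁅X, Y⁆ = ⁅X, siteTrace d i Y⁆ :=
  slicing_lie (fun _ hZ => commute_of_disjoint (by simpa using hi) hX hZ) _ _

theorem siteTrace_lie' {A : Finset ℤ} {i : ℤ} (hi : i ∉ A) {X : Chain d}
    (hX : X ∈ localAlg d A) (Y : Chain d) : siteTrace d i ⁅Y, X⁆ = ⁅siteTrace d i Y, X⁆ := by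
  rw [← lie_skew Y X, map_neg, siteTrace_lie hi hX, lie_skew]

theorem siteTrace_slicing {A : Finset ℤ} {i : ℤ} (hi : i ∉ A) (φ : Op d A →ₗ[ℂ] ℂ)
    (X : Chain d) : siteTrace d i (slicing A φ X) = slicing A φ (siteTrace d i X) := by
  rw [slicing_apply, slicing_apply]
  simp only [map_sum, map_smul, slice_apply]
  refine Finset.sum_congr rfl fun s _ => Finset.sum_congr rfl fun t _ => ?_
  congr 1
  refine Finset.sum_congr rfl fun u _ => ?_
  rw [siteTrace_mul_left hi (unit_mem _ _ _), siteTrace_mul_right hi (unit_mem _ _ _)]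

/-- The partial trace over the only common site of two operators kills their commutator. -/
theorem siteTrace_lie_of_inter {A B : Finset ℤ} {i : ℤ} (h : A ∩ B ⊆ {i}) {X Y : Chain d}
    (hX : X ∈ localAlg d A) (hY : Y ∈ localAlg d B) : siteTrace d i ⁅X, Y⁆ = 0 := by
  have hsub : ∀ C : Finset ℤ, C ⊆ C.erase i ∪ {i} := fun C j hj => by
    by_cases h : j = i <;> simp [h, hj]
  have hdis : ∀ C : Finset ℤ, Disjoint (C.erase i) {i} := fun C => by simp
  have hAB : Disjoint (A.erase i) (B.erase i) := by
    refine Finset.disjoint_left.2 fun j hj hj' => ?_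
    have : j ∈ A ∩ B :=
      Finset.mem_inter.2 ⟨Finset.mem_of_mem_erase hj, Finset.mem_of_mem_erase hj'⟩
    exact (Finset.ne_of_mem_erase hj) (Finset.mem_singleton.1 (h this))
  let p : Chain d → Submodule ℂ (Chain d) := fun Y =>
    LinearMap.ker (siteTrace d i ∘ₗ
      (LinearMap.mulRight ℂ Y - LinearMap.mulLeft ℂ Y))
  have hp : ∀ X Y, X ∈ p Y ↔ siteTrace d i ⁅X, Y⁆ = 0 := fun X Y => by
    simp [p, Ring.lie_def]
  refine (hp X Y).1 (localAlg_union_induction (hdis A) (p Y) ?_ (localAlg_mono (hsub A) hX))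
  intro x hx y hy
  rw [hp, ← lie_skew (x * y) Y, map_neg, neg_eq_zero, ← hp]
  refine localAlg_union_induction (hdis B) (p (x * y)) ?_ (localAlg_mono (hsub B) hY)
  intro x' hx' y' hy'
  rw [hp]
  obtain ⟨M, rfl⟩ := hy
  obtain ⟨M', rfl⟩ := hy'
  change siteTrace d i ⁅x' * toChain {i} M', x * toChain {i} M⁆ = 0
  have c1 := (commute_of_disjoint hAB hx hx').eq
  have c2 := (commute_of_disjoint (hdis A) hx (toChain_mem {i} M')).eq
  have c3 := (commute_of_disjoint (hdis B) hx' (toChain_mem {i} M)).eq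
  -- Away from the common site all factors commute, so only a one-site matrix commutator is left,
  -- and its trace is zero.
  have : ⁅x' * toChain {i} M', x * toChain {i} M⁆ = x * x' * toChain {i} (M' * M - M * M') := by
    rw [Ring.lie_def, map_sub, map_mul, map_mul, mul_sub]
    congr 1
    · rw [mul_assoc x', ← mul_assoc (toChain {i} M'), ← c2, mul_assoc x, ← mul_assoc x', ← c1]
    · rw [mul_assoc x, ← mul_assoc (toChain {i} M), ← c3]
      simp only [mul_assoc]
  rw [this, siteTrace, slicing_mul_toChain]
  · simp [Matrix.trace_mul_comm M M']
  · intro Z hZ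
    exact (commute_of_disjoint (hdis A) hx hZ).mul_left (commute_of_disjoint (hdis B) hx' hZ)

/-- A traceless operator on the sites `A` as an operator on the chain. -/
def termOp (A : Finset ℤ) : Op₀ d A →ₗ[ℂ] Chain d := (toChain A).toLinearMap ∘ₗ (Op₀ d A).subtype

theorem termOp_apply (A : Finset ℤ) (X : Op₀ d A) : termOp A X = toChain A (X : Op d A) := rfl

theorem termOp_mem (A : Finset ℤ) (X : Op₀ d A) : termOp A X ∈ localAlg d A := toChain_mem _ _

theorem termOp_injective [NeZero d] (A : Finset ℤ) : Function.Injective (termOp (d := d) A) :=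
  fun _ _ h => Subtype.ext (toChain_injective A h)

theorem siteTrace_termOp [NeZero d] (i : ℤ) (A : Finset ℤ) (X : Op₀ d A) :
    siteTrace d i (termOp A X) = if i ∈ A then 0 else termOp A X := by
  split_ifs with h
  · exact siteTrace_toChain_of_mem X.2 h
  · exact siteTrace_of_notMem h (termOp_mem A X)

/-- Each partial trace kills the terms whose support contains the site and fixes the others.
Applying it site by site sorts the sum by the intersection of the support with a growing set D, and
once D contains all supports only one term is left. -/
theorem eq_zero_of_sum_termOp_eq_zero [NeZero d] (S : Finset (Finset ℤ)) (x : ∀ A, Op₀ d A)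
    (h : ∑ A ∈ S, termOp A (x A) = 0) {A : Finset ℤ} (hA : A ∈ S) : x A = 0 := by
  have key : ∀ D P : Finset ℤ, P ⊆ D → ∑ A ∈ S with A ∩ D = P, termOp A (x A) = 0 := by
    intro D
    induction D using Finset.induction_on with
    | empty =>
      intro P hP
      rw [Finset.subset_empty.1 hP]
      simpa using h
    | insert i D hi ih =>
      intro P hP
      have h1 := ih (P.erase i) (by
        intro j hj
        have := hP (Finset.mem_of_mem_erase hj)
        exact (Finset.mem_insert.1 this).resolve_left (Finset.ne_of_mem_erase hj))
      have h2 := congrArg (siteTrace d i) h1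
      rw [map_zero, map_sum] at h2
      simp only [siteTrace_termOp] at h2
      have h3 : ∑ A ∈ S with A ∩ D = P.erase i, (if i ∈ A then termOp A (x A) else 0) = 0 := by
        have e : ∑ A ∈ S with A ∩ D = P.erase i, (if i ∈ A then termOp A (x A) else 0) +
            ∑ A ∈ S with A ∩ D = P.erase i, (if i ∈ A then 0 else termOp A (x A)) =
            ∑ A ∈ S with A ∩ D = P.erase i, termOp A (x A) := by
          rw [← Finset.sum_add_distrib]
          refine Finset.sum_congr rfl fun A _ => ?_
          by_cases hA : i ∈ A <;> simp [hA]
        rwa [h2, h1, add_zero] at e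
      by_cases hiP : i ∈ P
      · rw [← Finset.sum_filter, Finset.filter_filter] at h3
        rw [← h3]
        refine Finset.sum_congr (Finset.filter_congr fun A _ => ?_) fun _ _ => rfl
        constructor
        · rintro rfl
          refine ⟨?_, by simp at hiP; exact hiP⟩
          ext j
          simp only [Finset.mem_inter, Finset.mem_erase, Finset.mem_insert]
          constructor
          · rintro ⟨a, b⟩
            exact ⟨fun h => hi (h ▸ b), a, Or.inr b⟩
          · rintro ⟨a, b, c⟩
            exact ⟨b, c.resolve_left a⟩
        · rintro ⟨h1, h2⟩
          rw [Finset.inter_insert_of_mem h2, h1, Finset.insert_erase hiP]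
      · have h4 : ∑ A ∈ S with A ∩ D = P.erase i, (if i ∉ A then termOp A (x A) else 0) = 0 := by
          rw [← h2]
          exact Finset.sum_congr rfl fun A _ => by split_ifs <;> simp_all
        rw [← Finset.sum_filter, Finset.filter_filter] at h4
        rw [← h4]
        refine Finset.sum_congr (Finset.filter_congr fun A _ => ?_) fun _ _ => rfl
        rw [Finset.erase_eq_of_notMem hiP]
        constructor
        · rintro rfl
          have hiA : i ∉ A := by simpa using hiP
          exact ⟨(Finset.inter_insert_of_notMem hiA).symm, hiA⟩
        · rintro ⟨h1, h2⟩
          rw [Finset.inter_insert_of_notMem h2, h1]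
  have h5 := key (S.biUnion id) A (Finset.subset_biUnion_of_mem id hA)
  rw [Finset.sum_eq_single_of_mem A] at h5
  · exact termOp_injective A (by rw [h5, map_zero])
  · simp only [Finset.mem_filter]
    exact ⟨hA, Finset.inter_eq_left.2 (Finset.subset_biUnion_of_mem id hA)⟩
  · intro C hC hCA
    simp only [Finset.mem_filter] at hC
    have h6 : C ∩ S.biUnion id = C := Finset.inter_eq_left.2 (Finset.subset_biUnion_of_mem id hC.1)
    rw [h6] at hC
    exact absurd hC.2 hCA

/-- Linear independence of the traceless spaces gives a left inverse on all of `Chain d`. Its values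
on non-local operators are arbitrary. -/
theorem exists_coeff (d : ℕ) [NeZero d] : ∃ π : Chain d →ₗ[ℂ] Π₀ A : Finset ℤ, Op₀ d A,
    ∀ (A : Finset ℤ) (X : Op₀ d A), π (termOp A X) = DFinsupp.single A X := by
  classical
  let f : (Π₀ A : Finset ℤ, Op₀ d A) →ₗ[ℂ] Chain d := DFinsupp.lsum ℂ fun A => termOp A
  have hf : LinearMap.ker f = ⊥ := by
    rw [LinearMap.ker_eq_bot']
    intro x hx
    ext1 A
    by_cases hA : A ∈ x.support
    · rw [DFinsupp.lsum_apply_apply, DFinsupp.sumAddHom_apply] at hx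
      exact eq_zero_of_sum_termOp_eq_zero x.support x hx hA
    · simpa using hA
  obtain ⟨π, hπ⟩ := LinearMap.exists_leftInverse_of_injective
    (K := ℂ) (V := Π₀ A : Finset ℤ, Op₀ d A) (V' := Chain d) f hf
  refine ⟨π, fun A X => ?_⟩
  have := LinearMap.congr_fun hπ (DFinsupp.single A X)
  simpa [f] using this

/-- The component on the sites `A` of an operator on the chain. -/
def coeff [NeZero d] (A : Finset ℤ) : Chain d →ₗ[ℂ] Op₀ d A :=
  (DFinsupp.lapply A) ∘ₗ (exists_coeff d).choose

theorem coeff_termOp_self [NeZero d] (A : Finset ℤ) (X : Op₀ d A) : coeff A (termOp A X) = X := by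
  rw [coeff, LinearMap.comp_apply, (exists_coeff d).choose_spec A X]
  simp

theorem coeff_termOp_of_ne [NeZero d] {A B : Finset ℤ} (h : B ≠ A) (X : Op₀ d B) :
    coeff A (termOp B X) = 0 := by
  rw [coeff, LinearMap.comp_apply, (exists_coeff d).choose_spec B X]
  exact DFinsupp.single_eq_of_ne h.symm

/-- In this form the projection is a product of one-site kernels over all of B, so the sum over A
factorizes. -/
theorem embed_componentOp {A B : Finset ℤ} (h : A ⊆ B) (Y : Op d B) (s t : B → Fin d) :
    embed h (componentOp h Y) s t = ∑ s', ∑ t', (∏ i : B, if (i : ℤ) ∈ A then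
      tracelessKernel (s i) (t i) (s' i) (t' i) else
      (d : ℂ)⁻¹ * (if s i = t i ∧ s' i = t' i then 1 else 0)) * Y s' t' := by
  by_cases hst : ∀ i : B, (i : ℤ) ∉ A → s i = t i
  · simp only [embed, if_pos hst, componentOp]
    refine Finset.sum_congr rfl fun s' _ => Finset.sum_congr rfl fun t' _ => ?_
    congr 1
    let F : ℤ → ℂ := fun i => if hi : i ∈ B then
      tracelessKernel (s ⟨i, hi⟩) (t ⟨i, hi⟩) (s' ⟨i, hi⟩) (t' ⟨i, hi⟩) else 1
    have h1 : ∏ i : A, tracelessKernel (restrictConfig h s i) (restrictConfig h t i)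
        (s' ⟨i, h i.2⟩) (t' ⟨i, h i.2⟩) = ∏ i : B, if (i : ℤ) ∈ A then F i else 1 := by
      rw [Finset.prod_coe_sort B fun i => if i ∈ A then F i else 1, Finset.prod_ite_mem,
        Finset.inter_eq_right.2 h, ← Finset.prod_coe_sort A F]
      refine Finset.prod_congr rfl fun i _ => ?_
      simp [F, h i.2, restrictConfig]
    rw [h1, ← Finset.prod_mul_distrib]
    refine Finset.prod_congr rfl fun i _ => ?_
    by_cases hi : (i : ℤ) ∈ A
    · simp [hi, F]
    · simp [hi, hst i hi]
  · simp only [embed, if_neg hst]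
    push Not at hst
    obtain ⟨i, hi, hsi⟩ := hst
    symm
    refine Finset.sum_eq_zero fun s' _ => Finset.sum_eq_zero fun t' _ => ?_
    rw [Finset.prod_eq_zero (Finset.mem_univ i), zero_mul]
    simp [hi, hsi]

/-- At each site the traceless projection and the normalized trace add up to the identity. Expanding
the product of these sums over the sites of B gives one summand for every subset. -/
theorem sum_embed_component {B : Finset ℤ} (Y : Op d B) :
    ∑ A ∈ B.powerset.attach, embed (Finset.mem_powerset.1 A.2)
      (component (Finset.mem_powerset.1 A.2) Y : Op d A.1) = Y := by
  ext s t
  rw [Matrix.sum_apply]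
  simp only [component, embed_componentOp]
  rw [Finset.sum_comm]
  have h1 : ∀ s' t' : B → Fin d, ∑ A ∈ B.powerset, ∏ i : B, (if (i : ℤ) ∈ A then
      tracelessKernel (s i) (t i) (s' i) (t' i) else
      (d : ℂ)⁻¹ * (if s i = t i ∧ s' i = t' i then 1 else 0)) =
      if s = s' ∧ t = t' then 1 else 0 := by
    intro s' t'
    let F : ℤ → ℂ := fun i => if hi : i ∈ B then
      tracelessKernel (s ⟨i, hi⟩) (t ⟨i, hi⟩) (s' ⟨i, hi⟩) (t' ⟨i, hi⟩) else 1
    let G : ℤ → ℂ := fun i => if hi : i ∈ B then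
      (d : ℂ)⁻¹ * (if s ⟨i, hi⟩ = t ⟨i, hi⟩ ∧ s' ⟨i, hi⟩ = t' ⟨i, hi⟩ then 1 else 0) else 1
    have h2 : ∀ A ∈ B.powerset, ∏ i : B, (if (i : ℤ) ∈ A then
        tracelessKernel (s i) (t i) (s' i) (t' i) else
        (d : ℂ)⁻¹ * (if s i = t i ∧ s' i = t' i then 1 else 0)) =
        (∏ i ∈ A, F i) * ∏ i ∈ B \ A, G i := by
      intro A hA
      rw [Finset.mem_powerset] at hA
      have : ∏ i : B, (if (i : ℤ) ∈ A then
        tracelessKernel (s i) (t i) (s' i) (t' i) else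
        (d : ℂ)⁻¹ * (if s i = t i ∧ s' i = t' i then 1 else 0)) =
        ∏ i : B, (fun j : ℤ => if j ∈ A then F j else G j) i := by
        refine Finset.prod_congr rfl fun i _ => ?_
        by_cases hi : (i : ℤ) ∈ A <;> simp [hi, F, G]
      rw [this, Finset.prod_coe_sort B fun j : ℤ => if j ∈ A then F j else G j, Finset.prod_ite]
      congr 1
      · refine Finset.prod_congr ?_ fun _ _ => rfl
        ext j; simp only [Finset.mem_filter]; exact ⟨fun h => h.2, fun h => ⟨hA h, h⟩⟩
      · refine Finset.prod_congr ?_ fun _ _ => rfl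
        ext j; simp
    rw [Finset.sum_congr rfl h2, ← Finset.prod_add, ← Finset.prod_coe_sort]
    have h3 : ∀ i : B, F i + G i = if s i = s' i ∧ t i = t' i then 1 else 0 := by
      intro i
      simp only [F, G, i.2, dif_pos, tracelessKernel, sub_add_cancel]
    simp only [h3]
    rw [Finset.prod_ite_zero]
    simp [funext_iff, forall_and]
  have h4 : ∀ s' : B → Fin d, ∑ A ∈ B.powerset.attach, ∑ t', (∏ i : B, (if (i : ℤ) ∈ A.1 then
      tracelessKernel (s i) (t i) (s' i) (t' i) else
      (d : ℂ)⁻¹ * (if s i = t i ∧ s' i = t' i then 1 else 0))) * Y s' t' =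
      ∑ t', (if s = s' ∧ t = t' then 1 else 0) * Y s' t' := by
    intro s'
    rw [Finset.sum_comm]
    refine Finset.sum_congr rfl fun t' _ => ?_
    rw [← Finset.sum_mul, ← h1 s' t', ← Finset.sum_attach B.powerset]
  refine (Finset.sum_congr rfl fun s' _ => h4 s').trans ?_
  simp [ite_and]

theorem toChain_eq_sum_component {B : Finset ℤ} (Y : Op d B) :
    toChain B Y = ∑ A ∈ B.powerset.attach, termOp A.1 (component (Finset.mem_powerset.1 A.2) Y) := by
  conv_lhs => rw [← sum_embed_component Y]
  rw [map_sum]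
  exact Finset.sum_congr rfl fun A _ => toChain_embed _ _

/-! ### Components of local operators on the chain -/

section Coeff

variable [NeZero d]

theorem coeff_toChain {A B : Finset ℤ} (h : A ⊆ B) (Y : Op d B) :
    coeff A (toChain B Y) = component h Y := by
  rw [toChain_eq_sum_component, map_sum,
    Finset.sum_eq_single_of_mem ⟨A, Finset.mem_powerset.2 h⟩ (Finset.mem_attach _ _)]
  · exact coeff_termOp_self _ _
  · intro C _ hC
    exact coeff_termOp_of_ne (fun h => hC (Subtype.ext h)) _

theorem eq_sum_coeff {B : Finset ℤ} {X : Chain d} (hX : X ∈ localAlg d B) :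
    X = ∑ A ∈ B.powerset, termOp A (coeff A X) := by
  obtain ⟨Y, rfl⟩ := hX
  change toChain B Y = ∑ A ∈ B.powerset, termOp A (coeff A (toChain B Y))
  conv_lhs => rw [toChain_eq_sum_component]
  rw [← Finset.sum_attach B.powerset]
  exact Finset.sum_congr rfl fun A _ => by rw [coeff_toChain (Finset.mem_powerset.1 A.2)]

theorem coeff_sum_termOp (S : Finset (Finset ℤ)) (x : ∀ A, Op₀ d A) (A : Finset ℤ) :
    coeff A (∑ C ∈ S, termOp C (x C)) = if A ∈ S then x A else 0 := by
  rw [map_sum]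
  split_ifs with h
  · rw [Finset.sum_eq_single_of_mem A h fun C _ hC => coeff_termOp_of_ne hC _, coeff_termOp_self]
  · exact Finset.sum_eq_zero fun C hC => coeff_termOp_of_ne (fun e : C = A => h (e ▸ hC)) _

theorem coeff_eq_zero {A B : Finset ℤ} {X : Chain d} (hX : X ∈ localAlg d B) (h : ¬ A ⊆ B) :
    coeff A X = 0 := by
  rw [eq_sum_coeff hX, coeff_sum_termOp, if_neg (by simpa using h)]

theorem coeff_siteTrace {A B : Finset ℤ} {i : ℤ} (hi : i ∈ A) {X : Chain d}
    (hX : X ∈ localAlg d B) : coeff A (siteTrace d i X) = 0 :=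
  coeff_eq_zero (siteTrace_mem i hX) fun h => by simpa using h hi

/-- An operator on the sites `A` whose partial traces vanish is its own component on `A`. -/
theorem termOp_coeff {A : Finset ℤ} {X : Chain d} (hX : X ∈ localAlg d A)
    (h : ∀ i ∈ A, siteTrace d i X = 0) : termOp A (coeff A X) = X := by
  have key : ∀ C ∈ A.powerset, C ≠ A → termOp C (coeff C X) = 0 := by
    intro C hC hCA
    obtain ⟨i, hi, hiC⟩ := Finset.exists_of_ssubset
      (LE.le.ssubset_of_ne (Finset.mem_powerset.1 hC) hCA)
    have h1 := h i hi
    rw [eq_sum_coeff hX, map_sum] at h1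
    simp only [siteTrace_termOp] at h1
    have h2 : ∀ D : Finset ℤ, (if i ∈ D then 0 else termOp D (coeff D X)) =
        termOp D ((fun D => if i ∈ D then 0 else coeff D X) D) := by
      intro D; by_cases hD : i ∈ D <;> simp [hD]
    rw [Finset.sum_congr rfl fun D _ => h2 D] at h1
    have h3 := eq_zero_of_sum_termOp_eq_zero _ (fun D => if i ∈ D then 0 else coeff D X) h1 hC
    simp only [hiC, if_false] at h3
    rw [h3, map_zero]
  conv_rhs => rw [eq_sum_coeff hX]
  rw [Finset.sum_eq_single_of_mem A (Finset.mem_powerset_self A) key]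

/-- The commutator of traceless operators with one common site is traceless. -/
theorem termOp_coeff_lie {A B C : Finset ℤ} {i : ℤ} (hC : A ∪ B = C) (h : A ∩ B = {i})
    {X Y : Chain d} (hX : X ∈ localAlg d A) (hX0 : ∀ j ∈ A, siteTrace d j X = 0)
    (hY : Y ∈ localAlg d B) (hY0 : ∀ j ∈ B, siteTrace d j Y = 0) :
    termOp C (coeff C ⁅X, Y⁆) = ⁅X, Y⁆ := by
  subst hC
  refine termOp_coeff (lie_mem_localAlg (localAlg_mono Finset.subset_union_left hX)
    (localAlg_mono Finset.subset_union_right hY)) fun j hj => ?_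
  by_cases hA : j ∈ A
  · by_cases hB : j ∈ B
    · obtain rfl : j = i := by
        have : j ∈ A ∩ B := Finset.mem_inter.2 ⟨hA, hB⟩
        rw [h] at this
        exact Finset.mem_singleton.1 this
      exact siteTrace_lie_of_inter h.le hX hY
    · rw [siteTrace_lie' hB hY, hX0 j hA, zero_lie]
  · have hB : j ∈ B := (Finset.mem_union.1 hj).resolve_left hA
    rw [siteTrace_lie hA hX, hY0 j hB, lie_zero]

end Coeff

/-! ### Formal operators on the chain -/

/-- The term `Φ(A)` as an operator on the chain. -/
def term (Φ : FormalOp d) (A : Finset ℤ) : Chain d := termOp A (Φ A)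

/-- `Φ|_B` as an operator on the chain. -/
def truncate (Φ : FormalOp d) (B : Finset ℤ) : Chain d := ∑ A ∈ B.powerset, term Φ A

theorem term_mem (Φ : FormalOp d) (A : Finset ℤ) : term Φ A ∈ localAlg d A := termOp_mem _ _

theorem toChain_restrict (Φ : FormalOp d) (B : Finset ℤ) :
    toChain B (restrict Φ B) = truncate Φ B := by
  rw [restrict, truncate, map_sum, ← Finset.sum_attach B.powerset]
  exact Finset.sum_congr rfl fun A _ => toChain_embed _ _

theorem truncate_mem (Φ : FormalOp d) (B : Finset ℤ) : truncate Φ B ∈ localAlg d B := by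
  rw [← toChain_restrict]; exact toChain_mem _ _

theorem term_add (Φ Ψ : FormalOp d) (A : Finset ℤ) : term (Φ + Ψ) A = term Φ A + term Ψ A :=
  map_add _ _ _

theorem term_sub (Φ Ψ : FormalOp d) (A : Finset ℤ) : term (Φ - Ψ) A = term Φ A - term Ψ A :=
  map_sub _ _ _

theorem term_smul (c : ℂ) (Φ : FormalOp d) (A : Finset ℤ) : term (c • Φ) A = c • term Φ A :=
  map_smul (termOp A) c (Φ A)

theorem truncate_add (Φ Ψ : FormalOp d) (B : Finset ℤ) :
    truncate (Φ + Ψ) B = truncate Φ B + truncate Ψ B := by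
  simp only [truncate, term_add, Finset.sum_add_distrib]

theorem truncate_sub (Φ Ψ : FormalOp d) (B : Finset ℤ) :
    truncate (Φ - Ψ) B = truncate Φ B - truncate Ψ B := by
  simp only [truncate, term_sub, Finset.sum_sub_distrib]

theorem truncate_smul (c : ℂ) (Φ : FormalOp d) (B : Finset ℤ) :
    truncate (c • Φ) B = c • truncate Φ B := by
  simp only [truncate, term_smul, Finset.smul_sum]

theorem coeff_truncate [NeZero d] (Φ : FormalOp d) {A B : Finset ℤ} (h : A ⊆ B) :
    coeff A (truncate Φ B) = Φ A := by
  rw [truncate]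
  simp only [term]
  rw [coeff_sum_termOp, if_pos (Finset.mem_powerset.2 h)]

theorem term_eq_zero_iff [NeZero d] (Φ : FormalOp d) (A : Finset ℤ) : term Φ A = 0 ↔ Φ A = 0 := by
  refine ⟨fun h => termOp_injective A (by rw [map_zero]; exact h), fun h => ?_⟩
  rw [term, h, map_zero]

theorem formalOp_ext [NeZero d] {Φ Ψ : FormalOp d} (h : ∀ A, term Φ A = term Ψ A) : Φ = Ψ :=
  funext fun A => termOp_injective A (h A)

/-! ### The commutator of operators of finite range -/

/-- `Φ` is at most `n`-local for some `n`. -/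
def FiniteRange (Φ : FormalOp d) : Prop := ∃ n, AtMostLocal n Φ

theorem AtMostLocal.finiteRange {n : ℕ} {Φ : FormalOp d} (h : AtMostLocal n Φ) : FiniteRange Φ :=
  ⟨n, h⟩

theorem AtMostLocal.mono {m n : ℕ} (hmn : m ≤ n) {Φ : FormalOp d} (h : AtMostLocal m Φ) :
    AtMostLocal n Φ := by
  intro A hA
  obtain ⟨i, hi⟩ := h A hA
  exact ⟨i, hi.trans (Finset.Ico_subset_Ico_right (by omega))⟩

theorem AtMostLocal.add {n : ℕ} {Φ Ψ : FormalOp d} (h : AtMostLocal n Φ) (h' : AtMostLocal n Ψ) :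
    AtMostLocal n (Φ + Ψ) := by
  intro A hA
  by_cases hΦ : Φ A = 0
  · exact h' A fun hΨ => hA (by simp [hΦ, hΨ])
  · exact h A hΦ

theorem AtMostLocal.smul {n : ℕ} {Φ : FormalOp d} (h : AtMostLocal n Φ) (c : ℂ) :
    AtMostLocal n (c • Φ) := fun A hA => h A fun hΦ => hA (by simp [hΦ])

theorem AtMostLocal.sub {n : ℕ} {Φ Ψ : FormalOp d} (h : AtMostLocal n Φ) (h' : AtMostLocal n Ψ) :
    AtMostLocal n (Φ - Ψ) := by
  intro A hA
  by_cases hΦ : Φ A = 0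
  · exact h' A fun hΨ => hA (by simp [hΦ, hΨ])
  · exact h A hΦ

theorem FiniteRange.common {Φ Ψ : FormalOp d} (h : FiniteRange Φ) (h' : FiniteRange Ψ) :
    ∃ n, AtMostLocal n Φ ∧ AtMostLocal n Ψ := by
  obtain ⟨n, hn⟩ := h
  obtain ⟨m, hm⟩ := h'
  exact ⟨max n m, hn.mono (le_max_left _ _), hm.mono (le_max_right _ _)⟩

theorem FiniteRange.add {Φ Ψ : FormalOp d} (h : FiniteRange Φ) (h' : FiniteRange Ψ) :
    FiniteRange (Φ + Ψ) := by
  obtain ⟨n, h1, h2⟩ := h.common h'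
  exact ⟨n, h1.add h2⟩

theorem FiniteRange.sub {Φ Ψ : FormalOp d} (h : FiniteRange Φ) (h' : FiniteRange Ψ) :
    FiniteRange (Φ - Ψ) := by
  obtain ⟨n, h1, h2⟩ := h.common h'
  exact ⟨n, h1.sub h2⟩

theorem FiniteRange.smul {Φ : FormalOp d} (h : FiniteRange Φ) (c : ℂ) : FiniteRange (c • Φ) := by
  obtain ⟨n, h1⟩ := h
  exact ⟨n, h1.smul c⟩

theorem componentOp_empty {B : Finset ℤ} (h : ∅ ⊆ B) (Y : Op d B)
    (s t : (∅ : Finset ℤ) → Fin d) :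
    componentOp h Y s t = (d : ℂ)⁻¹ ^ B.card * Y.trace := by
  simp only [componentOp, Finset.notMem_empty, if_false, Finset.univ_eq_empty, Finset.prod_empty,
    one_mul, Matrix.trace, Matrix.diag, Finset.mul_sum, Finset.prod_mul_distrib,
    Finset.prod_const, Finset.card_univ, Fintype.card_coe, Finset.prod_ite_zero]
  refine Finset.sum_congr rfl fun s' _ => ?_
  rw [Finset.sum_eq_single s']
  · simp
  · intro t' _ ht
    rw [if_neg, mul_zero, zero_mul]
    intro h
    exact ht (funext fun i => (h i (Finset.mem_univ i)).symm)
  · simp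

/-- Overlapping terms whose union contains a given site stay within distance 2n of it. For empty A
there is no such site, which is why constant terms are treated separately. -/
theorem exists_pairs {Φ Ψ : FormalOp d} (hΦ : FiniteRange Φ) (hΨ : FiniteRange Ψ) {A : Finset ℤ}
    (hA : A.Nonempty) : ∃ S : Finset (Finset ℤ × Finset ℤ),
      ∀ C D, Φ C ≠ 0 → Ψ D ≠ 0 → ¬ Disjoint C D → A ⊆ C ∪ D → (C, D) ∈ S := by
  obtain ⟨n, hn, hm⟩ := hΦ.common hΨ
  obtain ⟨a, ha⟩ := hA
  refine ⟨(Finset.Icc (a - 2 * n) (a + 2 * n)).powerset ×ˢ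
    (Finset.Icc (a - 2 * n) (a + 2 * n)).powerset, fun C D hC hD hCD hsub => ?_⟩
  obtain ⟨i, hi⟩ := hn C hC
  obtain ⟨j, hj⟩ := hm D hD
  obtain ⟨x, hx, hx'⟩ := Finset.not_disjoint_iff.1 hCD
  have h1 := Finset.mem_Ico.1 (hi hx)
  have h2 := Finset.mem_Ico.1 (hj hx')
  rw [Finset.mem_product, Finset.mem_powerset, Finset.mem_powerset]
  have h3 : (i ≤ a ∧ a < i + n) ∨ (j ≤ a ∧ a < j + n) :=
    (Finset.mem_union.1 (hsub ha)).imp (fun h => Finset.mem_Ico.1 (hi h))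
      (fun h => Finset.mem_Ico.1 (hj h))
  refine ⟨fun y hy => ?_, fun y hy => ?_⟩
  · have := Finset.mem_Ico.1 (hi hy)
    rw [Finset.mem_Icc]; omega
  · have := Finset.mem_Ico.1 (hj hy)
    rw [Finset.mem_Icc]; omega

theorem eventually_pairs (S : Finset (Finset ℤ × Finset ℤ)) :
    ∀ᶠ B : Finset ℤ in atTop, ∀ p ∈ S, p.1 ⊆ B ∧ p.2 ⊆ B := by
  refine (Finset.eventually_all S).2 fun p _ => ?_
  filter_upwards [eventually_ge_atTop (p.1 ∪ p.2)] with B hB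
  exact Finset.union_subset_iff.1 hB

/-! ### Existence, bilinearity and the Jacobi identity of the commutator -/

section Comm

variable [NeZero d]

theorem coeff_empty_lie {B : Finset ℤ} {X Y : Chain d} (hX : X ∈ localAlg d B)
    (hY : Y ∈ localAlg d B) : coeff ∅ ⁅X, Y⁆ = 0 := by
  obtain ⟨X, rfl⟩ := hX
  obtain ⟨Y, rfl⟩ := hY
  change coeff ∅ ⁅toChain B X, toChain B Y⁆ = 0
  rw [Ring.lie_def, ← map_mul, ← map_mul, ← map_sub, coeff_toChain (Finset.empty_subset B)]
  refine Subtype.ext ?_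
  ext s t
  simp [component, componentOp_empty, Matrix.trace_mul_comm X Y]

theorem coeff_lie_term {Φ Ψ : FormalOp d} {A C D : Finset ℤ}
    (h : coeff A ⁅term Φ C, term Ψ D⁆ ≠ 0) :
    Φ C ≠ 0 ∧ Ψ D ≠ 0 ∧ ¬ Disjoint C D ∧ A ⊆ C ∪ D := by
  refine ⟨fun e => h ?_, fun e => h ?_, fun e => h ?_, ?_⟩
  · rw [(term_eq_zero_iff Φ C).2 e, zero_lie, map_zero]
  · rw [(term_eq_zero_iff Ψ D).2 e, lie_zero, map_zero]
  · rw [lie_eq_zero_of_disjoint e (term_mem Φ C) (term_mem Ψ D), map_zero]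
  · by_contra e
    exact h (coeff_eq_zero (lie_mem_localAlg
      (localAlg_mono Finset.subset_union_left (term_mem Φ C))
      (localAlg_mono Finset.subset_union_right (term_mem Ψ D))) e)

theorem coeff_lie_truncate {Φ Ψ : FormalOp d} {A B : Finset ℤ} (S : Finset (Finset ℤ × Finset ℤ))
    (hS : ∀ C D, coeff A ⁅term Φ C, term Ψ D⁆ ≠ 0 → (C, D) ∈ S)
    (hB : ∀ p ∈ S, p.1 ⊆ B ∧ p.2 ⊆ B) :
    coeff A ⁅truncate Φ B, truncate Ψ B⁆ = ∑ p ∈ S, coeff A ⁅term Φ p.1, term Ψ p.2⁆ := by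
  rw [truncate, truncate, sum_lie_sum, map_sum]
  simp only [map_sum]
  rw [← Finset.sum_product']
  symm
  refine Finset.sum_subset (fun p hp => ?_) fun p _ hp => ?_
  · rw [Finset.mem_product, Finset.mem_powerset, Finset.mem_powerset]
    exact hB p hp
  · by_contra h
    exact hp (hS _ _ h)

theorem component_comm {A B : Finset ℤ} (h : A ⊆ B) (Φ Ψ : FormalOp d) :
    component h (restrict Φ B * restrict Ψ B - restrict Ψ B * restrict Φ B) =
      coeff A ⁅truncate Φ B, truncate Ψ B⁆ := by
  rw [← coeff_toChain h, map_sub, map_mul, map_mul, toChain_restrict, toChain_restrict,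
    Ring.lie_def]

/-- For nonempty A only finitely many pairs of terms contribute. For A = ∅ every finite commutator
is traceless. Hence the default value of `opComm` never occurs for finite range. -/
theorem eventually_coeff_lie {Φ Ψ : FormalOp d} (hΦ : FiniteRange Φ) (hΨ : FiniteRange Ψ)
    (A : Finset ℤ) : ∀ᶠ B : Finset ℤ in atTop,
      coeff A ⁅truncate Φ B, truncate Ψ B⁆ = opComm Φ Ψ A := by
  have h : ∃ X : Op₀ d A, ∀ᶠ B : Finset ℤ in atTop, ∀ hAB : A ⊆ B,
      component hAB (restrict Φ B * restrict Ψ B - restrict Ψ B * restrict Φ B) = X := by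
    rcases A.eq_empty_or_nonempty with rfl | hA
    · refine ⟨0, Eventually.of_forall fun B hAB => ?_⟩
      rw [component_comm, coeff_empty_lie (truncate_mem Φ B) (truncate_mem Ψ B)]
    · obtain ⟨S, hS⟩ := exists_pairs hΦ hΨ hA
      refine ⟨∑ p ∈ S, coeff A ⁅term Φ p.1, term Ψ p.2⁆, ?_⟩
      filter_upwards [eventually_pairs S] with B hB hAB
      rw [component_comm, coeff_lie_truncate S (fun C D h => ?_) hB]
      obtain ⟨h1, h2, h3, h4⟩ := coeff_lie_term h
      exact hS C D h1 h2 h3 h4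
  have h1 : opComm Φ Ψ A = h.choose := by rw [opComm, dif_pos h]
  filter_upwards [h.choose_spec, eventually_ge_atTop A] with B hB hAB
  rw [h1, ← hB hAB, component_comm]

theorem opComm_eq_sum {Φ Ψ : FormalOp d} (hΦ : FiniteRange Φ) (hΨ : FiniteRange Ψ)
    {A : Finset ℤ} (S : Finset (Finset ℤ × Finset ℤ))
    (hS : ∀ C D, coeff A ⁅term Φ C, term Ψ D⁆ ≠ 0 → (C, D) ∈ S) :
    opComm Φ Ψ A = ∑ p ∈ S, coeff A ⁅term Φ p.1, term Ψ p.2⁆ := by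
  obtain ⟨B, h1, h2⟩ := ((eventually_coeff_lie hΦ hΨ A).and (eventually_pairs S)).exists
  rw [← h1, coeff_lie_truncate S hS h2]

theorem opComm_empty {Φ Ψ : FormalOp d} (hΦ : FiniteRange Φ) (hΨ : FiniteRange Ψ) :
    opComm Φ Ψ ∅ = 0 := by
  obtain ⟨B, h1⟩ := (eventually_coeff_lie hΦ hΨ ∅).exists
  rw [← h1, coeff_empty_lie (truncate_mem Φ B) (truncate_mem Ψ B)]

theorem subset_Ico_of_coeff_lie {n m k : ℕ} (hk : n + m ≤ k + 1) {Φ Ψ : FormalOp d}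
    (hΦ : AtMostLocal n Φ) (hΨ : AtMostLocal m Ψ) {A B : Finset ℤ}
    (h : coeff A ⁅truncate Φ B, truncate Ψ B⁆ ≠ 0) : ∃ i : ℤ, A ⊆ Finset.Ico i (i + k) := by
  rw [truncate, truncate, sum_lie_sum, map_sum] at h
  obtain ⟨C, _, hC⟩ := Finset.exists_ne_zero_of_sum_ne_zero h
  rw [map_sum] at hC
  obtain ⟨D, _, hD⟩ := Finset.exists_ne_zero_of_sum_ne_zero hC
  obtain ⟨h1, h2, h3, h4⟩ := coeff_lie_term hD
  obtain ⟨i, hi⟩ := hΦ C h1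
  obtain ⟨j, hj⟩ := hΨ D h2
  obtain ⟨x, hx, hx'⟩ := Finset.not_disjoint_iff.1 h3
  have h5 := Finset.mem_Ico.1 (hi hx)
  have h6 := Finset.mem_Ico.1 (hj hx')
  -- Two intervals of lengths n and m with a common point span at most n + m - 1 sites.
  refine ⟨min i j, fun y hy => ?_⟩
  rw [Finset.mem_Ico]
  rcases Finset.mem_union.1 (h4 hy) with h | h
  · have := Finset.mem_Ico.1 (hi h)
    omega
  · have := Finset.mem_Ico.1 (hj h)
    omega

theorem AtMostLocal.opComm {n m k : ℕ} (hk : n + m ≤ k + 1) {Φ Ψ : FormalOp d}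
    (hΦ : AtMostLocal n Φ) (hΨ : AtMostLocal m Ψ) : AtMostLocal k (opComm Φ Ψ) := by
  intro A hA
  obtain ⟨B, h1⟩ := (eventually_coeff_lie hΦ.finiteRange hΨ.finiteRange A).exists
  rw [← h1] at hA
  exact subset_Ico_of_coeff_lie hk hΦ hΨ hA

theorem FiniteRange.opComm {Φ Ψ : FormalOp d} (hΦ : FiniteRange Φ) (hΨ : FiniteRange Ψ) :
    FiniteRange (opComm Φ Ψ) := by
  obtain ⟨n, hn⟩ := hΦ
  obtain ⟨m, hm⟩ := hΨ
  exact ⟨n + m, hn.opComm (Nat.le_succ _) hm⟩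

/-- The neighborhood of width `n` of a set of sites. -/
def thicken (n : ℕ) (A : Finset ℤ) : Finset ℤ := A.biUnion fun x => Finset.Icc (x - n) (x + n)

theorem subset_thicken {n : ℕ} {A C : Finset ℤ} {i : ℤ} (hC : C ⊆ Finset.Ico i (i + n))
    (h : ¬ Disjoint C A) : C ⊆ thicken n A := by
  obtain ⟨x, hx, hx'⟩ := Finset.not_disjoint_iff.1 h
  intro y hy
  have h1 := Finset.mem_Ico.1 (hC hx)
  have h2 := Finset.mem_Ico.1 (hC hy)
  exact Finset.mem_biUnion.2 ⟨x, hx', by rw [Finset.mem_Icc]; omega⟩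

theorem self_subset_thicken (n : ℕ) (A : Finset ℤ) : A ⊆ thicken n A := fun x hx =>
  Finset.mem_biUnion.2 ⟨x, hx, by rw [Finset.mem_Icc]; omega⟩

theorem lie_truncate_of_thicken_subset {n : ℕ} {Φ : FormalOp d} (hΦ : AtMostLocal n Φ)
    {A B : Finset ℤ} (hB : thicken n A ⊆ B) {X : Chain d} (hX : X ∈ localAlg d A) :
    ⁅truncate Φ B, X⁆ = ⁅truncate Φ (thicken n A), X⁆ := by
  rw [truncate, truncate, sum_lie, sum_lie]
  symm
  refine Finset.sum_subset (Finset.powerset_mono.2 hB) fun C _ hC => ?_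
  rw [Finset.mem_powerset] at hC
  by_cases h : Φ C = 0
  · rw [(term_eq_zero_iff Φ C).2 h, zero_lie]
  · obtain ⟨i, hi⟩ := hΦ C h
    by_cases hd : Disjoint C A
    · exact lie_eq_zero_of_disjoint hd (term_mem Φ C) hX
    · exact absurd (subset_thicken hi hd) hC

theorem exists_lie_truncate {Φ : FormalOp d} (hΦ : FiniteRange Φ) {A : Finset ℤ} {X : Chain d}
    (hX : X ∈ localAlg d A) : ∃ C, ∃ Y ∈ localAlg d C, ∀ᶠ B : Finset ℤ in atTop,
      ⁅truncate Φ B, X⁆ = Y := by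
  obtain ⟨n, hn⟩ := hΦ
  refine ⟨thicken n A, ⁅truncate Φ (thicken n A), X⁆,
    lie_mem_localAlg (truncate_mem _ _) (localAlg_mono (self_subset_thicken n A) hX), ?_⟩
  filter_upwards [eventually_ge_atTop (thicken n A)] with B hB
  exact lie_truncate_of_thicken_subset hn hB hX

/-- The commutator represents the commutator of the derivations given by two operators. -/
theorem eventually_lie_truncate_opComm {Φ Ψ : FormalOp d} (hΦ : FiniteRange Φ)
    (hΨ : FiniteRange Ψ) {A : Finset ℤ} {X : Chain d} (hX : X ∈ localAlg d A) :
    ∀ᶠ B : Finset ℤ in atTop,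
      ⁅truncate (opComm Φ Ψ) B, X⁆ = ⁅⁅truncate Φ B, truncate Ψ B⁆, X⁆ := by
  obtain ⟨n, hn⟩ := hΦ
  obtain ⟨m, hm⟩ := hΨ
  have hk : n + m ≤ (n + m) + 1 := Nat.le_succ _
  have hloc := hn.opComm hk hm
  -- The two sides agree componentwise only eventually, and not uniformly over all components. Only
  -- the finitely many components that meet the support A of X matter.
  have hev : ∀ᶠ B : Finset ℤ in atTop, ∀ C ∈ (thicken (n + m) A).powerset,
      coeff C ⁅truncate Φ B, truncate Ψ B⁆ = opComm Φ Ψ C :=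
    (Finset.eventually_all _).2 fun C _ => eventually_coeff_lie ⟨n, hn⟩ ⟨m, hm⟩ C
  filter_upwards [hev] with B hB
  rw [eq_sum_coeff (lie_mem_localAlg (truncate_mem Φ B) (truncate_mem Ψ B)), truncate,
    sum_lie, sum_lie]
  refine Finset.sum_congr rfl fun C _ => ?_
  by_cases hd : Disjoint C A
  · rw [lie_eq_zero_of_disjoint hd (term_mem _ C) hX, lie_eq_zero_of_disjoint hd (termOp_mem _ _) hX]
  · by_cases hC : C ∈ (thicken (n + m) A).powerset
    · rw [hB C hC, term]
    · rw [Finset.mem_powerset] at hC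
      have h1 : opComm Φ Ψ C = 0 := by
        by_contra h
        obtain ⟨i, hi⟩ := hloc C h
        exact hC (subset_thicken hi hd)
      have h2 : coeff C ⁅truncate Φ B, truncate Ψ B⁆ = 0 := by
        by_contra h
        obtain ⟨i, hi⟩ := subset_Ico_of_coeff_lie hk hn hm h
        exact hC (subset_thicken hi hd)
      rw [h2, term, h1]

/-- If a local operator commutes with all matrix units at a site i, the partial trace at i fixes it,
so it has no component whose support contains i. The constant component is invisible to commutators.
-/
theorem eq_of_eventually_lie {Φ Ψ : FormalOp d}
    (h : ∀ (A : Finset ℤ), ∀ X ∈ localAlg d A, ∀ᶠ B : Finset ℤ in atTop,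
      ⁅truncate Φ B, X⁆ = ⁅truncate Ψ B, X⁆) {A : Finset ℤ} (hA : A.Nonempty) : Φ A = Ψ A := by
  obtain ⟨i, hi⟩ := hA
  have hd : (d : ℂ) ≠ 0 := by exact_mod_cast NeZero.ne d
  have hev : ∀ᶠ B : Finset ℤ in atTop, ∀ p u : ({i} : Finset ℤ) → Fin d,
      ⁅truncate Φ B, unit {i} u p⁆ = ⁅truncate Ψ B, unit {i} u p⁆ :=
    eventually_all.2 fun p => eventually_all.2 fun u => h {i} _ (unit_mem _ _ _)
  obtain ⟨B, hB, hAB⟩ := (hev.and (eventually_ge_atTop A)).exists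
  have h1 : siteTrace d i (truncate (Φ - Ψ) B) = truncate (Φ - Ψ) B := by
    have h2 : ∀ p u : ({i} : Finset ℤ) → Fin d,
        unit {i} u p * truncate (Φ - Ψ) B = truncate (Φ - Ψ) B * unit {i} u p := by
      intro p u
      have := hB p u
      rw [← sub_eq_zero, ← sub_lie, ← truncate_sub, Ring.lie_def, sub_eq_zero] at this
      exact this.symm
    rw [siteTrace_apply]
    simp only [← mul_assoc, h2]
    simp only [mul_assoc, unit_mul_unit, if_true, ← Finset.mul_sum, sum_unit, mul_one]
    rw [Finset.sum_const, Finset.card_univ]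
    simp [← Nat.cast_smul_eq_nsmul ℂ, smul_smul, hd]
  have h3 := coeff_siteTrace hi (truncate_mem (Φ - Ψ) B)
  rw [h1, coeff_truncate _ hAB] at h3
  exact sub_eq_zero.1 h3

theorem opComm_add {Φ Ψ Θ : FormalOp d} (hΦ : FiniteRange Φ) (hΨ : FiniteRange Ψ)
    (hΘ : FiniteRange Θ) : opComm Φ (Ψ + Θ) = opComm Φ Ψ + opComm Φ Θ := by
  funext A
  obtain ⟨B, ⟨h1, h2⟩, h3⟩ := (((eventually_coeff_lie hΦ hΨ A).and
    (eventually_coeff_lie hΦ hΘ A)).and (eventually_coeff_lie hΦ (hΨ.add hΘ) A)).exists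
  rw [Pi.add_apply, ← h1, ← h2, ← h3, truncate_add, lie_add, map_add]

theorem opComm_smul {Φ Ψ : FormalOp d} (hΦ : FiniteRange Φ) (hΨ : FiniteRange Ψ) (c : ℂ) :
    opComm Φ (c • Ψ) = c • opComm Φ Ψ := by
  funext A
  obtain ⟨B, h1, h2⟩ := ((eventually_coeff_lie hΦ hΨ A).and
    (eventually_coeff_lie hΦ (hΨ.smul c) A)).exists
  rw [Pi.smul_apply, ← h1, ← h2, truncate_smul, lie_smul, map_smul]

theorem opComm_skew {Φ Ψ : FormalOp d} (hΦ : FiniteRange Φ) (hΨ : FiniteRange Ψ) :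
    opComm Φ Ψ = -opComm Ψ Φ := by
  funext A
  obtain ⟨B, h1, h2⟩ := ((eventually_coeff_lie hΦ hΨ A).and
    (eventually_coeff_lie hΨ hΦ A)).exists
  rw [Pi.neg_apply, ← h1, ← h2, ← map_neg, lie_skew]

theorem opComm_self {Φ : FormalOp d} (hΦ : FiniteRange Φ) : opComm Φ Φ = 0 := by
  funext A
  obtain ⟨B, h1⟩ := (eventually_coeff_lie hΦ hΦ A).exists
  rw [Pi.zero_apply, ← h1, lie_self, map_zero]

theorem opComm_sub {Φ Ψ Θ : FormalOp d} (hΦ : FiniteRange Φ) (hΨ : FiniteRange Ψ)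
    (hΘ : FiniteRange Θ) : opComm Φ (Ψ - Θ) = opComm Φ Ψ - opComm Φ Θ := by
  funext A
  obtain ⟨B, ⟨h1, h2⟩, h3⟩ := (((eventually_coeff_lie hΦ hΨ A).and
    (eventually_coeff_lie hΦ hΘ A)).and (eventually_coeff_lie hΦ (hΨ.sub hΘ) A)).exists
  rw [Pi.sub_apply, ← h1, ← h2, ← h3, truncate_sub, lie_sub, map_sub]

theorem opComm_zero {Φ : FormalOp d} (hΦ : FiniteRange Φ) : opComm Φ 0 = 0 := by
  have := opComm_smul hΦ hΦ 0
  rwa [zero_smul, zero_smul] at this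

theorem zero_opComm {Φ : FormalOp d} (hΦ : FiniteRange Φ) : opComm 0 Φ = 0 := by
  rw [opComm_skew (Φ := 0) ⟨0, fun A hA => absurd rfl hA⟩ hΦ, opComm_zero hΦ, neg_zero]

theorem add_opComm {Φ Ψ Θ : FormalOp d} (hΦ : FiniteRange Φ) (hΨ : FiniteRange Ψ)
    (hΘ : FiniteRange Θ) : opComm (Φ + Ψ) Θ = opComm Φ Θ + opComm Ψ Θ := by
  rw [opComm_skew (hΦ.add hΨ) hΘ, opComm_add hΘ hΦ hΨ, opComm_skew hΦ hΘ, opComm_skew hΨ hΘ,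
    neg_add]

theorem sub_opComm {Φ Ψ Θ : FormalOp d} (hΦ : FiniteRange Φ) (hΨ : FiniteRange Ψ)
    (hΘ : FiniteRange Θ) : opComm (Φ - Ψ) Θ = opComm Φ Θ - opComm Ψ Θ := by
  rw [opComm_skew (hΦ.sub hΨ) hΘ, opComm_sub hΘ hΦ hΨ, opComm_skew hΦ hΘ, opComm_skew hΨ hΘ]
  abel

theorem smul_opComm {Φ Ψ : FormalOp d} (hΦ : FiniteRange Φ) (hΨ : FiniteRange Ψ) (c : ℂ) :
    opComm (c • Φ) Ψ = c • opComm Φ Ψ := by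
  rw [opComm_skew (hΦ.smul c) hΨ, opComm_smul hΨ hΦ, opComm_skew hΦ hΨ, smul_neg]

theorem eventually_lie_truncate_opComm_opComm {Φ Ψ Θ : FormalOp d} (hΦ : FiniteRange Φ)
    (hΨ : FiniteRange Ψ) (hΘ : FiniteRange Θ) {A : Finset ℤ} {X : Chain d}
    (hX : X ∈ localAlg d A) : ∀ᶠ B : Finset ℤ in atTop,
      ⁅truncate (opComm Φ (opComm Ψ Θ)) B, X⁆ =
        ⁅⁅truncate Φ B, ⁅truncate Ψ B, truncate Θ B⁆⁆, X⁆ := by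
  -- As the truncation grows, [Φ, X] stabilizes to one local operator Y, so the derivation property
  -- of [Ψ, Θ] can be used on Y as well as on X.
  obtain ⟨C, Y, hY, hΦX⟩ := exists_lie_truncate hΦ hX
  filter_upwards [hΦX, eventually_lie_truncate_opComm hΦ (hΨ.opComm hΘ) hX,
    eventually_lie_truncate_opComm hΨ hΘ hX, eventually_lie_truncate_opComm hΨ hΘ hY]
    with B h1 h2 h3 h4
  rw [h2, lie_lie, lie_lie, h1, h3, h4]

/-- The Jacobi identity for operators of finite range. -/
theorem opComm_opComm {Φ Ψ Θ : FormalOp d} (hΦ : FiniteRange Φ)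
    (hΨ : FiniteRange Ψ) (hΘ : FiniteRange Θ) :
    opComm Φ (opComm Ψ Θ) = opComm (opComm Φ Ψ) Θ + opComm Ψ (opComm Φ Θ) := by
  rw [opComm_skew (hΦ.opComm hΨ) hΘ, neg_add_eq_sub]
  funext A
  -- The derivations say nothing about the constant term, but commutators have none.
  rcases A.eq_empty_or_nonempty with rfl | hA
  · simp [opComm_empty hΦ (hΨ.opComm hΘ), opComm_empty hΘ (hΦ.opComm hΨ),
      opComm_empty hΨ (hΦ.opComm hΘ)]
  · refine eq_of_eventually_lie (fun C X hX => ?_) hA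
    filter_upwards [eventually_lie_truncate_opComm_opComm hΦ hΨ hΘ hX,
      eventually_lie_truncate_opComm_opComm hΘ hΦ hΨ hX,
      eventually_lie_truncate_opComm_opComm hΨ hΦ hΘ hX] with B h1 h2 h3
    rw [truncate_sub, sub_lie, h1, h2, h3, ← sub_lie, leibniz_lie (truncate Φ B),
      ← lie_skew ⁅truncate Φ B, truncate Ψ B⁆]
    congr 1
    abel

end Comm

/-! ### Translations -/

/-- The shift of the configurations of the chain by one site. -/
def shiftEquiv (d : ℕ) : (ℤ → Fin d) ≃ (ℤ → Fin d) where
  toFun s := fun j => s (j - 1)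
  invFun s := fun j => s (j + 1)
  left_inv s := by funext j; simp
  right_inv s := by funext j; simp

/-- The translation of the operators on the chain. -/
def translateChain (d : ℕ) : Chain d ≃ₐ[ℂ] Chain d :=
  (LinearEquiv.funCongrLeft ℂ ℂ (shiftEquiv d)).conjAlgEquiv ℂ

theorem translateChain_apply (X : Chain d) (f : (ℤ → Fin d) → ℂ) (s : ℤ → Fin d) :
    translateChain d X f s = X (f ∘ (shiftEquiv d).symm) (shiftEquiv d s) := rfl

theorem mem_shift {A : Finset ℤ} {j : ℤ} : j ∈ shift A ↔ j - 1 ∈ A := by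
  simp only [shift, Finset.mem_map, addRightEmbedding_apply]
  constructor
  · rintro ⟨i, hi, rfl⟩; simpa using hi
  · intro h; exact ⟨_, h, by ring⟩

/-- The shift of configurations is a bijection. -/
def shiftConfigEquiv (A : Finset ℤ) : (A → Fin d) ≃ (shift A → Fin d) where
  toFun := shiftConfig
  invFun t := fun i => t ⟨i + 1, mem_shift.2 (by simp)⟩
  left_inv s := by
    funext i
    simp [shiftConfig]
  right_inv t := by
    funext i
    simp [shiftConfig]

theorem translateChain_toChain (A : Finset ℤ) (Y : Op d (shift A)) :
    translateChain d (toChain (shift A) Y) =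
      toChain A (Y.submatrix shiftConfig shiftConfig) := by
  refine LinearMap.ext fun f => funext fun s => ?_
  rw [translateChain_apply, toChain_apply, toChain_apply]
  symm
  refine Fintype.sum_equiv (shiftConfigEquiv A) _ _ fun t => ?_
  have h1 : siteRestrict (shift A) (shiftEquiv d s) = shiftConfig (siteRestrict A s) := rfl
  have h2 : (shiftEquiv d).symm (glue (shiftEquiv d s) (shiftConfig t)) = glue s t := by
    rw [Equiv.symm_apply_eq]
    funext j
    by_cases hj : j - 1 ∈ A
    · simp [glue, shiftEquiv, shiftConfig, mem_shift, hj]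
    · simp [glue, shiftEquiv, mem_shift, hj]
  rw [h1]
  change _ = Y (shiftConfig (siteRestrict A s)) (shiftConfig t) *
    f ((shiftEquiv d).symm (glue (shiftEquiv d s) (shiftConfig t)))
  rw [h2, Matrix.submatrix_apply]

theorem term_translateOp (Φ : FormalOp d) (A : Finset ℤ) :
    term (translateOp Φ) A = translateChain d (term Φ (shift A)) := by
  rw [term, term, termOp_apply, termOp_apply, translateChain_toChain]
  rfl

theorem shift_injective : Function.Injective shift := Finset.map_injective _

theorem shift_subset_shift {A B : Finset ℤ} : shift A ⊆ shift B ↔ A ⊆ B := Finset.map_subset_map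

theorem shift_surjective : Function.Surjective shift := by
  intro A
  refine ⟨A.map (addRightEmbedding (-1)), ?_⟩
  ext j
  rw [mem_shift]
  simp only [Finset.mem_map, addRightEmbedding_apply]
  exact ⟨fun ⟨a, ha, h⟩ => (by omega : a = j) ▸ ha, fun h => ⟨j, h, by ring⟩⟩

theorem sum_powerset_shift {M : Type*} [AddCommMonoid M] (f : Finset ℤ → M) (B : Finset ℤ) :
    ∑ A ∈ (shift B).powerset, f A = ∑ A ∈ B.powerset, f (shift A) := by
  symm
  refine Finset.sum_bij (fun A _ => shift A) ?_ ?_ ?_ ?_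
  · intro A hA
    rw [Finset.mem_powerset] at hA ⊢
    exact shift_subset_shift.2 hA
  · intro A _ C _ h; exact shift_injective h
  · intro C hC
    obtain ⟨A, rfl⟩ := shift_surjective C
    rw [Finset.mem_powerset] at hC
    exact ⟨A, Finset.mem_powerset.2 (shift_subset_shift.1 hC), rfl⟩
  · intro A _; rfl

theorem truncate_translateOp (Φ : FormalOp d) (B : Finset ℤ) :
    truncate (translateOp Φ) B = translateChain d (truncate Φ (shift B)) := by
  rw [truncate, truncate, map_sum, sum_powerset_shift]
  exact Finset.sum_congr rfl fun A _ => term_translateOp Φ A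

theorem translateChain_lie (X Y : Chain d) :
    translateChain d ⁅X, Y⁆ = ⁅translateChain d X, translateChain d Y⁆ := by
  rw [Ring.lie_def, Ring.lie_def, map_sub, map_mul, map_mul]

theorem translateChain_mem {A : Finset ℤ} {X : Chain d} (hX : X ∈ localAlg d (shift A)) :
    translateChain d X ∈ localAlg d A := by
  obtain ⟨Y, rfl⟩ := hX
  change translateChain d (toChain (shift A) Y) ∈ localAlg d A
  rw [translateChain_toChain]
  exact toChain_mem _ _

theorem translateChain_symm_mem {A : Finset ℤ} {X : Chain d} (hX : X ∈ localAlg d A) :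
    (translateChain d).symm X ∈ localAlg d (shift A) := by
  obtain ⟨Y, rfl⟩ := hX
  refine ⟨Y.submatrix (shiftConfigEquiv A).symm (shiftConfigEquiv A).symm, ?_⟩
  change toChain (shift A) _ = (translateChain d).symm (toChain A Y)
  rw [AlgEquiv.eq_symm_apply, translateChain_toChain]
  congr 1
  ext s t
  change Y ((shiftConfigEquiv A).symm (shiftConfigEquiv A s))
    ((shiftConfigEquiv A).symm (shiftConfigEquiv A t)) = Y s t
  simp

theorem tendsto_shift : Tendsto shift atTop atTop := by
  refine tendsto_atTop.2 fun B => ?_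
  obtain ⟨C, rfl⟩ := shift_surjective B
  filter_upwards [eventually_ge_atTop C] with D hD
  exact shift_subset_shift.2 hD

section Translate

variable [NeZero d]

theorem term_coeff_translateChain {A B : Finset ℤ} (h : A ⊆ B) {X : Chain d}
    (hX : X ∈ localAlg d (shift B)) : termOp A (coeff A (translateChain d X)) =
      translateChain d (termOp (shift A) (coeff (shift A) X)) := by
  have h1 : X = truncate (fun C => coeff C X) (shift B) := eq_sum_coeff hX
  conv_lhs => rw [h1, ← truncate_translateOp, coeff_truncate _ h]
  exact term_translateOp _ A

theorem AtMostLocal.translateOp {n : ℕ} {Φ : FormalOp d} (h : AtMostLocal n Φ) :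
    AtMostLocal n (translateOp Φ) := by
  intro A hA
  have h1 : Φ (shift A) ≠ 0 := by
    intro e
    apply hA
    rw [← term_eq_zero_iff, term_translateOp, (term_eq_zero_iff _ _).2 e, map_zero]
  obtain ⟨i, hi⟩ := h _ h1
  refine ⟨i - 1, fun j hj => ?_⟩
  have := Finset.mem_Ico.1 (hi (mem_shift.2 (show j + 1 - 1 ∈ A by simpa using hj)))
  rw [Finset.mem_Ico]; omega

theorem FiniteRange.translateOp {Φ : FormalOp d} (h : FiniteRange Φ) :
    FiniteRange (translateOp Φ) := by
  obtain ⟨n, hn⟩ := h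
  exact ⟨n, hn.translateOp⟩

theorem translateOp_opComm {Φ Ψ : FormalOp d} (hΦ : FiniteRange Φ) (hΨ : FiniteRange Ψ) :
    translateOp (opComm Φ Ψ) = opComm (translateOp Φ) (translateOp Ψ) := by
  refine formalOp_ext fun A => ?_
  obtain ⟨B, ⟨h1, h2⟩, h3⟩ := (((eventually_coeff_lie hΦ.translateOp hΨ.translateOp A).and
    (tendsto_shift.eventually (eventually_coeff_lie hΦ hΨ (shift A)))).and
    (eventually_ge_atTop A)).exists
  rw [term_translateOp, term, term, ← h1, ← h2, truncate_translateOp, truncate_translateOp,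
    ← translateChain_lie, term_coeff_translateChain h3
      (lie_mem_localAlg (truncate_mem _ _) (truncate_mem _ _))]

/-- The partial traces are translated into each other. -/
theorem translateChain_siteTrace {B : Finset ℤ} (i : ℤ) {X : Chain d}
    (hX : X ∈ localAlg d (shift B)) :
    siteTrace d i (translateChain d X) = translateChain d (siteTrace d (i + 1) X) := by
  have h1 : X = truncate (fun C => coeff C X) (shift B) := eq_sum_coeff hX
  rw [h1, ← truncate_translateOp, truncate, truncate, sum_powerset_shift, map_sum, map_sum, map_sum]
  refine Finset.sum_congr rfl fun A _ => ?_
  rw [term, siteTrace_termOp, term, siteTrace_termOp]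
  have : i + 1 ∈ shift A ↔ i ∈ A := by simp [mem_shift]
  by_cases hi : i ∈ A
  · simp [hi, this]
  · simp only [hi, this, if_false]
    exact term_translateOp _ A

end Translate

/-! ### The normalized trace -/

section Trace

variable [NeZero d]

/-- The normalized trace of the local operators on the chain. -/
def chainTrace : Chain d →ₗ[ℂ] ℂ :=
  (Matrix.traceLinearMap _ ℂ ℂ ∘ₗ (Op₀ d ∅).subtype) ∘ₗ coeff ∅

theorem chainTrace_apply (X : Chain d) : chainTrace X = (coeff ∅ X : Op d ∅).trace := rfl

theorem chainTrace_toChain {B : Finset ℤ} (Y : Op d B) :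
    chainTrace (toChain B Y) = (d : ℂ)⁻¹ ^ B.card * Y.trace := by
  rw [chainTrace_apply, coeff_toChain (Finset.empty_subset B), Matrix.trace]
  simp [component, componentOp_empty]

theorem chainTrace_lie {B : Finset ℤ} {X Y : Chain d} (hX : X ∈ localAlg d B)
    (hY : Y ∈ localAlg d B) : chainTrace ⁅X, Y⁆ = 0 := by
  rw [chainTrace_apply, coeff_empty_lie hX hY]; simp

theorem chainTrace_mul_comm {B : Finset ℤ} {X Y : Chain d} (hX : X ∈ localAlg d B)
    (hY : Y ∈ localAlg d B) : chainTrace (X * Y) = chainTrace (Y * X) := by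
  have := chainTrace_lie hX hY
  rwa [Ring.lie_def, map_sub, sub_eq_zero] at this

theorem chainTrace_siteTrace {B : Finset ℤ} (i : ℤ) {X : Chain d} (hX : X ∈ localAlg d B) :
    chainTrace (siteTrace d i X) = chainTrace X := by
  rw [eq_sum_coeff hX, map_sum, map_sum, map_sum]
  refine Finset.sum_congr rfl fun A _ => ?_
  rw [siteTrace_termOp]
  split_ifs with h
  · rw [map_zero, chainTrace_apply, coeff_termOp_of_ne (by rintro rfl; simp at h)]
    simp
  · rfl

/-- At a site belonging to exactly one of the two supports, the partial trace passes over one factor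
and kills the other. -/
theorem chainTrace_termOp_mul_termOp {A C : Finset ℤ} (h : A ≠ C) (x : Op₀ d A) (y : Op₀ d C) :
    chainTrace (termOp A x * termOp C y) = 0 := by
  have hm : termOp A x * termOp C y ∈ localAlg d (A ∪ C) :=
    mul_mem (localAlg_mono Finset.subset_union_left (termOp_mem A x))
      (localAlg_mono Finset.subset_union_right (termOp_mem C y))
  have : ∃ i, (i ∈ A ∧ i ∉ C) ∨ (i ∉ A ∧ i ∈ C) := by
    by_contra! hc
    exact h (Finset.ext fun i => ⟨(hc i).1, fun hi => by_contra fun hA => (hc i).2 hA hi⟩)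
  obtain ⟨i, ⟨h1, h2⟩ | ⟨h1, h2⟩⟩ := this
  · rw [← chainTrace_siteTrace i hm, siteTrace_mul_right h2 (termOp_mem C y), siteTrace_termOp,
      if_pos h1, zero_mul, map_zero]
  · rw [← chainTrace_siteTrace i hm, siteTrace_mul_left h1 (termOp_mem A x), siteTrace_termOp,
      if_pos h2, mul_zero, map_zero]

theorem chainTrace_termOp_mul {A B : Finset ℤ} (x : Op₀ d A) {Y : Chain d}
    (hY : Y ∈ localAlg d B) :
    chainTrace (termOp A x * Y) = chainTrace (termOp A x * termOp A (coeff A Y)) := by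
  conv_lhs => rw [eq_sum_coeff hY, Finset.mul_sum, map_sum]
  by_cases h : A ∈ B.powerset
  · rw [Finset.sum_eq_single_of_mem A h]
    intro C _ hC
    exact chainTrace_termOp_mul_termOp hC.symm _ _
  · rw [coeff_eq_zero hY (by simpa using h), map_zero, mul_zero, map_zero]
    refine Finset.sum_eq_zero fun C hC => chainTrace_termOp_mul_termOp ?_ _ _
    rintro rfl
    exact h hC

theorem chainTrace_mul_termOp {A B : Finset ℤ} (x : Op₀ d A) {Y : Chain d}
    (hY : Y ∈ localAlg d B) :
    chainTrace (Y * termOp A x) = chainTrace (termOp A (coeff A Y) * termOp A x) := by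
  rw [chainTrace_mul_comm (B := A ∪ B) (localAlg_mono Finset.subset_union_right hY)
    (localAlg_mono Finset.subset_union_left (termOp_mem A x)), chainTrace_termOp_mul x hY,
    chainTrace_mul_comm (termOp_mem A x) (termOp_mem A _)]

theorem card_shift (A : Finset ℤ) : (shift A).card = A.card := Finset.card_map _

theorem chainTrace_translateChain {B : Finset ℤ} {X : Chain d}
    (hX : X ∈ localAlg d (shift B)) : chainTrace (translateChain d X) = chainTrace X := by
  obtain ⟨Y, rfl⟩ := hX
  change chainTrace (translateChain d (toChain (shift B) Y)) = chainTrace (toChain (shift B) Y)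
  rw [translateChain_toChain, chainTrace_toChain, chainTrace_toChain, card_shift]
  congr 1
  exact Fintype.sum_equiv (shiftConfigEquiv B) _ _ fun s => rfl

end Trace

/-! ### Adjoints -/

theorem conjTranspose_mem {A : Finset ℤ} {X : Op d A} (hX : X ∈ Op₀ d A) :
    X.conjTranspose ∈ Op₀ d A := by
  intro i s t
  have := congrArg star (hX i t s)
  simpa [star_sum] using this

/-- The adjoint of a formal operator. -/
def adj (Φ : FormalOp d) : FormalOp d := fun A =>
  ⟨(Φ A : Op d A).conjTranspose, conjTranspose_mem (Φ A).2⟩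

theorem adj_eq_self {Φ : FormalOp d} (h : IsSelfAdj Φ) : adj Φ = Φ :=
  funext fun A => Subtype.ext (h A)

theorem AtMostLocal.adj {n : ℕ} {Φ : FormalOp d} (h : AtMostLocal n Φ) : AtMostLocal n (adj Φ) := by
  intro A hA
  refine h A fun e => hA (Subtype.ext ?_)
  simp [SpinChain.adj, e]

theorem embed_conjTranspose {A B : Finset ℤ} (h : A ⊆ B) (X : Op d A) :
    embed h X.conjTranspose = (embed h X).conjTranspose := by
  ext s t
  simp only [embed, Matrix.conjTranspose_apply]
  by_cases hst : ∀ i : B, (i : ℤ) ∉ A → s i = t i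
  · rw [if_pos hst, if_pos fun i hi => (hst i hi).symm]
  · rw [if_neg hst, if_neg fun h => hst fun i hi => (h i hi).symm, star_zero]

theorem restrict_adj (Φ : FormalOp d) (B : Finset ℤ) :
    restrict (adj Φ) B = (restrict Φ B).conjTranspose := by
  rw [restrict, restrict, Matrix.conjTranspose_sum]
  exact Finset.sum_congr rfl fun A _ => embed_conjTranspose _ _

theorem star_tracelessKernel (a b a' b' : Fin d) :
    star (tracelessKernel a b a' b') = tracelessKernel b a b' a' := by
  simp only [tracelessKernel, star_sub, star_mul', star_inv₀, star_natCast, apply_ite star, star_one,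
    star_zero, and_comm, eq_comm]

theorem componentOp_conjTranspose {A B : Finset ℤ} (h : A ⊆ B) (Y : Op d B) :
    componentOp h Y.conjTranspose = (componentOp h Y).conjTranspose := by
  ext s t
  simp only [componentOp, Matrix.conjTranspose_apply, star_sum, star_mul', star_prod,
    star_tracelessKernel]
  rw [Finset.sum_comm]
  refine Finset.sum_congr rfl fun s' _ => Finset.sum_congr rfl fun t' _ => ?_
  congr 2
  refine Finset.prod_congr rfl fun i _ => ?_
  by_cases hi : (i : ℤ) ∈ A <;> by_cases hst : s' i = t' i <;> simp [hi, hst, eq_comm]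

theorem opComm_adj [NeZero d] {Φ Ψ : FormalOp d} {n m : ℕ} (hΦ : AtMostLocal n Φ)
    (hΨ : AtMostLocal m Ψ) : opComm (adj Φ) (adj Ψ) = adj (opComm Ψ Φ) := by
  funext A
  obtain ⟨B, ⟨h1, h2⟩, h3⟩ := (((eventually_coeff_lie hΦ.adj.finiteRange hΨ.adj.finiteRange A).and
    (eventually_coeff_lie hΨ.finiteRange hΦ.finiteRange A)).and (eventually_ge_atTop A)).exists
  rw [← component_comm h3] at h1 h2
  rw [← h1]
  refine Subtype.ext ?_
  change componentOp h3 _ = (opComm Ψ Φ A : Op d A).conjTranspose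
  rw [← h2, restrict_adj, restrict_adj, ← Matrix.conjTranspose_mul, ← Matrix.conjTranspose_mul,
    ← Matrix.conjTranspose_sub, componentOp_conjTranspose]
  rfl

theorem chainTrace_adj_mul [NeZero d] (Φ : FormalOp d) (A : Finset ℤ) :
    chainTrace (term (adj Φ) A * term Φ A) =
      ((((d : ℝ)⁻¹ ^ A.card * ∑ s, ∑ t, Complex.normSq ((Φ A : Op d A) t s) : ℝ)) : ℂ) := by
  have : term (adj Φ) A * term Φ A = toChain A ((Φ A : Op d A).conjTranspose * (Φ A : Op d A)) := by
    rw [map_mul]; rfl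
  rw [this, chainTrace_toChain]
  push_cast
  congr 1
  rw [Matrix.trace]
  refine Finset.sum_congr rfl fun s _ => ?_
  rw [Matrix.diag_apply, Matrix.mul_apply]
  refine Finset.sum_congr rfl fun t _ => ?_
  rw [Matrix.conjTranspose_apply, Complex.normSq_eq_conj_mul_self]
  rfl

theorem eq_zero_of_sum_chainTrace_adj_mul [NeZero d] (Φ : FormalOp d) (S : Finset (Finset ℤ))
    (h : ∑ A ∈ S, chainTrace (term (adj Φ) A * term Φ A) = 0) {A : Finset ℤ} (hA : A ∈ S) :
    Φ A = 0 := by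
  simp only [chainTrace_adj_mul] at h
  rw [← Complex.ofReal_sum, Complex.ofReal_eq_zero, Finset.sum_eq_zero_iff_of_nonneg] at h
  · have hd : ((d : ℝ)⁻¹ ^ A.card) ≠ 0 :=
      pow_ne_zero _ (inv_ne_zero (by exact_mod_cast NeZero.ne d))
    have h1 := (mul_eq_zero.1 (h A hA)).resolve_left hd
    rw [Finset.sum_eq_zero_iff_of_nonneg fun s _ =>
      Finset.sum_nonneg fun t _ => Complex.normSq_nonneg _] at h1
    refine Subtype.ext ?_
    ext t s
    have h2 := h1 s (Finset.mem_univ s)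
    rw [Finset.sum_eq_zero_iff_of_nonneg fun t _ => Complex.normSq_nonneg _] at h2
    exact Complex.normSq_eq_zero.1 (h2 t (Finset.mem_univ t))
  · intro C _
    exact mul_nonneg (by positivity)
      (Finset.sum_nonneg fun s _ => Finset.sum_nonneg fun t _ => Complex.normSq_nonneg _)

/-! ### Mass transport -/

/-- The translate `A + k`. -/
def shiftBy (k : ℤ) (A : Finset ℤ) : Finset ℤ := A.map (addRightEmbedding k)

theorem mem_shiftBy {k : ℤ} {A : Finset ℤ} {j : ℤ} : j ∈ shiftBy k A ↔ j - k ∈ A := by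
  simp only [shiftBy, Finset.mem_map, addRightEmbedding_apply]
  exact ⟨fun ⟨a, ha, h⟩ => (by omega : a = j - k) ▸ ha, fun h => ⟨_, h, by ring⟩⟩

theorem shiftBy_zero (A : Finset ℤ) : shiftBy 0 A = A := by ext j; simp [mem_shiftBy]

theorem shiftBy_shiftBy (k l : ℤ) (A : Finset ℤ) : shiftBy k (shiftBy l A) = shiftBy (l + k) A := by
  ext j; simp only [mem_shiftBy]; rw [show j - k - l = j - (l + k) by ring]

theorem shift_shiftBy (k : ℤ) (A : Finset ℤ) : shift (shiftBy k A) = shiftBy (k + 1) A :=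
  shiftBy_shiftBy 1 k A

theorem shiftBy_invariant {p : Finset ℤ → Finset ℤ → ℂ}
    (hp : ∀ A C, p (shift A) (shift C) = p A C) (k : ℤ) (A C : Finset ℤ) :
    p (shiftBy k A) (shiftBy k C) = p A C := by
  induction k using Int.induction_on with
  | zero => rw [shiftBy_zero, shiftBy_zero]
  | succ n ih => rw [← shift_shiftBy, ← shift_shiftBy, hp, ih]
  | pred n ih =>
    rw [← ih, ← hp (shiftBy (-n - 1) A), shift_shiftBy, shift_shiftBy, sub_add_cancel]

/-- The sets of sites with minimum `0` in `{0, …, m - 1}`. -/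
def anchored (m : ℕ) : Finset (Finset ℤ) := (Finset.Ico 0 (m : ℤ)).powerset.filter fun A => 0 ∈ A

theorem mem_anchored {m : ℕ} {A : Finset ℤ} :
    A ∈ anchored m ↔ A ⊆ Finset.Ico 0 (m : ℤ) ∧ 0 ∈ A := by
  rw [anchored, Finset.mem_filter, Finset.mem_powerset]

theorem exists_anchored {m : ℕ} {A : Finset ℤ} (hA : A.Nonempty) {i : ℤ}
    (h : A ⊆ Finset.Ico i (i + m)) : ∃ C ∈ anchored m, shiftBy (A.min' hA) C = A := by
  refine ⟨shiftBy (-(A.min' hA)) A, mem_anchored.2 ⟨fun j hj => ?_, ?_⟩, ?_⟩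
  · rw [mem_shiftBy, sub_neg_eq_add] at hj
    have h1 := Finset.mem_Ico.1 (h hj)
    have h2 := Finset.mem_Ico.1 (h (A.min'_mem hA))
    have h3 := A.min'_le _ hj
    rw [Finset.mem_Ico]; omega
  · rw [mem_shiftBy, sub_neg_eq_add, zero_add]; exact A.min'_mem hA
  · rw [shiftBy_shiftBy, neg_add_cancel, shiftBy_zero]

theorem anchored_shiftBy_injective {m : ℕ} {A C : Finset ℤ} {k l : ℤ} (hA : A ∈ anchored m)
    (hC : C ∈ anchored m) (h : shiftBy k A = shiftBy l C) : A = C ∧ k = l := by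
  rw [mem_anchored] at hA hC
  have h1 : k ∈ shiftBy l C := by rw [← h, mem_shiftBy, sub_self]; exact hA.2
  have h2 : l ∈ shiftBy k A := by rw [h, mem_shiftBy, sub_self]; exact hC.2
  rw [mem_shiftBy] at h1 h2
  have h3 := Finset.mem_Ico.1 (hC.1 h1)
  have h4 := Finset.mem_Ico.1 (hA.1 h2)
  have hkl : k = l := by omega
  subst hkl
  exact ⟨Finset.map_injective _ h, rfl⟩

theorem sum_eq_of_eventually_sum {f : Finset ℤ → ℂ} {v : ℂ}
    (h : ∀ᶠ B : Finset ℤ in atTop, ∑ A ∈ B.powerset, f A = v) (S : Finset (Finset ℤ))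
    (hS : ∀ A, f A ≠ 0 → A ∈ S) : ∑ A ∈ S, f A = v := by
  obtain ⟨B, h1, h2⟩ := (h.and (eventually_ge_atTop (S.biUnion id))).exists
  rw [← h1]
  refine Finset.sum_subset (fun A hA => ?_) fun A _ hA => by_contra fun h => hA (hS A h)
  exact Finset.mem_powerset.2 ((Finset.subset_biUnion_of_mem id hA).trans h2)

/-- The total masses sent and received per site agree for a translation-invariant transport. -/
theorem mass_transport {F : Finset ℤ → Finset ℤ → ℂ} (hF : ∀ A C, F (shift A) (shift C) = F A C)
    {m R : ℕ} (hloc : ∀ A C, F A C ≠ 0 → A.Nonempty ∧ C.Nonempty ∧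
      (∃ i : ℤ, A ⊆ Finset.Ico i (i + m)) ∧ (∃ i : ℤ, C ⊆ Finset.Ico i (i + m)) ∧
      ∀ a ∈ A, ∀ c ∈ C, |a - c| ≤ R) {g h : Finset ℤ → ℂ}
    (hg : ∀ A, ∀ᶠ B : Finset ℤ in atTop, ∑ C ∈ B.powerset, F A C = g A)
    (hh : ∀ C, ∀ᶠ B : Finset ℤ in atTop, ∑ A ∈ B.powerset, F A C = h C) :
    ∑ A ∈ anchored m, g A = ∑ C ∈ anchored m, h C := by
  -- Up to translation every set that occurs is anchored, and a partner of an anchored set is an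
  -- anchored set moved by at most R. So both sides become finite double sums with a displacement k.
  let T : Finset (Finset ℤ × ℤ) := anchored m ×ˢ Finset.Icc (-(R : ℤ)) R
  let φ : Finset ℤ × ℤ → Finset ℤ := fun p => shiftBy p.2 p.1
  have hinj : Set.InjOn φ (T : Set (Finset ℤ × ℤ)) := by
    rintro ⟨A, k⟩ hp ⟨C, l⟩ hq hpq
    have hp1 := (Finset.mem_product.1 (Finset.mem_coe.1 hp)).1
    have hq1 := (Finset.mem_product.1 (Finset.mem_coe.1 hq)).1
    obtain ⟨h1, h2⟩ := anchored_shiftBy_injective hp1 hq1 hpq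
    simp only at h1 h2
    rw [h1, h2]
  have hmem : ∀ A ∈ anchored m, ∀ C : Finset ℤ, C.Nonempty →
      (∃ i : ℤ, C ⊆ Finset.Ico i (i + m)) → (∀ a ∈ A, ∀ c ∈ C, |a - c| ≤ R) →
      C ∈ T.image φ := by
    intro A hA C hC ⟨i, hi⟩ hR
    obtain ⟨C₀, hC₀, hC₀'⟩ := exists_anchored hC hi
    refine Finset.mem_image.2 ⟨(C₀, C.min' hC), Finset.mem_product.2 ⟨hC₀, ?_⟩, hC₀'⟩
    have := hR 0 (mem_anchored.1 hA).2 _ (C.min'_mem hC)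
    rw [zero_sub, abs_neg] at this
    exact Finset.mem_Icc.2 (abs_le.1 this)
  have h1 : ∀ A ∈ anchored m, g A =
      ∑ C ∈ anchored m, ∑ k ∈ Finset.Icc (-(R : ℤ)) R, F A (shiftBy k C) := by
    intro A hA
    rw [← sum_eq_of_eventually_sum (hg A) (T.image φ), Finset.sum_image hinj, Finset.sum_product]
    intro C hC
    obtain ⟨_, h2, _, h4, h5⟩ := hloc A C hC
    exact hmem A hA C h2 h4 h5
  have h2 : ∀ C ∈ anchored m, h C =
      ∑ A ∈ anchored m, ∑ k ∈ Finset.Icc (-(R : ℤ)) R, F (shiftBy k A) C := by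
    intro C hC
    rw [← sum_eq_of_eventually_sum (hh C) (T.image φ), Finset.sum_image hinj, Finset.sum_product]
    intro A hA
    obtain ⟨h1, _, h3, _, h5⟩ := hloc A C hA
    exact hmem C hC A h1 h3 fun c hc a ha => by rw [abs_sub_comm]; exact h5 a ha c hc
  rw [Finset.sum_congr rfl h1, Finset.sum_congr rfl h2, Finset.sum_comm]
  refine Finset.sum_congr rfl fun C _ => Finset.sum_congr rfl fun A _ => ?_
  -- By invariance, moving the receiver by k is the same as moving the sender by -k.
  refine Finset.sum_bij' (fun k _ => -k) (fun k _ => -k) ?_ ?_ ?_ ?_ ?_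
  · intro k hk; rw [Finset.mem_Icc] at hk ⊢; omega
  · intro k hk; rw [Finset.mem_Icc] at hk ⊢; omega
  · intro k _; simp
  · intro k _; simp
  · intro k _
    rw [← shiftBy_invariant hF (-k) A, shiftBy_shiftBy, add_neg_cancel, shiftBy_zero]

theorem thicken_shift (n : ℕ) (A : Finset ℤ) : thicken n (shift A) = shift (thicken n A) := by
  ext j
  simp only [thicken, mem_shift, Finset.mem_biUnion, Finset.mem_Icc]
  constructor
  · rintro ⟨x, hx, h1, h2⟩
    exact ⟨x - 1, hx, by omega, by omega⟩
  · rintro ⟨x, hx, h1, h2⟩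
    exact ⟨x + 1, by simpa using hx, by omega, by omega⟩

theorem thicken_mono (n : ℕ) {A B : Finset ℤ} (h : A ⊆ B) : thicken n A ⊆ thicken n B :=
  Finset.biUnion_subset_biUnion_of_subset_left _ h

theorem translateOp_adj (Φ : FormalOp d) : translateOp (adj Φ) = adj (translateOp Φ) := rfl

/-! ### Symmetry of the commutator with H for the trace per site -/

section DoubleCommutator

variable [NeZero d]

theorem lie_truncate_mem_thicken {n : ℕ} {Φ : FormalOp d} (hΦ : AtMostLocal n Φ) (B : Finset ℤ)
    {C : Finset ℤ} {X : Chain d} (hX : X ∈ localAlg d C) :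
    ⁅truncate Φ B, X⁆ ∈ localAlg d (thicken n C) := by
  rw [truncate, sum_lie]
  refine sum_mem fun A _ => ?_
  by_cases h : Φ A = 0
  · rw [(term_eq_zero_iff Φ A).2 h, zero_lie]; exact zero_mem _
  · obtain ⟨i, hi⟩ := hΦ A h
    by_cases hd : Disjoint A C
    · rw [lie_eq_zero_of_disjoint hd (term_mem Φ A) hX]; exact zero_mem _
    · exact lie_mem_localAlg (localAlg_mono (subset_thicken hi hd) (term_mem Φ A))
        (localAlg_mono (self_subset_thicken n C) hX)

/-- For translation-invariant operators, the second commutator with a self-adjoint operator vanishes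
only if the first one does. -/
theorem opComm_eq_zero_of_opComm_opComm {n m : ℕ} {H Ψ : FormalOp d} (hH : AtMostLocal n H)
    (hH_sa : IsSelfAdj H) (hH_inv : translateOp H = H) (hΨ : AtMostLocal m Ψ)
    (hΨ_inv : translateOp Ψ = Ψ) (h0 : opComm H (opComm H Ψ) = 0) : opComm H Ψ = 0 := by
  set K := opComm H Ψ with hK
  have hK_loc : AtMostLocal (n + m) K := hH.opComm (Nat.le_succ _) hΨ
  have hK_inv : translateOp K = K := by
    rw [hK, translateOp_opComm hH.finiteRange hΨ.finiteRange, hH_inv, hΨ_inv]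
  have hadj : opComm (adj K) H = 0 := by
    have := opComm_adj hK_loc hH
    rw [adj_eq_self hH_sa, h0] at this
    rw [this]
    funext A
    exact Subtype.ext Matrix.conjTranspose_zero
  have hadj_inv : translateOp (adj K) = adj K := by rw [translateOp_adj, hK_inv]
  -- The mass sent from A to C is the overlap of K(A) with [H, Ψ(C)]. The neighborhood of C contains
  -- every term of H that contributes to this commutator.
  let F : Finset ℤ → Finset ℤ → ℂ := fun A C =>
    chainTrace (term (adj K) A * ⁅truncate H (thicken n C), term Ψ C⁆)
  have hD : ∀ B C : Finset ℤ, ⁅truncate H B, term Ψ C⁆ ∈ localAlg d (thicken n C) :=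
    fun B C => lie_truncate_mem_thicken hH B (term_mem Ψ C)
  have hF : ∀ A C, F (shift A) (shift C) = F A C := by
    intro A C
    have e1 : term (adj K) A = translateChain d (term (adj K) (shift A)) := by
      rw [← term_translateOp, hadj_inv]
    have e2 : truncate H (thicken n C) = translateChain d (truncate H (shift (thicken n C))) := by
      rw [← truncate_translateOp, hH_inv]
    have e3 : term Ψ C = translateChain d (term Ψ (shift C)) := by
      rw [← term_translateOp, hΨ_inv]
    simp only [F]
    rw [e1, e2, e3, ← translateChain_lie, ← map_mul, thicken_shift,
      chainTrace_translateChain (B := A ∪ thicken n C)]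
    refine mul_mem (localAlg_mono (shift_subset_shift.2 Finset.subset_union_left) (term_mem _ _))
      (localAlg_mono (shift_subset_shift.2 Finset.subset_union_right) ?_)
    rw [← thicken_shift]
    exact hD _ _
  have hlocB : ∀ A B C : Finset ℤ,
      chainTrace (term (adj K) A * ⁅truncate H B, term Ψ C⁆) ≠ 0 →
      A.Nonempty ∧ K A ≠ 0 ∧ Ψ C ≠ 0 ∧ A ⊆ thicken n C := by
    intro A B C h
    have h' : term (adj K) A * ⁅truncate H B, term Ψ C⁆ ≠ 0 := fun e => h (by rw [e, map_zero])
    rw [term, chainTrace_termOp_mul _ (hD B C)] at h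
    refine ⟨?_, fun e => h' ?_, fun e => h' ?_, ?_⟩
    · by_contra hA
      rw [Finset.not_nonempty_iff_eq_empty] at hA
      subst hA
      refine h ?_
      rw [coeff_empty_lie (B := B ∪ C) (localAlg_mono Finset.subset_union_left (truncate_mem H B))
        (localAlg_mono Finset.subset_union_right (term_mem Ψ C)), map_zero, mul_zero, map_zero]
    · have : adj K A = 0 := Subtype.ext (by simp [adj, e])
      rw [(term_eq_zero_iff _ _).2 this, zero_mul]
    · rw [(term_eq_zero_iff _ _).2 e, lie_zero, mul_zero]
    · by_contra hA
      rw [coeff_eq_zero (hD B C) hA, map_zero, mul_zero, map_zero] at h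
      exact h rfl
  have hloc : ∀ A C, F A C ≠ 0 → A.Nonempty ∧ C.Nonempty ∧
      (∃ i : ℤ, A ⊆ Finset.Ico i (i + (n + m : ℕ))) ∧
      (∃ i : ℤ, C ⊆ Finset.Ico i (i + (n + m : ℕ))) ∧
      ∀ a ∈ A, ∀ c ∈ C, |a - c| ≤ (n + m : ℕ) := by
    intro A C h
    obtain ⟨h1, h2, h3, h4⟩ := hlocB A _ C h
    obtain ⟨a, ha⟩ := h1
    obtain ⟨c, hc, _⟩ := Finset.mem_biUnion.1 (h4 ha)
    obtain ⟨i, hi⟩ := hΨ C h3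
    refine ⟨⟨a, ha⟩, ⟨c, hc⟩, hK_loc A h2, hΨ.mono (Nat.le_add_left m n) C h3, ?_⟩
    intro a ha c hc
    obtain ⟨c', hc', h5⟩ := Finset.mem_biUnion.1 (h4 ha)
    have h6 := Finset.mem_Ico.1 (hi hc)
    have h7 := Finset.mem_Ico.1 (hi hc')
    rw [Finset.mem_Icc] at h5
    rw [abs_le]; push_cast
    constructor <;> omega
  -- Summed over C, the second factor is [H, Ψ], whose only component not orthogonal to K(A) is K(A)
  -- itself.
  have hg : ∀ A, ∀ᶠ B : Finset ℤ in atTop, ∑ C ∈ B.powerset, F A C =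
      chainTrace (term (adj K) A * term K A) := by
    intro A
    filter_upwards [eventually_ge_atTop (thicken n (thicken (n + m) A)),
      eventually_coeff_lie hH.finiteRange hΨ.finiteRange A] with B hB hBA
    have h1 : ∀ C, F A C = chainTrace (term (adj K) A * ⁅truncate H B, term Ψ C⁆) := by
      intro C
      by_cases h : A.Nonempty ∧ Ψ C ≠ 0 ∧ A ⊆ thicken n C
      · obtain ⟨⟨a, ha⟩, h3, h4⟩ := h
        have hCA : C ⊆ thicken (n + m) A := by
          intro c hc
          obtain ⟨i, hi⟩ := hΨ C h3
          obtain ⟨c', hc', h5⟩ := Finset.mem_biUnion.1 (h4 ha)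
          have h6 := Finset.mem_Ico.1 (hi hc)
          have h7 := Finset.mem_Ico.1 (hi hc')
          rw [Finset.mem_Icc] at h5
          exact Finset.mem_biUnion.2 ⟨a, ha, by rw [Finset.mem_Icc]; push_cast; omega⟩
        simp only [F]
        rw [lie_truncate_of_thicken_subset hH ((thicken_mono n hCA).trans hB) (term_mem Ψ C)]
      · have h2 : ∀ B', chainTrace (term (adj K) A * ⁅truncate H B', term Ψ C⁆) = 0 := by
          intro B'
          by_contra hc
          obtain ⟨a1, _, a3, a4⟩ := hlocB A B' C hc
          exact h ⟨a1, a3, a4⟩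
        simp only [F]
        rw [h2, h2]
    simp only [h1]
    rw [← map_sum, ← Finset.mul_sum, ← lie_sum]
    change chainTrace (term (adj K) A * ⁅truncate H B, truncate Ψ B⁆) = _
    rw [term, chainTrace_termOp_mul _ (lie_mem_localAlg (truncate_mem H B) (truncate_mem Ψ B)), hBA]
    rfl
  -- Summed over A, cyclicity of the trace moves the commutator onto K†, and [K†, H] = 0 is the
  -- adjoint of the hypothesis.
  have hh : ∀ C, ∀ᶠ B : Finset ℤ in atTop, ∑ A ∈ B.powerset, F A C = 0 := by
    intro C
    filter_upwards [eventually_ge_atTop (thicken n C),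
      eventually_coeff_lie hK_loc.adj.finiteRange hH.finiteRange C] with B hB hBC
    have h1 : ∀ A, F A C = chainTrace (term (adj K) A * ⁅truncate H B, term Ψ C⁆) := by
      intro A
      simp only [F]
      rw [lie_truncate_of_thicken_subset hH hB (term_mem Ψ C)]
    simp only [h1]
    rw [← map_sum, ← Finset.sum_mul]
    change chainTrace (truncate (adj K) B * ⁅truncate H B, term Ψ C⁆) = 0
    have hC : term Ψ C ∈ localAlg d B :=
      localAlg_mono ((self_subset_thicken n C).trans hB) (term_mem Ψ C)
    have h2 : chainTrace (truncate (adj K) B * ⁅truncate H B, term Ψ C⁆) =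
        chainTrace (⁅truncate (adj K) B, truncate H B⁆ * term Ψ C) := by
      rw [Ring.lie_def, Ring.lie_def, mul_sub, sub_mul, map_sub, map_sub, ← mul_assoc, ← mul_assoc,
        chainTrace_mul_comm (mul_mem (truncate_mem (adj K) B) hC) (truncate_mem H B),
        ← mul_assoc]
    rw [h2, term, chainTrace_mul_termOp _
      (lie_mem_localAlg (truncate_mem (adj K) B) (truncate_mem H B)), hBC, hadj]
    simp
  have hsum := mass_transport hF hloc hg hh
  rw [Finset.sum_const_zero] at hsum
  -- The squared norms of the anchored terms sum to zero, so each vanishes. Every nonempty support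
  -- of K is a translate of an anchored set.
  have hzero : ∀ A ∈ anchored (n + m), K A = 0 := fun A hA =>
    eq_zero_of_sum_chainTrace_adj_mul K _ hsum hA
  have hshift : ∀ (k : ℤ) (A : Finset ℤ), K A = 0 → K (shiftBy k A) = 0 := by
    have h1 : ∀ A, K (shift A) = 0 ↔ K A = 0 := by
      intro A
      rw [← term_eq_zero_iff, ← term_eq_zero_iff]
      conv_rhs => rw [← hK_inv, term_translateOp]
      simp
    intro k A hA
    induction k using Int.induction_on with
    | zero => rwa [shiftBy_zero]
    | succ n ih => rwa [← shift_shiftBy, h1]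
    | pred n ih => rwa [← h1, shift_shiftBy, sub_add_cancel]
  funext A
  by_contra hA
  rcases A.eq_empty_or_nonempty with rfl | hne
  · exact hA (opComm_empty hH.finiteRange hΨ.finiteRange)
  · obtain ⟨i, hi⟩ := hK_loc A hA
    obtain ⟨C, hC, hCA⟩ := exists_anchored hne hi
    exact hA (hCA ▸ hshift (A.min' hne) C (hzero C hC))

end DoubleCommutator

/-! ### Traceless operators and partial inverses -/

/-- The traceless operators on the sites `A`, as operators on the chain. -/
def tracelessAlg (d : ℕ) (A : Finset ℤ) : Submodule ℂ (Chain d) := LinearMap.range (termOp A)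

theorem termOp_mem_tracelessAlg (A : Finset ℤ) (X : Op₀ d A) : termOp A X ∈ tracelessAlg d A :=
  ⟨X, rfl⟩

theorem term_mem_tracelessAlg (Φ : FormalOp d) (A : Finset ℤ) : term Φ A ∈ tracelessAlg d A :=
  ⟨_, rfl⟩

theorem slice_eq_slicing (A : Finset ℤ) (s t : A → Fin d) :
    slice A s t = slicing A (Matrix.entryLinearMap ℂ ℂ s t) := by
  refine LinearMap.ext fun X => ?_
  rw [slicing_apply, Finset.sum_eq_single s, Finset.sum_eq_single t]
  · simp
  · intro t' _ ht; simp [ht]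
  · simp
  · intro s' _ hs; simp [hs]
  · simp

/-- The amplification `id ⊗ L` of a linear map `L` from the operators on `B` to the traceless
operators on `A`. -/
def amplify {A B : Finset ℤ} (L : Op d B →ₗ[ℂ] Op₀ d A) : Chain d →ₗ[ℂ] Chain d :=
  ∑ s, ∑ t, LinearMap.mulRight ℂ (termOp A (L (Matrix.single s t 1))) ∘ₗ slice B s t

theorem amplify_apply {A B : Finset ℤ} (L : Op d B →ₗ[ℂ] Op₀ d A) (X : Chain d) :
    amplify L X = ∑ s, ∑ t, slice B s t X * termOp A (L (Matrix.single s t 1)) := by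
  simp [amplify]

theorem amplify_mul_toChain {A B : Finset ℤ} (L : Op d B →ₗ[ℂ] Op₀ d A) {X : Chain d}
    (hX : ∀ Y ∈ localAlg d B, Commute X Y) (M : Op d B) :
    amplify L (X * toChain B M) = X * termOp A (L M) := by
  rw [amplify_apply]
  simp only [slice_mul_left hX, slice_toChain, mul_smul_comm, mul_one, smul_mul_assoc]
  conv_rhs => rw [Matrix.matrix_eq_sum_single M]
  simp only [map_sum, Finset.mul_sum]
  refine Finset.sum_congr rfl fun s _ => Finset.sum_congr rfl fun t _ => ?_
  have : Matrix.single s t (M s t) = M s t • Matrix.single s t (1 : ℂ) := by simp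
  rw [this, map_smul, map_smul, mul_smul_comm]

theorem amplify_lie {A B : Finset ℤ} (hAB : A ⊆ B) (L : Op d B →ₗ[ℂ] Op₀ d A) {X : Chain d}
    (hX : ∀ Y ∈ localAlg d B, Commute X Y) (Y : Chain d) :
    amplify L ⁅X, Y⁆ = ⁅X, amplify L Y⁆ := by
  rw [amplify_apply, amplify_apply]
  simp only [lie_sum]
  refine Finset.sum_congr rfl fun s _ => Finset.sum_congr rfl fun t _ => ?_
  have h1 := (hX _ (localAlg_mono hAB (termOp_mem A (L (Matrix.single s t 1))))).eq
  rw [slice_eq_slicing, slicing_lie hX, Ring.lie_def, Ring.lie_def, sub_mul, mul_assoc, mul_assoc,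
    mul_assoc, h1]

section

variable [NeZero d]

theorem mem_tracelessAlg {A : Finset ℤ} {X : Chain d} :
    X ∈ tracelessAlg d A ↔ X ∈ localAlg d A ∧ ∀ i ∈ A, siteTrace d i X = 0 := by
  constructor
  · rintro ⟨x, rfl⟩
    exact ⟨termOp_mem A x, fun i hi => siteTrace_toChain_of_mem x.2 hi⟩
  · rintro ⟨h1, h2⟩
    exact ⟨_, termOp_coeff h1 h2⟩

theorem termOp_coeff_of_mem {A : Finset ℤ} {X : Chain d} (hX : X ∈ tracelessAlg d A) :
    termOp A (coeff A X) = X := by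
  obtain ⟨x, rfl⟩ := hX
  rw [coeff_termOp_self]

theorem coeff_of_mem_of_ne {A C : Finset ℤ} (h : A ≠ C) {X : Chain d}
    (hX : X ∈ tracelessAlg d A) : coeff C X = 0 := by
  obtain ⟨x, rfl⟩ := hX
  exact coeff_termOp_of_ne h x

theorem lie_mem_tracelessAlg {A B C : Finset ℤ} {i : ℤ} (hC : A ∪ B = C) (h : A ∩ B = {i})
    {X Y : Chain d} (hX : X ∈ tracelessAlg d A) (hY : Y ∈ tracelessAlg d B) :
    ⁅X, Y⁆ ∈ tracelessAlg d C := by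
  rw [mem_tracelessAlg] at hX hY
  exact ⟨_, termOp_coeff_lie hC h hX.1 hX.2 hY.1 hY.2⟩

theorem termOp_coeff_singleton {j : ℤ} {X : Chain d} (hX : X ∈ localAlg d {j}) :
    termOp {j} (coeff {j} X) = X - siteTrace d j X := by
  rw [eq_sub_iff_add_eq]
  have h1 : ∀ Y : Chain d, Y ∈ localAlg d {j} →
      Y = termOp ∅ (coeff ∅ Y) + termOp {j} (coeff {j} Y) := by
    intro Y hY
    conv_lhs => rw [eq_sum_coeff hY]
    rw [show ({j} : Finset ℤ).powerset = {∅, {j}} from rfl, Finset.sum_pair]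
    exact (Finset.singleton_ne_empty j).symm
  have h2 : siteTrace d j X = termOp ∅ (coeff ∅ X) := by
    conv_lhs => rw [h1 X hX]
    rw [map_add, siteTrace_termOp, siteTrace_termOp]
    simp
  rw [h2, add_comm]
  exact (h1 X hX).symm

theorem amplify_mem {A B C : Finset ℤ} (hAB : A ⊆ B) (hCB : Disjoint C B)
    (L : Op d B →ₗ[ℂ] Op₀ d A) {X : Chain d} (hX : X ∈ tracelessAlg d (C ∪ B)) :
    amplify L X ∈ tracelessAlg d (C ∪ A) := by
  rw [mem_tracelessAlg] at hX
  have hs : ∀ s t, slice B s t X ∈ localAlg d C := fun s t => by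
    rw [slice_eq_slicing]; exact slicing_mem hCB _ hX.1
  rw [mem_tracelessAlg, amplify_apply]
  constructor
  · exact sum_mem fun s _ => sum_mem fun t _ =>
      mul_mem (localAlg_mono Finset.subset_union_left (hs s t))
        (localAlg_mono Finset.subset_union_right (termOp_mem _ _))
  · intro i hi
    simp only [map_sum]
    refine Finset.sum_eq_zero fun s _ => Finset.sum_eq_zero fun t _ => ?_
    by_cases hiB : i ∈ B
    · have hiC : i ∉ C := Finset.disjoint_right.1 hCB hiB
      have hiA : i ∈ A := (Finset.mem_union.1 hi).resolve_left hiC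
      rw [siteTrace_mul_left hiC (hs s t), siteTrace_termOp, if_pos hiA, mul_zero]
    · have hiA : i ∉ A := fun h => hiB (hAB h)
      have hiC : i ∈ C := (Finset.mem_union.1 hi).resolve_right hiA
      rw [siteTrace_mul_right hiA (termOp_mem _ _), slice_eq_slicing, siteTrace_slicing hiB,
        hX.2 i (Finset.mem_union_left _ hiC), map_zero, zero_mul]

/-- An operator which is traceless at the site `j` is a sum of products with traceless operators
at `j`. -/
theorem eq_sum_slice_mul_termOp {j : ℤ} {X : Chain d} {A : Finset ℤ} (hj : j ∉ A)
    (hX : X ∈ localAlg d (A ∪ {j})) (h0 : siteTrace d j X = 0) :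
    X = ∑ s, ∑ t, slice {j} s t X * termOp {j} (coeff {j} (unit {j} s t)) := by
  have hs : ∀ s t, slice {j} s t X ∈ localAlg d A := fun s t => by
    rw [slice_eq_slicing]; exact slicing_mem (by simpa using hj) _ hX
  have h1 : X = X - siteTrace d j X := by rw [h0, sub_zero]
  conv_lhs => rw [h1, eq_sum_slice_mul_unit {j} X]
  simp only [map_sum, ← Finset.sum_sub_distrib]
  refine Finset.sum_congr rfl fun s _ => Finset.sum_congr rfl fun t _ => ?_
  rw [siteTrace_mul_left hj (hs s t), ← mul_sub, termOp_coeff_singleton (unit_mem _ _ _)]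

/-- A partial inverse of the commutator with a fixed operator `h` on the sites `B ∋ j`. -/
theorem exists_amplify_lie {j : ℤ} {B : Finset ℤ} (hj : j ∈ B) {h : Chain d}
    (hh : h ∈ localAlg d B) (hinj : ∀ y ∈ tracelessAlg d {j}, ⁅y, h⁆ = 0 → y = 0) :
    ∃ L : Op d B →ₗ[ℂ] Op₀ d {j}, ∀ A : Finset ℤ, Disjoint A B → ∀ X ∈ localAlg d (A ∪ {j}),
      siteTrace d j X = 0 → amplify L ⁅X, h⁆ = X := by
  have hjB : ({j} : Finset ℤ) ⊆ B := by simpa using hj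
  obtain ⟨M, rfl⟩ := hh
  let f : Op₀ d {j} →ₗ[ℂ] Op d B :=
    { toFun := fun y => embed hjB (y : Op d {j}) * M - M * embed hjB (y : Op d {j})
      map_add' := by
        intro x y
        apply toChain_injective B
        simp only [map_sub, map_add, map_mul, toChain_embed, Submodule.coe_add]
        noncomm_ring
      map_smul' := by
        intro c x
        apply toChain_injective B
        simp only [map_sub, map_mul, toChain_embed, Submodule.coe_smul, map_smul,
          smul_mul_assoc, mul_smul_comm, RingHom.id_apply, smul_sub] }
  have hf : ∀ y, toChain B (f y) = ⁅termOp {j} y, toChain B M⁆ := by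
    intro y
    change toChain B (embed hjB (y : Op d {j}) * M - M * embed hjB (y : Op d {j})) = _
    rw [map_sub, map_mul, map_mul, toChain_embed, Ring.lie_def, termOp_apply]
  have hker : LinearMap.ker f = ⊥ := by
    rw [LinearMap.ker_eq_bot']
    intro y hy
    have h1 := hf y
    rw [hy, map_zero] at h1
    have h2 := hinj _ (termOp_mem_tracelessAlg {j} y) h1.symm
    exact termOp_injective {j} (by rw [h2, map_zero])
  -- Any left inverse will do. It is amplified to act as the identity on the sites outside B.
  obtain ⟨L, hL⟩ := LinearMap.exists_leftInverse_of_injective (K := ℂ) (V := Op₀ d {j})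
    (V' := Op d B) f hker
  refine ⟨L, fun A hA X hX h0 => ?_⟩
  have hjA : j ∉ A := Finset.disjoint_right.1 hA hj
  have hs : ∀ s t, slice {j} s t X ∈ localAlg d A := fun s t => by
    rw [slice_eq_slicing]; exact slicing_mem (by simpa using hjA) _ hX
  conv_rhs => rw [eq_sum_slice_mul_termOp hjA hX h0]
  conv_lhs => rw [eq_sum_slice_mul_termOp hjA hX h0]
  simp only [sum_lie, map_sum]
  refine Finset.sum_congr rfl fun s _ => Finset.sum_congr rfl fun t _ => ?_
  have h1 : ∀ y : Op₀ d {j}, ⁅slice {j} s t X * termOp {j} y, toChain B M⁆ =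
      slice {j} s t X * toChain B (f y) := by
    intro y
    rw [hf, Ring.lie_def, Ring.lie_def, mul_sub, ← mul_assoc (toChain B M),
      ← (commute_of_disjoint hA (hs s t) (toChain_mem B M)).eq, mul_assoc, mul_assoc]
  change amplify L ⁅_, toChain B M⁆ = _
  rw [h1, amplify_mul_toChain L fun Y hY => commute_of_disjoint hA (hs s t) hY]
  have := LinearMap.congr_fun hL (coeff {j} (unit {j} s t))
  rw [LinearMap.comp_apply, LinearMap.id_apply] at this
  rw [this]

/-- The commutator with an operator on `{i, j}` is injective on the operators on `{j} ∪ B` which are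
traceless at `j`. -/
theorem eq_zero_of_lie_eq_zero {j : ℤ} {B C : Finset ℤ} (hj : j ∉ B) {h : Chain d}
    (hh : h ∈ localAlg d C) (hCB : Disjoint C B)
    (hinj : ∀ y ∈ tracelessAlg d {j}, ⁅h, y⁆ = 0 → y = 0) {X : Chain d}
    (hX : X ∈ localAlg d ({j} ∪ B)) (h0 : siteTrace d j X = 0) (hX0 : ⁅h, X⁆ = 0) : X = 0 := by
  -- Since h acts away from B, its commutator passes to the coefficients of the matrix units on B,
  -- and those are traceless one-site operators at j.
  rw [eq_sum_slice_mul_unit B X]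
  refine Finset.sum_eq_zero fun s _ => Finset.sum_eq_zero fun t _ => ?_
  have : slice B s t X = 0 := by
    refine hinj _ (mem_tracelessAlg.2 ⟨?_, ?_⟩) ?_
    · rw [slice_eq_slicing]; exact slicing_mem (by simpa using hj) _ hX
    · intro i hi
      obtain rfl := Finset.mem_singleton.1 hi
      rw [slice_eq_slicing, siteTrace_slicing hj, h0, map_zero]
    · rw [slice_eq_slicing, ← slicing_lie (fun Y hY => commute_of_disjoint hCB hh hY), hX0,
        map_zero]
  rw [this, zero_mul]

end

/-! ### Supports contained in short intervals -/

theorem eq_pair_of_subset_Ico {C : Finset ℤ} {i j : ℤ} (h : C ⊆ Finset.Ico j (j + (2 : ℕ)))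
    (h1 : i ∈ C) (h2 : i + 1 ∈ C) : C = {i, i + 1} := by
  have a1 := Finset.mem_Ico.1 (h h1)
  have a2 := Finset.mem_Ico.1 (h h2)
  ext x
  rw [Finset.mem_insert, Finset.mem_singleton]
  constructor
  · intro hx
    have := Finset.mem_Ico.1 (h hx)
    omega
  · rintro (rfl | rfl) <;> assumption

theorem eq_triple_of_subset_Ico {C : Finset ℤ} {i j : ℤ} (h : C ⊆ Finset.Ico j (j + (3 : ℕ)))
    (h1 : i ∈ C) (h2 : i + 1 ∈ C) (h3 : i + 1 + 1 ∈ C) : C = {i, i + 1, i + 1 + 1} := by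
  have a1 := Finset.mem_Ico.1 (h h1)
  have a2 := Finset.mem_Ico.1 (h h2)
  have a3 := Finset.mem_Ico.1 (h h3)
  ext x
  rw [Finset.mem_insert, Finset.mem_insert, Finset.mem_singleton]
  constructor
  · intro hx
    have := Finset.mem_Ico.1 (h hx)
    omega
  · rintro (rfl | rfl | rfl) <;> assumption

theorem eq_singleton_of_subset_Ico {C : Finset ℤ} {i j : ℤ}
    (h : C ⊆ Finset.Ico j (j + (1 : ℕ))) (h1 : i ∈ C) : C = {i} := by
  have a1 := Finset.mem_Ico.1 (h h1)
  ext x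
  rw [Finset.mem_singleton]
  constructor
  · intro hx
    have := Finset.mem_Ico.1 (h hx)
    omega
  · rintro rfl; assumption

theorem AtMostLocal.one_of_two {Φ : FormalOp d} (hΦ : AtMostLocal 2 Φ)
    (h : ∀ i : ℤ, Φ {i, i + 1} = 0) : AtMostLocal 1 Φ := by
  intro A hA
  obtain ⟨i, hi⟩ := hΦ A hA
  have hiA : ∀ x ∈ A, i ≤ x ∧ x < i + 2 := fun x hx => by simpa using hi hx
  by_cases h1 : i ∈ A
  · by_cases h2 : i + 1 ∈ A
    · have := eq_pair_of_subset_Ico hi h1 h2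
      subst this
      exact absurd (h i) hA
    · refine ⟨i, fun x hx => ?_⟩
      have h3 := hiA x hx
      have : x ≠ i + 1 := fun e => h2 (e ▸ hx)
      rw [Finset.mem_Ico]; push_cast; omega
  · refine ⟨i + 1, fun x hx => ?_⟩
    have h3 := hiA x hx
    have : x ≠ i := fun e => h1 (e ▸ hx)
    rw [Finset.mem_Ico]; push_cast; omega

section TwoLocal

variable [NeZero d]

/-! ### Consequences of the assumptions on the interaction -/

theorem translateChain_mem_tracelessAlg {A : Finset ℤ} {X : Chain d} :
    translateChain d X ∈ tracelessAlg d A ↔ X ∈ tracelessAlg d (shift A) := by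
  simp only [mem_tracelessAlg]
  constructor
  · rintro ⟨h1, h2⟩
    have h3 : X ∈ localAlg d (shift A) := by
      have := translateChain_symm_mem h1
      rwa [AlgEquiv.symm_apply_apply] at this
    refine ⟨h3, fun i hi => (translateChain d).injective ?_⟩
    have := h2 (i - 1) (mem_shift.1 hi)
    rwa [translateChain_siteTrace _ h3, sub_add_cancel, ← map_zero (translateChain d)] at this
  · rintro ⟨h1, h2⟩
    refine ⟨translateChain_mem h1, fun i hi => ?_⟩
    rw [translateChain_siteTrace _ h1, h2 _ (mem_shift.2 (by simpa using hi)), map_zero]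

theorem shift_pair (i j : ℤ) : shift {i, j} = {i + 1, j + 1} := by
  simp [shift]

theorem shift_singleton (i : ℤ) : shift {i} = {i + 1} := by
  simp [shift]

/-- A property of the terms of a translation-invariant operator holds at all sites if it holds
at one site. -/
theorem lie_eq_zero_translate {H : FormalOp d} (hH_inv : translateOp H = H) {i j l : ℤ} :
    (∀ y ∈ tracelessAlg d {l}, ⁅term H {i, j}, y⁆ = 0 → y = 0) ↔
      ∀ y ∈ tracelessAlg d {l + 1}, ⁅term H {i + 1, j + 1}, y⁆ = 0 → y = 0 := by
  have h1 : term H {i, j} = translateChain d (term H {i + 1, j + 1}) := by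
    rw [← shift_pair, ← term_translateOp, hH_inv]
  rw [h1, ← shift_singleton l]
  constructor
  · intro h y hy hy0
    have := h _ (translateChain_mem_tracelessAlg.2 hy) (by
      rw [← translateChain_lie, hy0, map_zero])
    simpa using this
  · intro h y hy hy0
    obtain ⟨x, rfl⟩ := (translateChain d).surjective y
    rw [← translateChain_lie, map_eq_zero_iff _ (translateChain d).injective] at hy0
    rw [h x (translateChain_mem_tracelessAlg.1 hy) hy0, map_zero]

theorem commute_of_lie_eq_zero {A C : Finset ℤ} (hA : A ⊆ C) {X : Op d A} {Y : Op d C}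
    (h : ⁅toChain C Y, toChain A X⁆ = 0) : Commute (embed hA X) Y := by
  apply toChain_injective C
  rw [map_mul, map_mul, toChain_embed]
  rw [Ring.lie_def, sub_eq_zero] at h
  exact h.symm

theorem InjectiveInteraction.right {H : FormalOp d} (hH_inj : InjectiveInteraction H)
    (hH_inv : translateOp H = H) (i : ℤ) :
    ∀ y ∈ tracelessAlg d {i + 1}, ⁅term H {i, i + 1}, y⁆ = 0 → y = 0 := by
  have base : ∀ y ∈ tracelessAlg d {(1 : ℤ) + 1}, ⁅term H {1, (1 : ℤ) + 1}, y⁆ = 0 → y = 0 := by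
    rintro _ ⟨x, rfl⟩ h
    rw [show x = 0 from hH_inj.1 x (commute_of_lie_eq_zero _ h), map_zero]
  induction i using Int.induction_on with
  -- The assumption is given at the bond {1, 2}, so the bond {0, 1} is reached by one step
  -- backwards.
  | zero => exact (lie_eq_zero_translate hH_inv).2 (by simpa using base)
  | succ n ih => exact (lie_eq_zero_translate hH_inv).1 ih
  | pred n ih =>
    refine (lie_eq_zero_translate hH_inv).2 ?_
    rwa [sub_add_cancel]

theorem InjectiveInteraction.left {H : FormalOp d} (hH_inj : InjectiveInteraction H)
    (hH_inv : translateOp H = H) (i : ℤ) :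
    ∀ y ∈ tracelessAlg d {i}, ⁅y, term H {i, i + 1}⁆ = 0 → y = 0 := by
  have base : ∀ y ∈ tracelessAlg d {(1 : ℤ)}, ⁅term H {1, (1 : ℤ) + 1}, y⁆ = 0 → y = 0 := by
    rintro _ ⟨x, rfl⟩ h
    rw [show x = 0 from hH_inj.2 x (commute_of_lie_eq_zero _ h), map_zero]
  have key : ∀ y ∈ tracelessAlg d {i}, ⁅term H {i, i + 1}, y⁆ = 0 → y = 0 := by
    induction i using Int.induction_on with
    | zero => exact (lie_eq_zero_translate hH_inv).2 (by simpa using base)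
    | succ n ih => exact (lie_eq_zero_translate hH_inv).1 ih
    | pred n ih =>
      refine (lie_eq_zero_translate hH_inv).2 ?_
      rwa [sub_add_cancel]
  intro y hy h
  exact key y hy (by rw [← lie_skew, h, neg_zero])

theorem OneDimTwoLocal.exists_smul {H : FormalOp d} (hH_one : OneDimTwoLocal H)
    {a : ℤ → Chain d} (ha : ∀ i, a i ∈ tracelessAlg d {i, i + 1})
    (h : ∀ i, ⁅term H {i, i + 1}, a (i + 1)⁆ = ⁅a i, term H {i + 1, i + 1 + 1}⁆) :
    ∃ α : ℂ, ∀ i, a i = α • term H {i, i + 1} := by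
  have hadj : ∀ i x y, toChain {i, i + 1, i + 1 + 1} (adjacentComm (d := d) i x y) =
      ⁅termOp {i, i + 1} x, termOp {i + 1, i + 1 + 1} y⁆ := by
    intro i x y
    simp only [adjacentComm]
    rw [map_sub, map_mul, map_mul, toChain_embed, toChain_embed, Ring.lie_def]
    rfl
  obtain ⟨α, hα⟩ := hH_one (fun i => coeff {i, i + 1} (a i)) fun i => by
    apply toChain_injective
    rw [hadj, hadj, termOp_coeff_of_mem (ha i), termOp_coeff_of_mem (ha (i + 1))]
    exact h i
  refine ⟨α, fun i => ?_⟩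
  rw [← termOp_coeff_of_mem (ha i), hα i, map_smul]
  rfl

/-- The relation at i determines c_i from c_{i+1}: the partial inverse of y ↦ [y, h_{i+2}] acts away
from h_i, so applying it to both sides gives c_i = [h_i, a_{i+1}], where a_{i+1} is its value on
c_{i+1}. Substituting this back shows that h_i commutes with c_{i+1} - [a_{i+1}, h_{i+2}], an
operator traceless at i+1, and injectivity makes it zero. -/
theorem exists_factorization {h : ℤ → Chain d} (hh : ∀ i, h i ∈ tracelessAlg d {i, i + 1})
    (hr : ∀ i, ∀ y ∈ tracelessAlg d {i + 1}, ⁅h i, y⁆ = 0 → y = 0)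
    (hl : ∀ i, ∀ y ∈ tracelessAlg d {i}, ⁅y, h i⁆ = 0 → y = 0)
    {c : ℤ → Chain d} (hc : ∀ i, c i ∈ tracelessAlg d {i, i + 1, i + 1 + 1})
    (hcc : ∀ i, ⁅h i, c (i + 1)⁆ = ⁅c i, h (i + 1 + 1)⁆) :
    ∃ a : ℤ → Chain d, (∀ i, a i ∈ tracelessAlg d {i, i + 1}) ∧
      (∀ i, c i = ⁅h i, a (i + 1)⁆) ∧ ∀ i, c i = ⁅a i, h (i + 1)⁆ := by
  have hloc : ∀ i, h i ∈ localAlg d {i, i + 1} := fun i => (mem_tracelessAlg.1 (hh i)).1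
  choose L hL using fun j : ℤ => exists_amplify_lie (d := d) (Finset.mem_insert_self j {j + 1})
    (hloc j) (hl j)
  have hdis : ∀ i : ℤ, Disjoint ({i, i + 1} : Finset ℤ) {i + 1 + 1, i + 1 + 1 + 1} := by
    intro i
    rw [Finset.disjoint_left]
    intro x
    simp only [Finset.mem_insert, Finset.mem_singleton]
    omega
  have ha : ∀ i, amplify (L (i + 1)) (c i) ∈ tracelessAlg d {i, i + 1} := by
    intro i
    have := amplify_mem (C := {i}) (A := {i + 1}) (B := {i + 1, i + 1 + 1}) (by simp)
      (by simp only [Finset.disjoint_singleton_left, Finset.mem_insert, Finset.mem_singleton]; omega)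
      (L (i + 1)) (hc i)
    exact this
  have h1 : ∀ i, c i = ⁅h i, amplify (L (i + 1 + 1)) (c (i + 1))⁆ := by
    intro i
    have h2 := mem_tracelessAlg.1 (hc i)
    rw [← amplify_lie (by simp) _ fun Y hY => commute_of_disjoint (hdis i) (hloc i) hY, hcc,
      hL (i + 1 + 1) {i, i + 1} (hdis i) (c i) (by
        convert h2.1 using 2
        ext x; simp only [Finset.mem_insert, Finset.mem_singleton, Finset.mem_union]; omega)
      (h2.2 _ (by simp))]
  refine ⟨fun i => amplify (L (i + 1)) (c i), ha, h1, ?_⟩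
  have h3 : ∀ i, c (i + 1) = ⁅amplify (L (i + 1 + 1)) (c (i + 1)), h (i + 1 + 1)⁆ := by
    intro i
    have h4 : c (i + 1) - ⁅amplify (L (i + 1 + 1)) (c (i + 1)), h (i + 1 + 1)⁆ ∈
        tracelessAlg d {i + 1, i + 1 + 1, i + 1 + 1 + 1} := by
      refine sub_mem (hc (i + 1)) (lie_mem_tracelessAlg (i := i + 1 + 1) ?_ ?_ (ha (i + 1))
        (hh (i + 1 + 1)))
      · ext x; simp only [Finset.mem_insert, Finset.mem_singleton, Finset.mem_union]; omega
      · ext x; simp only [Finset.mem_insert, Finset.mem_singleton, Finset.mem_inter]; omega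
    rw [mem_tracelessAlg] at h4
    refine sub_eq_zero.1 (eq_zero_of_lie_eq_zero (j := i + 1) (B := {i + 1 + 1, i + 1 + 1 + 1})
      (by simp only [Finset.mem_insert, Finset.mem_singleton]; omega)
      (hloc i) (hdis i) (hr i) h4.1 (h4.2 _ (by simp)) ?_)
    have h5 : ⁅h i, h (i + 1 + 1)⁆ = 0 :=
      lie_eq_zero_of_disjoint (hdis i) (hloc i) (hloc (i + 1 + 1))
    -- Jacobi with [h_i, h_{i+2}] = 0 turns [h_i, [a_{i+1}, h_{i+2}]] into [c_i, h_{i+2}].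
    rw [lie_sub, leibniz_lie (h i), ← h1 i, h5, lie_zero, add_zero, hcc, sub_self]
  have h6 : ∀ a : ℤ → Chain d, (∀ i, c (i + 1) = ⁅a (i + 1), h (i + 1 + 1)⁆) →
      ∀ i, c i = ⁅a i, h (i + 1)⁆ := by
    intro a ha i
    have := ha (i - 1)
    simpa only [sub_add_cancel] using this
  exact h6 (fun i => amplify (L (i + 1)) (c i)) h3

/-! ### Components of commutators with a two-local operator -/

theorem term_opComm {Φ Ψ : FormalOp d} (hΦ : FiniteRange Φ) (hΨ : FiniteRange Ψ)
    {A : Finset ℤ} (S : Finset (Finset ℤ × Finset ℤ))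
    (hS : ∀ C D, coeff A ⁅term Φ C, term Ψ D⁆ ≠ 0 → (C, D) ∈ S)
    (hmem : ∀ p ∈ S, ⁅term Φ p.1, term Ψ p.2⁆ ∈ tracelessAlg d A) :
    term (opComm Φ Ψ) A = ∑ p ∈ S, ⁅term Φ p.1, term Ψ p.2⁆ := by
  rw [term, opComm_eq_sum hΦ hΨ S hS, map_sum]
  exact Finset.sum_congr rfl fun p hp => termOp_coeff_of_mem (hmem p hp)

/-- The maximal support can only come from two pairs sharing the middle site. With a single common
site the commutator is already traceless, so no projection is left in the formula. -/
theorem term_opComm_triple {Φ Ψ : FormalOp d} (hΦ : AtMostLocal 2 Φ) (hΨ : AtMostLocal 2 Ψ)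
    (i : ℤ) : term (opComm Φ Ψ) {i, i + 1, i + 1 + 1} =
      ⁅term Φ {i, i + 1}, term Ψ {i + 1, i + 1 + 1}⁆ +
      ⁅term Φ {i + 1, i + 1 + 1}, term Ψ {i, i + 1}⁆ := by
  have hne : (({i, i + 1}, {i + 1, i + 1 + 1}) : Finset ℤ × Finset ℤ) ≠
      ({i + 1, i + 1 + 1}, {i, i + 1}) := by
    intro h
    have : i ∈ ({i + 1, i + 1 + 1} : Finset ℤ) := by
      rw [← (Prod.mk.inj h).1]; simp
    simp only [Finset.mem_insert, Finset.mem_singleton] at this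
    omega
  rw [term_opComm hΦ.finiteRange hΨ.finiteRange
    {({i, i + 1}, {i + 1, i + 1 + 1}), ({i + 1, i + 1 + 1}, {i, i + 1})}, Finset.sum_pair hne]
  · intro C D h
    obtain ⟨h1, h2, h3, h4⟩ := coeff_lie_term h
    obtain ⟨j, hj⟩ := hΦ C h1
    obtain ⟨k, hk⟩ := hΨ D h2
    obtain ⟨x, hx, hx'⟩ := Finset.not_disjoint_iff.1 h3
    have b1 := Finset.mem_Ico.1 (hj hx)
    have b2 := Finset.mem_Ico.1 (hk hx')
    have hC : ∀ y ∈ C, j ≤ y ∧ y < j + 2 := fun y hy => by simpa using hj hy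
    have hD : ∀ y ∈ D, k ≤ y ∧ y < k + 2 := fun y hy => by simpa using hk hy
    have m1 : i ∈ C ∪ D := h4 (by simp)
    have m3 : i + 1 + 1 ∈ C ∪ D := h4 (by simp)
    rw [Finset.mem_insert, Finset.mem_singleton]
    rcases Finset.mem_union.1 m1 with m1 | m1 <;> rcases Finset.mem_union.1 m3 with m3 | m3
    · have := hC _ m1; have := hC _ m3; omega
    · have := hC _ m1; have := hD _ m3
      obtain rfl : x = i + 1 := by omega
      left
      rw [eq_pair_of_subset_Ico hj m1 hx, eq_pair_of_subset_Ico hk hx' m3]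
    · have := hD _ m1; have := hC _ m3
      obtain rfl : x = i + 1 := by omega
      right
      rw [eq_pair_of_subset_Ico hj hx m3, eq_pair_of_subset_Ico hk m1 hx']
    · have := hD _ m1; have := hD _ m3; omega
  · intro p hp
    rw [Finset.mem_insert, Finset.mem_singleton] at hp
    rcases hp with rfl | rfl
    · refine lie_mem_tracelessAlg (i := i + 1) ?_ ?_ (term_mem_tracelessAlg _ _)
        (term_mem_tracelessAlg _ _)
      · ext x; simp only [Finset.mem_insert, Finset.mem_singleton, Finset.mem_union]; omega
      · ext x; simp only [Finset.mem_insert, Finset.mem_singleton, Finset.mem_inter]; omega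
    · refine lie_mem_tracelessAlg (i := i + 1) ?_ ?_ (term_mem_tracelessAlg _ _)
        (term_mem_tracelessAlg _ _)
      · ext x; simp only [Finset.mem_insert, Finset.mem_singleton, Finset.mem_union]; omega
      · ext x; simp only [Finset.mem_insert, Finset.mem_singleton, Finset.mem_inter]; omega

theorem term_opComm_quadruple {Φ Ψ : FormalOp d} (hΦ : AtMostLocal 2 Φ) (hΨ : AtMostLocal 3 Ψ)
    (i : ℤ) : term (opComm Φ Ψ) {i, i + 1, i + 1 + 1, i + 1 + 1 + 1} =
      ⁅term Φ {i, i + 1}, term Ψ {i + 1, i + 1 + 1, i + 1 + 1 + 1}⁆ +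
      ⁅term Φ {i + 1 + 1, i + 1 + 1 + 1}, term Ψ {i, i + 1, i + 1 + 1}⁆ := by
  have hne : (({i, i + 1}, {i + 1, i + 1 + 1, i + 1 + 1 + 1}) : Finset ℤ × Finset ℤ) ≠
      ({i + 1 + 1, i + 1 + 1 + 1}, {i, i + 1, i + 1 + 1}) := by
    intro h
    have : i ∈ ({i + 1 + 1, i + 1 + 1 + 1} : Finset ℤ) := by
      rw [← (Prod.mk.inj h).1]; simp
    simp only [Finset.mem_insert, Finset.mem_singleton] at this
    omega
  rw [term_opComm hΦ.finiteRange hΨ.finiteRange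
    {({i, i + 1}, {i + 1, i + 1 + 1, i + 1 + 1 + 1}),
      ({i + 1 + 1, i + 1 + 1 + 1}, {i, i + 1, i + 1 + 1})}, Finset.sum_pair hne]
  · intro C D h
    obtain ⟨h1, h2, h3, h4⟩ := coeff_lie_term h
    obtain ⟨j, hj⟩ := hΦ C h1
    obtain ⟨k, hk⟩ := hΨ D h2
    obtain ⟨x, hx, hx'⟩ := Finset.not_disjoint_iff.1 h3
    have hC : ∀ y ∈ C, j ≤ y ∧ y < j + 2 := fun y hy => by simpa using hj hy
    have hD : ∀ y ∈ D, k ≤ y ∧ y < k + 3 := fun y hy => by simpa using hk hy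
    have b1 := hC _ hx
    have b2 := hD _ hx'
    have m1 : i ∈ C ∪ D := h4 (by simp)
    have m2 : i + 1 ∈ C ∪ D := h4 (by simp)
    have m3 : i + 1 + 1 ∈ C ∪ D := h4 (by simp)
    have m4 : i + 1 + 1 + 1 ∈ C ∪ D := h4 (by simp)
    rw [Finset.mem_insert, Finset.mem_singleton]
    rcases Finset.mem_union.1 m1 with m1 | m1 <;> rcases Finset.mem_union.1 m4 with m4 | m4
    · have := hC _ m1; have := hC _ m4; omega
    · have := hC _ m1; have := hD _ m4
      obtain rfl : x = i + 1 := by omega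
      have m3' : i + 1 + 1 ∈ D :=
        (Finset.mem_union.1 m3).resolve_left fun h => by have := hC _ h; omega
      left
      rw [eq_pair_of_subset_Ico hj m1 hx, eq_triple_of_subset_Ico hk hx' m3' m4]
    · have := hD _ m1; have := hC _ m4
      obtain rfl : x = i + 1 + 1 := by omega
      have m2' : i + 1 ∈ D :=
        (Finset.mem_union.1 m2).resolve_left fun h => by have := hC _ h; omega
      right
      rw [eq_pair_of_subset_Ico hj hx m4, eq_triple_of_subset_Ico hk m1 m2' hx']
    · have := hD _ m1; have := hD _ m4; omega
  · intro p hp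
    rw [Finset.mem_insert, Finset.mem_singleton] at hp
    rcases hp with rfl | rfl
    · refine lie_mem_tracelessAlg (i := i + 1) ?_ ?_ (term_mem_tracelessAlg _ _)
        (term_mem_tracelessAlg _ _)
      · ext x; simp only [Finset.mem_insert, Finset.mem_singleton, Finset.mem_union]; omega
      · ext x; simp only [Finset.mem_insert, Finset.mem_singleton, Finset.mem_inter]; omega
    · refine lie_mem_tracelessAlg (i := i + 1 + 1) ?_ ?_ (term_mem_tracelessAlg _ _)
        (term_mem_tracelessAlg _ _)
      · ext x; simp only [Finset.mem_insert, Finset.mem_singleton, Finset.mem_union]; omega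
      · ext x; simp only [Finset.mem_insert, Finset.mem_singleton, Finset.mem_inter]; omega

/-! ### Commutators with one-local operators, which preserve supports -/

theorem lie_term_mem_of_one_local {Φ Ψ : FormalOp d} (hΨ : AtMostLocal 1 Ψ) {A C D : Finset ℤ}
    (h : coeff A ⁅term Φ C, term Ψ D⁆ ≠ 0) : ∃ x ∈ C, D = {x} ∧ A = C := by
  obtain ⟨h1, h2, h3, _⟩ := coeff_lie_term h
  obtain ⟨k, hk⟩ := hΨ D h2
  obtain ⟨x, hx, hx'⟩ := Finset.not_disjoint_iff.1 h3
  obtain rfl := eq_singleton_of_subset_Ico hk hx'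
  refine ⟨x, hx, rfl, ?_⟩
  by_contra hne
  refine h (coeff_of_mem_of_ne (Ne.symm hne) (lie_mem_tracelessAlg (i := x) ?_ ?_
    (term_mem_tracelessAlg Φ C) (term_mem_tracelessAlg Ψ {x})))
  · simpa using hx
  · simpa using hx

theorem lie_term_singleton_mem (Φ Ψ : FormalOp d) {C : Finset ℤ} {x : ℤ} (hx : x ∈ C) :
    ⁅term Φ C, term Ψ {x}⁆ ∈ tracelessAlg d C :=
  lie_mem_tracelessAlg (i := x) (by simpa using hx) (by simpa using hx)
    (term_mem_tracelessAlg Φ C) (term_mem_tracelessAlg Ψ {x})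

theorem term_opComm_one_local {Φ Ψ : FormalOp d} (hΦ : FiniteRange Φ) (hΨ : AtMostLocal 1 Ψ)
    (A : Finset ℤ) : term (opComm Φ Ψ) A = ∑ x ∈ A, ⁅term Φ A, term Ψ {x}⁆ := by
  rw [term_opComm hΦ hΨ.finiteRange (A.image fun x => (A, {x})), Finset.sum_image]
  · intro x _ y _ h
    exact Finset.singleton_injective (Prod.mk.inj h).2
  · intro C D h
    obtain ⟨x, hx, rfl, rfl⟩ := lie_term_mem_of_one_local hΨ h
    exact Finset.mem_image.2 ⟨x, hx, rfl⟩
  · intro p hp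
    obtain ⟨x, hx, rfl⟩ := Finset.mem_image.1 hp
    exact lie_term_singleton_mem Φ Ψ hx

/-- For one-local operators, the second commutator with `H` vanishes only if the first one does. -/
theorem opComm_eq_zero_of_one_local {H S : FormalOp d} (hH : AtMostLocal 2 H) (hH_sa : IsSelfAdj H)
    (hH_one : OneDimTwoLocal H) (hS : AtMostLocal 1 S) (h0 : opComm H (opComm H S) = 0) :
    opComm H S = 0 := by
  set G := opComm H S with hG
  have hG_loc : AtMostLocal 2 G := hH.opComm le_rfl hS
  have hGt : ∀ A, term G A = ∑ x ∈ A, ⁅term H A, term S {x}⁆ :=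
    term_opComm_one_local hH.finiteRange hS
  have hself : ∀ A, term (adj H) A = term H A := fun A => by rw [adj_eq_self hH_sa]
  -- The vanishing three-site terms of [H, G] are exactly the relations in the uniqueness
  -- assumption.
  obtain ⟨γ, hγ⟩ := hH_one.exists_smul (a := fun i => term G {i, i + 1})
    (fun i => term_mem_tracelessAlg _ _) (by
      intro i
      have h1 := term_opComm_triple hH hG_loc i
      rw [h0, term, Pi.zero_apply, map_zero] at h1
      rw [← lie_skew (term G {i, i + 1}), eq_neg_iff_add_eq_zero]
      exact h1.symm)
  have hedge : ∀ i : ℤ, G {i, i + 1} = 0 := by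
    intro i
    -- tr(h[h, s]) = tr[h, hs] = 0. Hence γ tr(h²) = 0, and h is Hermitian.
    have h1 : chainTrace (term H {i, i + 1} * term G {i, i + 1}) = 0 := by
      rw [hGt, Finset.mul_sum, map_sum]
      refine Finset.sum_eq_zero fun x hx => ?_
      have hxm : term S {x} ∈ localAlg d {i, i + 1} :=
        localAlg_mono (Finset.singleton_subset_iff.2 hx) (term_mem S {x})
      have h2 := chainTrace_lie (term_mem H {i, i + 1}) (mul_mem (term_mem H {i, i + 1}) hxm)
      rw [← h2, Ring.lie_def, Ring.lie_def, mul_sub, mul_assoc]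
    have h3 : term G {i, i + 1} = γ • term H {i, i + 1} := hγ i
    rw [← term_eq_zero_iff, h3]
    rw [h3, mul_smul_comm, map_smul, smul_eq_mul] at h1
    rcases mul_eq_zero.1 h1 with h1 | h1
    · rw [h1, zero_smul]
    · have : H {i, i + 1} = 0 := eq_zero_of_sum_chainTrace_adj_mul H {{i, i + 1}}
        (by rw [Finset.sum_singleton, hself, h1]) (Finset.mem_singleton_self _)
      rw [(term_eq_zero_iff _ _).2 this, smul_zero]
  have hG_one : AtMostLocal 1 G := hG_loc.one_of_two hedge
  have hsite : ∀ i : ℤ, G {i} = 0 := by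
    intro i
    have h1 : ⁅term H {i}, term G {i}⁆ = 0 := by
      have := term_opComm_one_local hH.finiteRange hG_one {i}
      rw [h0, Finset.sum_singleton, term, Pi.zero_apply, map_zero] at this
      exact this.symm
    have h2 : term (adj G) {i} = ⁅term (adj S) {i}, term H {i}⁆ := by
      have e : adj G = -opComm H (adj S) := by
        rw [hG, ← opComm_adj hS hH, adj_eq_self hH_sa,
          opComm_skew hS.adj.finiteRange hH.finiteRange]
      have := term_opComm_one_local hH.finiteRange hS.adj {i}
      rw [Finset.sum_singleton] at this
      rw [e, ← lie_skew, ← this]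
      exact map_neg _ _
    have hs := term_mem (adj S) {i}
    have hh := term_mem H {i}
    have hg := term_mem G {i}
    -- With G_i = [H_i, S_i] and [H_i, G_i] = 0, cyclicity gives tr(G_i† G_i) = tr(S_i† [H_i, G_i])
    -- = 0.
    have h3 : chainTrace (term (adj G) {i} * term G {i}) = 0 := by
      have h4 : chainTrace (term (adj S) {i} * ⁅term H {i}, term G {i}⁆) = 0 := by
        rw [h1, mul_zero, map_zero]
      rw [← h4, h2, Ring.lie_def, Ring.lie_def, sub_mul, mul_sub, map_sub, map_sub, mul_assoc,
        mul_assoc (term H {i}), chainTrace_mul_comm hh (mul_mem hs hg), mul_assoc]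
    exact eq_zero_of_sum_chainTrace_adj_mul G {{i}}
        (by rw [Finset.sum_singleton, h3]) (Finset.mem_singleton_self _)
  funext A
  by_contra hA
  obtain ⟨i, hi⟩ := hG_one A hA
  rcases A.eq_empty_or_nonempty with rfl | ⟨x, hx⟩
  · exact hA (opComm_empty hH.finiteRange hS.finiteRange)
  · obtain rfl := eq_singleton_of_subset_Ico hi hx
    exact hA (hsite x)

end TwoLocal

/-! ### The form of the boost operator -/

theorem term_zero (A : Finset ℤ) : term (0 : FormalOp d) A = 0 := map_zero (termOp A)

theorem opComm_neg [NeZero d] {Φ Ψ : FormalOp d} (hΦ : FiniteRange Φ) (hΨ : FiniteRange Ψ) :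
    opComm Φ (-Ψ) = -opComm Φ Ψ := by
  rw [← zero_sub, opComm_sub hΦ (Ψ := 0) ⟨0, fun A hA => absurd rfl hA⟩ hΨ, opComm_zero hΦ,
    zero_sub]

theorem AtMostLocal.standardBoost {n : ℕ} {H : FormalOp d} (hH : AtMostLocal n H) :
    AtMostLocal n (standardBoost H) := by
  intro A hA
  refine hH A fun h => hA ?_
  by_cases hne : A.Nonempty <;> simp [SpinChain.standardBoost, hne, h]

theorem standardBoost_pair (H : FormalOp d) (i : ℤ) :
    standardBoost H {i, i + 1} = (i : ℂ) • H {i, i + 1} := by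
  have h : ({i, i + 1} : Finset ℤ).Nonempty := ⟨i, by simp⟩
  have hmin : ({i, i + 1} : Finset ℤ).min' h = i := by
    refine le_antisymm (Finset.min'_le _ _ (by simp)) (Finset.le_min' _ _ _ fun y hy => ?_)
    simp only [Finset.mem_insert, Finset.mem_singleton] at hy
    omega
  simp only [standardBoost, dif_pos h, hmin]

/-- The constant term of a formal operator. -/
def constantTerm (Φ : FormalOp d) : FormalOp d := fun A => if A.Nonempty then 0 else Φ A

theorem atMostLocal_constantTerm (Φ : FormalOp d) : AtMostLocal 0 (constantTerm Φ) := by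
  intro A hA
  by_cases h : A.Nonempty
  · simp [constantTerm, h] at hA
  · rw [Finset.not_nonempty_iff_eq_empty] at h
    exact ⟨0, by simp [h]⟩

theorem min'_shift {A : Finset ℤ} (hA : A.Nonempty) (h : (shift A).Nonempty) :
    (shift A).min' h = A.min' hA + 1 := by
  refine le_antisymm (Finset.min'_le _ _ (mem_shift.2 (by simpa using A.min'_mem hA)))
    (Finset.le_min' _ _ _ fun y hy => ?_)
  have := A.min'_le _ (mem_shift.1 hy)
  omega

/-- The shift raises the leftmost site of every nonempty support by one, which adds one copy of H.
The boost has no constant term, so that of H must be removed. -/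
theorem translateOp_standardBoost {H : FormalOp d} (hH_inv : translateOp H = H) :
    translateOp (standardBoost H) = standardBoost H + (H - constantTerm H) := by
  funext A
  by_cases hA : A.Nonempty
  · have hs : (shift A).Nonempty := by
      obtain ⟨x, hx⟩ := hA
      exact ⟨x + 1, mem_shift.2 (by simpa using hx)⟩
    have h1 : translateOp (standardBoost H) A =
        (((shift A).min' hs : ℤ) : ℂ) • translateOp H A := by
      refine Subtype.ext ?_
      change Matrix.submatrix (standardBoost H (shift A) : Op d (shift A)) shiftConfig shiftConfig =
        (((shift A).min' hs : ℤ) : ℂ) •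
          Matrix.submatrix (H (shift A) : Op d (shift A)) shiftConfig shiftConfig
      rw [standardBoost, dif_pos hs]
      rfl
    rw [h1, hH_inv, min'_shift hA hs]
    simp [standardBoost, hA, constantTerm, add_smul]
  · rw [Finset.not_nonempty_iff_eq_empty] at hA
    subst hA
    refine Subtype.ext ?_
    ext s t
    simp [translateOp, standardBoost, constantTerm, shift]

section Boost

variable [NeZero d]

theorem opComm_of_atMostLocal_zero {Φ Ψ : FormalOp d} (hΦ : AtMostLocal 0 Φ)
    (hΨ : FiniteRange Ψ) : opComm Φ Ψ = 0 := by
  funext A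
  rw [opComm_eq_sum hΦ.finiteRange hΨ ∅, Finset.sum_empty, Pi.zero_apply]
  intro C D h
  obtain ⟨h1, _, h3, _⟩ := coeff_lie_term h
  obtain ⟨i, hi⟩ := hΦ C h1
  have : C = ∅ := by simpa using hi
  simp [this] at h3

/-- Commuting with a one-local operator does not mix supports, so each term of H commutes with S
separately and may be rescaled freely. -/
theorem opComm_standardBoost {H S : FormalOp d} (hH : FiniteRange H) (hS : AtMostLocal 1 S)
    (h : opComm H S = 0) : opComm (standardBoost H) S = 0 := by
  have hb : FiniteRange (standardBoost H) := by
    obtain ⟨n, hn⟩ := hH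
    exact ⟨n, hn.standardBoost⟩
  refine formalOp_ext fun A => ?_
  have h1 := term_opComm_one_local hH hS A
  rw [h, term, Pi.zero_apply, map_zero] at h1
  rw [term_opComm_one_local hb hS, term_zero]
  by_cases hA : A.Nonempty
  · have h2 : term (standardBoost H) A = ((A.min' hA : ℤ) : ℂ) • term H A := by
      rw [term, standardBoost, dif_pos hA, map_smul]; rfl
    simp only [h2, smul_lie]
    rw [← Finset.smul_sum, ← h1, smul_zero]
  · rw [Finset.not_nonempty_iff_eq_empty] at hA
    simp [hA]

/-- The interaction part of a two-local operator whose commutator with `H` is conserved. -/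
theorem exists_linear_interaction {H B : FormalOp d} (hH_loc : AtMostLocal 2 H)
    (hH_inv : translateOp H = H) (hH_inj : InjectiveInteraction H) (hH_one : OneDimTwoLocal H)
    (hB_loc : AtMostLocal 2 B) (hQ_cons : IsConserved H (opComm B H)) :
    ∃ α β : ℂ, ∀ i : ℤ, B {i, i + 1} = (α * i + β) • H {i, i + 1} := by
  have hQ_loc : AtMostLocal 3 (opComm B H) := hB_loc.opComm (m := 2) le_rfl hH_loc
  have hq := term_opComm_triple hB_loc hH_loc
  obtain ⟨a, ha, ha1, ha2⟩ := exists_factorization (h := fun i => term H {i, i + 1})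
    (fun i => term_mem_tracelessAlg _ _) (hH_inj.right hH_inv) (hH_inj.left hH_inv)
    (c := fun i => term (opComm B H) {i, i + 1, i + 1 + 1})
    (fun i => term_mem_tracelessAlg _ _) (by
      intro i
      have h1 := term_opComm_quadruple hH_loc hQ_loc i
      rw [hQ_cons, term, Pi.zero_apply, map_zero] at h1
      rw [← lie_skew (term (opComm B H) _), eq_neg_iff_add_eq_zero]
      exact h1.symm)
  obtain ⟨γ, hγ⟩ := hH_one.exists_smul ha fun i => by
    rw [← ha1 i]; exact ha2 i
  -- Now c_i = γ[h_i, h_{i+1}], that is, [b_i, h_{i+1}] - [h_i, b_{i+1}] = γ[h_i, h_{i+1}]. A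
  -- particular solution is b_i = -γ i h_i, and the difference satisfies the homogeneous relation.
  obtain ⟨β, hβ⟩ := hH_one.exists_smul
    (a := fun i : ℤ => term B {i, i + 1} - (-γ * i) • term H {i, i + 1})
    (fun i => sub_mem (term_mem_tracelessAlg _ _)
      (Submodule.smul_mem _ _ (term_mem_tracelessAlg _ _))) (by
      intro i
      have h1 := ha2 i
      simp only [hq, hγ] at h1
      rw [← lie_skew (term B {i + 1, i + 1 + 1}), smul_lie] at h1
      simp only [lie_sub, sub_lie, lie_smul, smul_lie]
      push_cast
      rw [← sub_eq_zero] at h1 ⊢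
      rw [← neg_eq_zero, ← h1]
      module)
  refine ⟨-γ, β, fun i => termOp_injective _ ?_⟩
  have h1 := hβ i
  rw [sub_eq_iff_eq_add] at h1
  rw [map_smul]
  change term B {i, i + 1} = _ • term H {i, i + 1}
  rw [h1]
  module

/-- If one interaction term vanished, all would by invariance. Every one-site operator commutes with
zero, so injectivity would kill the one-site terms too. Then H would be constant and [B, H] = 0. -/
theorem interaction_ne_zero {H B : FormalOp d} (hH_loc : AtMostLocal 2 H)
    (hH_inv : translateOp H = H) (hH_inj : InjectiveInteraction H) (hB_loc : AtMostLocal 2 B)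
    (hQ_ne : opComm B H ≠ 0) (i : ℤ) : H {i, i + 1} ≠ 0 := by
  intro h0
  have h1 : ∀ j : ℤ, H {j, j + 1} = 0 ↔ H {j + 1, j + 1 + 1} = 0 := by
    intro j
    rw [← term_eq_zero_iff, ← term_eq_zero_iff, ← shift_pair]
    conv_lhs => rw [← hH_inv, term_translateOp]
    simp
  have h2 : ∀ k : ℤ, H {i + k, i + k + 1} = 0 := by
    intro k
    induction k using Int.induction_on with
    | zero => rwa [add_zero]
    | succ n ih => rw [← add_assoc]; exact (h1 _).1 ih
    | pred n ih =>
      refine (h1 _).2 ?_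
      rwa [show i + (-(n : ℤ) - 1) + 1 = i + -n by ring]
  have h3 : ∀ j : ℤ, H {j, j + 1} = 0 := by
    intro j
    have := h2 (j - i)
    rwa [add_sub_cancel] at this
  have h4 : ∀ j : ℤ, term H {j} = 0 := by
    intro j
    refine hH_inj.left hH_inv j _ (term_mem_tracelessAlg _ _) ?_
    rw [(term_eq_zero_iff _ _).2 (h3 j), lie_zero]
  refine hQ_ne (formalOp_ext fun A => ?_)
  rw [term_opComm_one_local hB_loc.finiteRange (hH_loc.one_of_two h3), term_zero]
  exact Finset.sum_eq_zero fun x _ => by rw [h4, lie_zero]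

end Boost

theorem star_eq_of_isHermitian_smul {n : Type*} {M : Matrix n n ℂ} {z : ℂ} (hM : M.IsHermitian)
    (hM0 : M ≠ 0) (hz : (z • M).IsHermitian) : star z = z := by
  have h : (star z - z) • M = 0 := by
    rw [sub_smul, sub_eq_zero]
    have := hz.eq
    rwa [Matrix.conjTranspose_smul, hM.eq] at this
  exact sub_eq_zero.1 ((smul_eq_zero.1 h).resolve_right hM0)

section Boost

variable [NeZero d]

/-- The interaction of B is (αi + β)h_i, with α and β real because B and the nonzero h_i are
Hermitian. Dividing by α gives c = α and a = β/α, and R collects the remaining one-local part. -/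
theorem exists_boost_form {H B : FormalOp d}
    (hH_loc : AtMostLocal 2 H) (hH_sa : IsSelfAdj H) (hH_inv : translateOp H = H)
    (hH_inj : InjectiveInteraction H) (hH_one : OneDimTwoLocal H)
    (hB_loc : AtMostLocal 2 B) (hB_sa : IsSelfAdj B)
    (hQ_ne : opComm B H ≠ 0) (hQ_cons : IsConserved H (opComm B H)) :
    ∃ (c a : ℝ) (R : FormalOp d), c ≠ 0 ∧ AtMostLocal 1 R ∧
      B = (c : ℂ) • (standardBoost H + R + (a : ℂ) • H) := by
  obtain ⟨α, β, hαβ⟩ := exists_linear_interaction hH_loc hH_inv hH_inj hH_one hB_loc hQ_cons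
  have hreal : ∀ i : ℤ, star (α * i + β) = α * i + β := by
    intro i
    refine star_eq_of_isHermitian_smul (hH_sa {i, i + 1})
      (fun h => interaction_ne_zero hH_loc hH_inv hH_inj hB_loc hQ_ne i (Subtype.ext h)) ?_
    have := hB_sa {i, i + 1}
    rwa [hαβ i] at this
  have hβ : star β = β := by simpa using hreal 0
  have hα : star α = α := by
    have := hreal 1
    rw [Int.cast_one, mul_one, star_add, hβ] at this
    exact add_right_cancel this
  obtain ⟨β, rfl⟩ := Complex.conj_eq_iff_real.1 hβ
  obtain ⟨α, rfl⟩ := Complex.conj_eq_iff_real.1 hα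
  -- Otherwise S = B - βH is one-local with [S, H] = [B, H], and conservation reads [H, [H, S]] = 0,
  -- forcing [B, H] = 0.
  have hα0 : α ≠ 0 := by
    rintro rfl
    have hS : AtMostLocal 1 (B - (β : ℂ) • H) := by
      refine (hB_loc.sub (hH_loc.smul _)).one_of_two fun i => ?_
      rw [Pi.sub_apply, Pi.smul_apply, hαβ i]
      simp
    have h1 : opComm (B - (β : ℂ) • H) H = opComm B H := by
      rw [sub_opComm hB_loc.finiteRange (hH_loc.smul _).finiteRange hH_loc.finiteRange,
        smul_opComm hH_loc.finiteRange hH_loc.finiteRange, opComm_self hH_loc.finiteRange,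
        smul_zero, sub_zero]
    have h2 : opComm H (B - (β : ℂ) • H) = 0 := by
      refine opComm_eq_zero_of_one_local hH_loc hH_sa hH_one hS ?_
      rw [opComm_skew hH_loc.finiteRange hS.finiteRange, h1, opComm_neg hH_loc.finiteRange
        (hB_loc.finiteRange.opComm hH_loc.finiteRange), hQ_cons, neg_zero]
    rw [opComm_skew hH_loc.finiteRange hS.finiteRange, h1, neg_eq_zero] at h2
    exact hQ_ne h2
  have hαc : (α : ℂ) ≠ 0 := by exact_mod_cast hα0
  refine ⟨α, β / α, (α : ℂ)⁻¹ • (B - (α : ℂ) • standardBoost H - (β : ℂ) • H), hα0, ?_, ?_⟩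
  · refine AtMostLocal.smul (AtMostLocal.one_of_two
      ((hB_loc.sub (hH_loc.standardBoost.smul _)).sub (hH_loc.smul _)) fun i => ?_) _
    rw [Pi.sub_apply, Pi.sub_apply, Pi.smul_apply, Pi.smul_apply, hαβ i, standardBoost_pair]
    module
  · funext A
    simp only [Pi.add_apply, Pi.sub_apply, Pi.smul_apply, smul_add, smul_smul]
    rw [mul_inv_cancel₀ hαc, one_smul, show (α : ℂ) * ((β / α : ℝ) : ℂ) = β by
      push_cast; field_simp]
    module

end Boost

/-! ### The hierarchy of conserved quantities -/

section Hierarchy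

variable [NeZero d]

theorem atMostLocal_iterate_opComm {H B : FormalOp d} (hH : AtMostLocal 2 H)
    (hB : AtMostLocal 2 B) (n : ℕ) : AtMostLocal (n + 2) ((opComm B)^[n] H) := by
  induction n with
  | zero => exact hH
  | succ n ih =>
    rw [Function.iterate_succ_apply']
    exact hB.opComm (m := n + 2) (by omega) ih

theorem opComm_eq_zero_symm {Φ Ψ : FormalOp d} (hΦ : FiniteRange Φ) (hΨ : FiniteRange Ψ)
    (h : opComm Φ Ψ = 0) : opComm Ψ Φ = 0 := by
  rw [opComm_skew hΨ hΦ, h, neg_zero]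

/-- The translation changes a boost operator by `H` and a one-local operator. -/
theorem translateOp_boost_opComm {H B R Ψ : FormalOp d} {c a : ℂ} (hH_loc : AtMostLocal 2 H)
    (hH_inv : translateOp H = H) (hB_loc : AtMostLocal 2 B) (hR : AtMostLocal 1 R)
    (hB : B = c • (standardBoost H + R + a • H)) (hΨ : FiniteRange Ψ) :
    opComm (translateOp B) Ψ = opComm B Ψ + c • (opComm H Ψ + opComm (translateOp R - R) Ψ) := by
  have h : translateOp B =
      c • (translateOp (standardBoost H) + translateOp R + a • translateOp H) := by
    rw [hB]; rfl
  have h1 : translateOp B = B + c • ((H - constantTerm H) + (translateOp R - R)) := by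
    rw [h, translateOp_standardBoost hH_inv, hH_inv]
    conv_rhs => rw [hB]
    rw [← smul_add]
    congr 1
    abel
  have hK := (atMostLocal_constantTerm H).finiteRange
  have hHK := hH_loc.finiteRange.sub hK
  have hS := (hR.translateOp.sub hR).finiteRange
  rw [h1, add_opComm hB_loc.finiteRange ((hHK.add hS).smul c) hΨ, smul_opComm (hHK.add hS) hΨ,
    add_opComm hHK hS hΨ, sub_opComm hH_loc.finiteRange hK hΨ,
    opComm_of_atMostLocal_zero (atMostLocal_constantTerm H) hΨ, sub_zero]

/-- Both [B, H] and its translate are conserved, and their difference is c[T(R) - R, H]. So the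
second commutator of H with the one-local operator T(R) - R vanishes, hence also the first. -/
theorem opComm_translateOp_sub_eq_zero {H B R : FormalOp d} {c a : ℂ} (hH_loc : AtMostLocal 2 H)
    (hH_sa : IsSelfAdj H) (hH_inv : translateOp H = H) (hH_one : OneDimTwoLocal H)
    (hB_loc : AtMostLocal 2 B) (hQ_cons : IsConserved H (opComm B H)) (hc : c ≠ 0)
    (hR : AtMostLocal 1 R) (hB : B = c • (standardBoost H + R + a • H)) :
    opComm H (translateOp R - R) = 0 := by
  have hHf := hH_loc.finiteRange
  have hQf := hB_loc.finiteRange.opComm hHf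
  have hS := hR.translateOp.sub hR
  refine opComm_eq_zero_of_one_local hH_loc hH_sa hH_one hS ?_
  have h1 : translateOp (opComm B H) - opComm B H = c • opComm (translateOp R - R) H := by
    rw [translateOp_opComm hB_loc.finiteRange hHf, hH_inv,
      translateOp_boost_opComm hH_loc hH_inv hB_loc hR hB hHf, opComm_self hHf, zero_add,
      add_sub_cancel_left]
  have h2 : opComm H (translateOp (opComm B H)) = 0 := by
    have := translateOp_opComm hHf hQf
    rw [hH_inv] at this
    rw [← this, hQ_cons]
    rfl
  have h3 := congrArg (opComm H) h1
  rw [opComm_sub hHf hQf.translateOp hQf, h2, hQ_cons, sub_zero,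
    opComm_smul hHf (hS.finiteRange.opComm hHf), opComm_skew hS.finiteRange hHf,
    opComm_neg hHf (hHf.opComm hS.finiteRange)] at h3
  have h4 := (smul_eq_zero.1 h3.symm).resolve_left hc
  exact neg_eq_zero.1 h4

/-- One-local conserved quantities commute with the whole hierarchy. -/
theorem one_local_opComm_iterate {H B R : FormalOp d} {c a : ℂ} (hH_loc : AtMostLocal 2 H)
    (hH_sa : IsSelfAdj H) (hH_one : OneDimTwoLocal H)
    (hB_loc : AtMostLocal 2 B) (hQ_cons : IsConserved H (opComm B H)) (hc : c ≠ 0)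
    (hR : AtMostLocal 1 R) (hB : B = c • (standardBoost H + R + a • H)) (n : ℕ)
    {S : FormalOp d} (hS : AtMostLocal 1 S) (hHS : opComm H S = 0) :
    opComm S ((opComm B)^[n] H) = 0 := by
  have hHf := hH_loc.finiteRange
  have hBf := hB_loc.finiteRange
  have hRf := hR.finiteRange
  have hbf := hH_loc.standardBoost.finiteRange
  have hQf := hBf.opComm hHf
  -- The step replaces S by [S, R], which is again one-local and conserved, so the hypothesis must
  -- cover all such S.
  induction n generalizing S with
  | zero => exact opComm_eq_zero_symm hHf hS.finiteRange hHS
  | succ n ih =>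
    have hSf := hS.finiteRange
    have hnf := (atMostLocal_iterate_opComm hH_loc hB_loc n).finiteRange
    have hSH : opComm S H = 0 := opComm_eq_zero_symm hHf hSf hHS
    have hS' : AtMostLocal 1 (opComm S R) := hS.opComm (m := 1) le_rfl hR
    have hSB : opComm S B = c • opComm S R := by
      conv_lhs => rw [hB]
      rw [opComm_smul hSf ((hbf.add hRf).add (hHf.smul a)),
        opComm_add hSf (hbf.add hRf) (hHf.smul a), opComm_add hSf hbf hRf, opComm_smul hSf hHf, hSH,
        opComm_eq_zero_symm hbf hSf (opComm_standardBoost hHf hS hHS), smul_zero, add_zero, zero_add]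
    -- S commutes with H and with the standard boost, so [S, [B, H]] = c[[S, R], H]. The left side
    -- is conserved, and the one-local double-commutator fact applies to [S, R].
    have hHS' : opComm H (opComm S R) = 0 := by
      refine opComm_eq_zero_of_one_local hH_loc hH_sa hH_one hS' ?_
      have h1 : opComm S (opComm B H) = c • opComm (opComm S R) H := by
        rw [opComm_opComm hSf hBf hHf, hSH, opComm_zero hBf, add_zero, hSB,
          smul_opComm hS'.finiteRange hHf]
      have h2 : opComm H (opComm S (opComm B H)) = 0 := by
        rw [opComm_opComm hHf hSf hQf, hHS, hQ_cons, zero_opComm hQf, opComm_zero hSf, add_zero]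
      rw [h1, opComm_smul hHf (hS'.finiteRange.opComm hHf), opComm_skew hS'.finiteRange hHf,
        opComm_neg hHf (hHf.opComm hS'.finiteRange)] at h2
      exact neg_eq_zero.1 ((smul_eq_zero.1 h2).resolve_left hc)
    rw [Function.iterate_succ_apply', opComm_opComm hSf hBf hnf, ih hS hHS, opComm_zero hBf,
      add_zero, hSB, smul_opComm hS'.finiteRange hnf, ih hS' hHS', smul_zero]

/-- The two claims feed each other: conservation of Q^(n) makes Q^(n+1) translation-invariant, and
this invariance is what permits the double-commutator argument for the conservation of Q^(n+1). -/
theorem iterate_opComm_conserved {H B R : FormalOp d} {c a : ℂ} (hH_loc : AtMostLocal 2 H)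
    (hH_sa : IsSelfAdj H) (hH_inv : translateOp H = H) (hH_one : OneDimTwoLocal H)
    (hB_loc : AtMostLocal 2 B) (hQ_cons : IsConserved H (opComm B H)) (hc : c ≠ 0)
    (hR : AtMostLocal 1 R) (hB : B = c • (standardBoost H + R + a • H)) (n : ℕ) :
    translateOp ((opComm B)^[n] H) = (opComm B)^[n] H ∧ opComm H ((opComm B)^[n] H) = 0 := by
  have hHf := hH_loc.finiteRange
  have hBf := hB_loc.finiteRange
  have hQf := hBf.opComm hHf
  have hS := hR.translateOp.sub hR
  have hHS := opComm_translateOp_sub_eq_zero hH_loc hH_sa hH_inv hH_one hB_loc hQ_cons hc hR hB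
  induction n with
  | zero => exact ⟨hH_inv, opComm_self hHf⟩
  | succ n ih =>
    have hnl := atMostLocal_iterate_opComm hH_loc hB_loc n
    have hsl := atMostLocal_iterate_opComm hH_loc hB_loc (n + 1)
    rw [Function.iterate_succ_apply'] at hsl ⊢
    have hnf := hnl.finiteRange
    have hinv : translateOp (opComm B ((opComm B)^[n] H)) = opComm B ((opComm B)^[n] H) := by
      rw [translateOp_opComm hBf hnf, ih.1,
        translateOp_boost_opComm hH_loc hH_inv hB_loc hR hB hnf, ih.2,
        one_local_opComm_iterate hH_loc hH_sa hH_one hB_loc hQ_cons hc hR hB n hS hHS, add_zero,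
        smul_zero, add_zero]
    refine ⟨hinv, opComm_eq_zero_of_opComm_opComm hH_loc hH_sa hH_inv hsl hinv ?_⟩
    -- Jacobi rewrites [H, Q^(n+1)] as -[Q^(3), Q^(n)]. Both entries commute with H, so a further
    -- commutator with H gives zero.
    have h1 : opComm H (opComm B ((opComm B)^[n] H)) =
        opComm (-opComm B H) ((opComm B)^[n] H) := by
      rw [opComm_opComm hHf hBf hnf, ih.2, opComm_zero hBf, add_zero, opComm_skew hHf hBf]
    have hQf' : FiniteRange (-opComm B H) := by
      rw [← opComm_skew hHf hBf]; exact hHf.opComm hBf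
    rw [h1, opComm_opComm hHf hQf' hnf, ih.2, opComm_zero hQf', add_zero, opComm_neg hHf hQf,
      hQ_cons, neg_zero, zero_opComm hnf]

/-- Jacobi gives [[B, P], Q] = [B, [P, Q]] - [P, [B, Q]], so commutativity of P with the entire
hierarchy passes to [B, P]. -/
theorem iterate_opComm_commute {H B : FormalOp d} (hH_loc : AtMostLocal 2 H)
    (hB_loc : AtMostLocal 2 B) (h : ∀ n : ℕ, opComm H ((opComm B)^[n] H) = 0) (m n : ℕ) :
    opComm ((opComm B)^[m] H) ((opComm B)^[n] H) = 0 := by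
  have hBf := hB_loc.finiteRange
  have hf := fun k => (atMostLocal_iterate_opComm hH_loc hB_loc k).finiteRange
  induction m generalizing n with
  | zero => exact h n
  | succ m ih =>
    have h1 := opComm_opComm hBf (hf m) (hf n)
    rw [ih n, opComm_zero hBf, ← Function.iterate_succ_apply' (opComm B) n, ih (n + 1), add_zero,
      ← Function.iterate_succ_apply' (opComm B) m] at h1
    exact h1.symm


end Hierarchy

end SpinChain

end

theorem theorem2 {d : ℕ} (hd : 0 < d) (H B : FormalOp d)
    (hH_loc : AtMostLocal 2 H) (hH_sa : IsSelfAdj H) (hH_inv : translateOp H = H)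
    (hH_inj : InjectiveInteraction H) (hH_one : OneDimTwoLocal H)
    (hB_loc : AtMostLocal 2 B) (hB_sa : IsSelfAdj B)
    (hQ_ne : opComm B H ≠ 0) (hQ_cons : IsConserved H (opComm B H)) :
    (∀ n : ℕ, 2 ≤ n → AtMostLocal n (charge H B n) ∧
      translateOp (charge H B n) = charge H B n ∧ IsConserved H (charge H B n)) ∧
    (∀ m n : ℕ, 2 ≤ m → 2 ≤ n → opComm (charge H B m) (charge H B n) = 0) ∧
    ∃ (c a : ℝ) (R : FormalOp d), c ≠ 0 ∧ AtMostLocal 1 R ∧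
      opComm H (translateOp R - R) = 0 ∧
      B = (c : ℂ) • (standardBoost H + R + (a : ℂ) • H) := by
  have : NeZero d := ⟨hd.ne'⟩
  obtain ⟨c, a, R, hc, hR, hB⟩ :=
    exists_boost_form hH_loc hH_sa hH_inv hH_inj hH_one hB_loc hB_sa hQ_ne hQ_cons
  have hcc : (c : ℂ) ≠ 0 := by exact_mod_cast hc
  have hcons := iterate_opComm_conserved hH_loc hH_sa hH_inv hH_one hB_loc hQ_cons hcc hR hB
  refine ⟨fun n hn => ?_, fun m n _ _ => ?_, c, a, R, hc, hR, ?_, hB⟩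
  -- Q^(n) is the (n-2)-fold commutator, so n = k + 2 turns the truncated subtraction into the
  -- iteration count k.
  · obtain ⟨k, rfl⟩ := Nat.exists_eq_add_of_le' hn
    exact ⟨atMostLocal_iterate_opComm hH_loc hB_loc k, (hcons k).1, (hcons k).2⟩
  · exact iterate_opComm_commute hH_loc hB_loc (fun n => (hcons n).2) (m - 2) (n - 2)
  · exact opComm_translateOp_sub_eq_zero hH_loc hH_sa hH_inv hH_one hB_loc hQ_cons hcc hR hB
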